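/- For $m\ge 2$ let $\Lambda_{K3^{[m]}} = U^{\oplus 3}\oplus E_8(-1)^{\oplus 2}\oplus \mathbf{Z}(-(2m-2))$. For $h\in\Lambda_{K3^{[m]}}$ with $h^2>0$ let $\mathscr{D}_{h^\perp}$ be the set of $x\in\mathbf{P}(h^\perp\otimes\mathbf{C})$ with $x^2=0$ and $x\cdot\bar x>0$, and let $\widehat O(\Lambda_{K3^{[m]}},h)$ be the group of isometries of $\Lambda_{K3^{[m]}}$ that fix $h$ and act as $\pm\mathrm{id}$ on the discriminant group of $\Lambda_{K3^{[m]}}$. The period domain of $h$ is the quotient $\mathscr{P}_h=\mathscr{D}_{h^\perp}/\widehat O(\Lambda_{K3^{[m]}},h)$. For an integer $d>0$, the Heegner divisor of discriminant $d$ in $\mathscr{P}_h$ is the union of the images of $\mathbf{P}(K^\perp\otimes\mathbf{C})\cap\mathscr{D}_{h^\perp}$, where $K$ runs over the rank-$2$ sublattices of $\Lambda_{K3^{[m]}}$ of real signature $(1,1)$ that contain $h$ and satisfy $\operatorname{disc}(K^\perp)=-d$; here $\operatorname{disc}$ is the determinant of a Gram matrix. Let $h_2\in\Lambda_{K3^{[2]}}$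 have square $2$ and divisibility $1$, and let $h_3\in\Lambda_{K3^{[3]}}$ have square $4$ and divisibility $2$. Let ${}^{[2]}\mathscr{P}_2^{(1)}$ and ${}^{[3]}\mathscr{P}_4^{(2)}$ be their period domains, with Heegner divisors ${}^{[2]}\mathscr{D}_{2,d}^{(1)}$ and ${}^{[3]}\mathscr{D}_{4,d}^{(2)}$. The lattices $h_2^\perp$ and $h_3^\perp$ are isometric, and every isometry $h_2^\perp\to h_3^\perp$ induces the same map $\rho\colon{}^{[2]}\mathscr{P}_2^{(1)}\to{}^{[3]}\mathscr{P}_4^{(2)}$. Let $d$ be a positive integer. The Heegner divisor ${}^{[3]}\mathscr{D}_{4,d}^{(2)}$ is nonempty if and only if $d=2e$ for an integer $e\not\equiv 3\pmod 4$. When this is the case, ${}^{[3]}\mathscr{D}_{4,2e}^{(2)}$ is irreducible (it is a closed analytic subset of ${}^{[3]}\mathscr{P}_4^{(2)}$ that is not the union of two proper closed analytic subsets), and it is the image by $\rho$ of the Heegner divisor ${}^{[2]}\mathscr{D}_{2,2e}^{(1)}$. -/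

import Mathlib

open scoped TensorProduct LinearAlgebra.Projectivization

noncomputable section

namespace K3Heegner

/-! ### The lattices -/

abbrev K3Index := (Fin 2 × Fin 3) ⊕ (Fin 8 × Fin 2)

abbrev K3mIndex := K3Index ⊕ Unit

/-- The Gram matrix of the K3 lattice `U^3 ⊕ E₈(-1)^2`. -/
def k3Gram : Matrix K3Index K3Index ℤ :=
  Matrix.fromBlocks (Matrix.blockDiagonal fun _ : Fin 3 => !![0, 1; 1, 0]) 0
    0 (Matrix.blockDiagonal fun _ : Fin 2 => -CartanMatrix.E₈)

/-- The Gram matrix of `Λ_{K3^[m]} = Λ_{K3} ⊕ ℤ(-(2m-2))`. -/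
def k3mGram (m : ℕ) : Matrix K3mIndex K3mIndex ℤ :=
  Matrix.fromBlocks k3Gram 0 0 (Matrix.of fun _ _ => -(2 * (m : ℤ) - 2))

/-- The free abelian group underlying `Λ_{K3^[m]}`; its form is `k3mForm m`. -/
abbrev K3mLattice := K3mIndex → ℤ

def k3mForm (m : ℕ) : LinearMap.BilinForm ℤ K3mLattice := Matrix.toBilin' (k3mGram m)

section Lattice

variable {Λ : Type*} [AddCommGroup Λ] (B : LinearMap.BilinForm ℤ Λ) (h : Λ)

/-- `n` is the divisibility of `h`: the ideal `B(h, Λ)` of `ℤ` is generated by `n`. -/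
def HasDivisibility (n : ℕ) : Prop :=
  LinearMap.range (B h) = Ideal.span {(n : ℤ)}

/-- The sublattice `h^⊥`. -/
abbrev perp : Submodule ℤ Λ := LinearMap.ker (B h)

/-- The form of `h^⊥`. -/
abbrev perpForm : LinearMap.BilinForm ℤ (perp B h) := B.restrict (perp B h)

/-- The discriminant group `Λ^∨ / Λ`. -/
abbrev DiscriminantGroup := Module.Dual ℤ Λ ⧸ LinearMap.range B

variable {B} in
/-- The isometry `g` (acting on `Λ^∨` by `f ↦ f ∘ g⁻¹`) acts on the discriminant group as `id` or
as `-id`. -/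
def ActsBySign (g : B.IsometryEquiv B) : Prop :=
  ∃ ε : ℤˣ, ∀ f : Module.Dual ℤ Λ,
    (Submodule.Quotient.mk (f ∘ₗ (g.symm : Λ ≃ₗ[ℤ] Λ).toLinearMap) : DiscriminantGroup B) =
      (ε : ℤ) • Submodule.Quotient.mk f

/-- The isometries of `h^⊥` that are restrictions of elements of `Ô(Λ, h)`, the group of isometries
of `Λ` that fix `h` and act as `± id` on the discriminant group of `Λ`. -/
def InPeriodGroup (γ : (perpForm B h).IsometryEquiv (perpForm B h)) : Prop :=
  ∃ g : B.IsometryEquiv B, g h = h ∧ ActsBySign g ∧ ∀ y : perp B h, (γ y : Λ) = g y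

variable {B h}

theorem InPeriodGroup.refl :
    InPeriodGroup B h (LinearMap.BilinForm.IsometryEquiv.refl (perpForm B h)) := by
  refine ⟨LinearMap.BilinForm.IsometryEquiv.refl B, rfl, ⟨1, fun f => ?_⟩, fun y => rfl⟩
  simp only [Units.val_one, one_smul]
  rfl

theorem InPeriodGroup.symm {γ : (perpForm B h).IsometryEquiv (perpForm B h)}
    (hγ : InPeriodGroup B h γ) : InPeriodGroup B h γ.symm := by
  obtain ⟨g, gh, ⟨ε, hε⟩, hg⟩ := hγ
  refine ⟨g.symm, ?_, ⟨ε, fun f => ?_⟩, fun y => ?_⟩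
  · have : g.toLinearEquiv.symm (g.toLinearEquiv h) = h := g.toLinearEquiv.symm_apply_apply h
    have e : g.toLinearEquiv h = h := gh
    rw [e] at this
    exact this
  · have := hε (f ∘ₗ (g : Λ ≃ₗ[ℤ] Λ).toLinearMap)
    have e : (f ∘ₗ (g : Λ ≃ₗ[ℤ] Λ).toLinearMap) ∘ₗ (g.symm : Λ ≃ₗ[ℤ] Λ).toLinearMap = f := by
      ext x
      exact congrArg f (g.toLinearEquiv.apply_symm_apply x)
    rw [e] at this
    change (Submodule.Quotient.mk (f ∘ₗ (g : Λ ≃ₗ[ℤ] Λ).toLinearMap) : DiscriminantGroup B) = _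
    rw [this, smul_smul]
    rcases Int.units_eq_one_or ε with rfl | rfl <;> simp
  · have := hg (γ.symm y)
    have e : γ (γ.symm y) = y := γ.toLinearEquiv.apply_symm_apply y
    rw [e] at this
    rw [this]
    exact (g.toLinearEquiv.symm_apply_apply _).symm

theorem InPeriodGroup.trans {γ δ : (perpForm B h).IsometryEquiv (perpForm B h)}
    (hγ : InPeriodGroup B h γ) (hδ : InPeriodGroup B h δ) :
    InPeriodGroup B h (γ.trans δ) := by
  obtain ⟨g, gh, ⟨ε, hε⟩, hg⟩ := hγ
  obtain ⟨k, kh, ⟨η, hη⟩, hk⟩ := hδ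
  refine ⟨g.trans k, ?_, ⟨ε * η, fun f => ?_⟩, fun y => ?_⟩
  · change k (g h) = h
    rw [gh, kh]
  · have := hη (f ∘ₗ (g.symm : Λ ≃ₗ[ℤ] Λ).toLinearMap)
    rw [hε f, smul_smul, mul_comm, ← Units.val_mul] at this
    exact this
  · change (δ (γ y) : Λ) = k (g y)
    rw [hk, hg]

end Lattice

/-! ### Period domains -/

section Domain

variable {L L' L'' : Type*} [AddCommGroup L] [AddCommGroup L'] [AddCommGroup L'']
  (b : LinearMap.BilinForm ℤ L)

/-- Complex conjugation on `ℂ ⊗ L`. -/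
def conj : ℂ ⊗[ℤ] L →ₗ[ℤ] ℂ ⊗[ℤ] L :=
  LinearMap.rTensor L (starRingEnd ℂ).toAddMonoidHom.toIntLinearMap

/-- The vectors `v` of `ℂ ⊗ L` with `v² = 0` and `v · v̄ > 0`. -/
def periodCone : Set (ℂ ⊗[ℤ] L) :=
  {v | b.baseChange ℂ v v = 0 ∧ 0 < (b.baseChange ℂ v (conj v)).re}

/-- The period domain `{[v] ∈ ℙ(ℂ ⊗ L) | v² = 0, v · v̄ > 0}`. -/
def PeriodDomain : Type _ := {x : ℙ ℂ (ℂ ⊗[ℤ] L) // x.rep ∈ periodCone b}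

variable {b}

theorem ne_zero_of_mem_periodCone {v : ℂ ⊗[ℤ] L} (hv : v ∈ periodCone b) : v ≠ 0 := by
  rintro rfl
  simpa using hv.2

theorem conj_tmul (z : ℂ) (x : L) : conj (z ⊗ₜ[ℤ] x) = (starRingEnd ℂ z) ⊗ₜ[ℤ] x := rfl

theorem conj_smul (a : ℂ) (v : ℂ ⊗[ℤ] L) : conj (a • v) = (starRingEnd ℂ a) • conj v := by
  induction v with
  | zero => simp
  | tmul z x => simp [conj_tmul, TensorProduct.smul_tmul']
  | add x y hx hy => rw [smul_add, map_add, hx, hy, map_add, smul_add]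

theorem smul_mem_periodCone {a : ℂ} (ha : a ≠ 0) {v : ℂ ⊗[ℤ] L} (hv : v ∈ periodCone b) :
    a • v ∈ periodCone b := by
  refine ⟨by simp [hv.1], ?_⟩
  have e : b.baseChange ℂ (a • v) (conj (a • v)) =
      ((Complex.normSq a : ℝ) : ℂ) * b.baseChange ℂ v (conj v) := by
    rw [conj_smul, map_smul, map_smul, LinearMap.smul_apply, smul_eq_mul, smul_eq_mul, ← mul_assoc,
      ← Complex.mul_conj]
    ring
  rw [e, Complex.re_ofReal_mul]
  exact mul_pos (Complex.normSq_pos.2 ha) hv.2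

theorem mk_rep_mem_periodCone {v : ℂ ⊗[ℤ] L} (hv : v ∈ periodCone b) :
    (Projectivization.mk ℂ v (ne_zero_of_mem_periodCone hv)).rep ∈ periodCone b := by
  obtain ⟨a, ha⟩ := Projectivization.exists_smul_eq_mk_rep ℂ v (ne_zero_of_mem_periodCone hv)
  rw [← ha]
  exact smul_mem_periodCone a.ne_zero hv

variable (b) in
/-- The point `[v]` of the period domain. -/
def PeriodDomain.mk (v : ℂ ⊗[ℤ] L) (hv : v ∈ periodCone b) : PeriodDomain b :=
  ⟨Projectivization.mk ℂ v (ne_zero_of_mem_periodCone hv), mk_rep_mem_periodCone hv⟩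

variable {b' : LinearMap.BilinForm ℤ L'} {b'' : LinearMap.BilinForm ℤ L''}

theorem map_mem_periodCone (φ : b.IsometryEquiv b') {v : ℂ ⊗[ℤ] L} (hv : v ∈ periodCone b) :
    (φ : L ≃ₗ[ℤ] L').baseChange ℤ ℂ L L' v ∈ periodCone b' := by
  have key : ∀ x y : ℂ ⊗[ℤ] L, b'.baseChange ℂ ((φ : L ≃ₗ[ℤ] L').baseChange ℤ ℂ L L' x)
      ((φ : L ≃ₗ[ℤ] L').baseChange ℤ ℂ L L' y) = b.baseChange ℂ x y := by
    intro x y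
    induction x with
    | zero => simp
    | add x x' hx hx' => simp [hx, hx']
    | tmul z x =>
      induction y with
      | zero => simp
      | add y y' hy hy' => simp only [map_add, hy, hy']
      | tmul w y => simp
  have hc : conj ((φ : L ≃ₗ[ℤ] L').baseChange ℤ ℂ L L' v) =
      (φ : L ≃ₗ[ℤ] L').baseChange ℤ ℂ L L' (conj v) := by
    clear hv
    induction v with
    | zero => simp
    | add x y hx hy => simp only [map_add, hx, hy]
    | tmul z x => simp [conj_tmul]
  refine ⟨?_, ?_⟩
  · rw [key]; exact hv.1
  · rw [hc, key]; exact hv.2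

/-- The map between period domains induced by an isometry. -/
def PeriodDomain.map (φ : b.IsometryEquiv b') (x : PeriodDomain b) : PeriodDomain b' :=
  ⟨Projectivization.map ((φ : L ≃ₗ[ℤ] L').baseChange ℤ ℂ L L').toLinearMap
      ((φ : L ≃ₗ[ℤ] L').baseChange ℤ ℂ L L').injective x.1, by
    have h := mk_rep_mem_periodCone (map_mem_periodCone φ x.2)
    have e := Projectivization.map_mk ((φ : L ≃ₗ[ℤ] L').baseChange ℤ ℂ L L').toLinearMap
      ((φ : L ≃ₗ[ℤ] L').baseChange ℤ ℂ L L').injective x.1.rep x.1.rep_nonzero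
    rw [Projectivization.mk_rep] at e
    rw [e]
    exact h⟩

theorem PeriodDomain.map_mk (φ : b.IsometryEquiv b') {v : ℂ ⊗[ℤ] L} (hv : v ∈ periodCone b) :
    PeriodDomain.map φ (PeriodDomain.mk b v hv) =
      PeriodDomain.mk b' _ (map_mem_periodCone φ hv) :=
  rfl

theorem PeriodDomain.exists_mk (x : PeriodDomain b) :
    ∃ v, ∃ hv : v ∈ periodCone b, PeriodDomain.mk b v hv = x :=
  ⟨x.1.rep, x.2, Subtype.ext x.1.mk_rep⟩

theorem PeriodDomain.mk_congr {v w : ℂ ⊗[ℤ] L} (e : v = w) (hv : v ∈ periodCone b) :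
    PeriodDomain.mk b v hv = PeriodDomain.mk b w (e ▸ hv) := by
  subst e; rfl

theorem PeriodDomain.map_refl (x : PeriodDomain b) :
    PeriodDomain.map (LinearMap.BilinForm.IsometryEquiv.refl b) x = x := by
  obtain ⟨v, hv, rfl⟩ := x.exists_mk
  rw [PeriodDomain.map_mk]
  refine PeriodDomain.mk_congr ?_ _
  change (LinearMap.id : L →ₗ[ℤ] L).baseChange ℂ v = v
  rw [LinearMap.baseChange_id]
  rfl

theorem PeriodDomain.map_trans (φ : b.IsometryEquiv b') (ψ : b'.IsometryEquiv b'')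
    (x : PeriodDomain b) :
    PeriodDomain.map (φ.trans ψ) x = PeriodDomain.map ψ (PeriodDomain.map φ x) := by
  obtain ⟨v, hv, rfl⟩ := x.exists_mk
  simp only [PeriodDomain.map_mk]
  refine PeriodDomain.mk_congr ?_ _
  exact LinearEquiv.congr_fun (LinearEquiv.baseChange_trans ℤ ℂ L L' (φ : L ≃ₗ[ℤ] L')
    (ψ : L' ≃ₗ[ℤ] L'')) v

end Domain

/-! ### Period spaces and Heegner divisors -/

section PeriodSpace

variable {Λ : Type*} [AddCommGroup Λ] (B : LinearMap.BilinForm ℤ Λ) (h : Λ)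

/-- Two points of the period domain of `h^⊥` are equivalent if they are in the same orbit of
`Ô(Λ, h)`. -/
def periodSetoid : Setoid (PeriodDomain (perpForm B h)) where
  r x y := ∃ γ : (perpForm B h).IsometryEquiv (perpForm B h),
    InPeriodGroup B h γ ∧ PeriodDomain.map γ x = y
  iseqv :=
    { refl := fun x => ⟨_, InPeriodGroup.refl, PeriodDomain.map_refl x⟩
      symm := by
        rintro x y ⟨γ, hγ, rfl⟩
        refine ⟨γ.symm, hγ.symm, ?_⟩
        rw [← PeriodDomain.map_trans]
        have e : γ.trans γ.symm = LinearMap.BilinForm.IsometryEquiv.refl _ :=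
          DFunLike.ext _ _ fun y => γ.toLinearEquiv.symm_apply_apply y
        rw [e, PeriodDomain.map_refl]
      trans := by
        rintro x y z ⟨γ, hγ, rfl⟩ ⟨δ, hδ, rfl⟩
        exact ⟨γ.trans δ, hγ.trans hδ, PeriodDomain.map_trans γ δ x⟩ }

/-- The quotient of the period domain of `h^⊥` by `Ô(Λ, h)`. -/
def PeriodSpace : Type _ := Quotient (periodSetoid B h)

/-- The quotient map from the period domain to the period space. -/
def PeriodSpace.mk (x : PeriodDomain (perpForm B h)) : PeriodSpace B h :=
  Quotient.mk (periodSetoid B h) x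

variable [Module.Free ℤ Λ] [Module.Finite ℤ Λ]

/-- The discriminant of a sublattice: the determinant of its Gram matrix in a basis. -/
def disc (N : Submodule ℤ Λ) : ℤ :=
  (LinearMap.BilinForm.toMatrix (Module.finBasis ℤ N) (B.restrict N)).det

theorem disc_eq {ι : Type*} [Fintype ι] [DecidableEq ι] (N : Submodule ℤ Λ)
    (e : Module.Basis ι ℤ N) :
    disc B N = (LinearMap.BilinForm.toMatrix e (B.restrict N)).det := by
  unfold disc
  set c := Module.finBasis ℤ N
  set e' := e.reindex (e.indexEquiv c) with he'
  have h1 : LinearMap.BilinForm.toMatrix e' (B.restrict N) =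
      (LinearMap.BilinForm.toMatrix e (B.restrict N)).submatrix (e.indexEquiv c).symm
        (e.indexEquiv c).symm := by
    ext i j
    simp [he', LinearMap.BilinForm.toMatrix_apply]
  have h2 := congrArg Matrix.det (LinearMap.BilinForm.toMatrix_mul_basis_toMatrix c e' (B.restrict N))
  rw [h1, Matrix.det_submatrix_equiv_self, Matrix.det_mul, Matrix.det_mul,
    Matrix.det_transpose] at h2
  have h3 : (c.toMatrix e').det * (e'.toMatrix c).det = 1 := by
    rw [← Matrix.det_mul, Module.Basis.toMatrix_mul_toMatrix_flip, Matrix.det_one]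
  rcases Int.isUnit_iff.1 (IsUnit.of_mul_eq_one _ h3) with h4 | h4 <;> rw [h4] at h2 <;> linarith

/-- `K` has real signature `(1, 1)`. -/
def HasSignatureOneOne (K : Submodule ℤ Λ) : Prop :=
  sigPos ((B.restrict K).baseChange ℝ).toQuadraticMap = 1 ∧
    sigNeg ((B.restrict K).baseChange ℝ).toQuadraticMap = 1

/-- The image in the period space of `ℙ(K^⊥ ⊗ ℂ) ∩ D`, where `D` is the period domain of `h^⊥`
and `h ∈ K`. -/
def heegnerOf (K : Submodule ℤ Λ) : Set (PeriodSpace B h) :=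
  PeriodSpace.mk B h ''
    {x | x.1.submodule ≤ ((B.orthogonal K).submoduleOf (perp B h)).baseChange ℂ}

/-- The union of the `heegnerOf B h K` over the sublattices `K` of rank 2 and signature `(1, 1)`
that contain `h` and satisfy `disc(K^⊥) = -d`. -/
def heegnerDivisor (d : ℕ) : Set (PeriodSpace B h) :=
  {p | ∃ K : Submodule ℤ Λ, h ∈ K ∧ Module.finrank ℤ K = 2 ∧ HasSignatureOneOne B K ∧
    disc B (B.orthogonal K) = -(d : ℤ) ∧ p ∈ heegnerOf B h K}

end PeriodSpace

/-! ### Analytic subsets -/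

section Analytic

/-- `A ∩ D` is a closed analytic subset of `D`: near each point of `D`, it is the set of common
zeros in `D` of finitely many holomorphic functions. Here `V` is identified with some `ℂ^n` by the
choice of a basis. -/
def IsAnalyticIn {V : Type*} [AddCommGroup V] [Module ℂ V] [Module.Finite ℂ V] (D A : Set V) :
    Prop :=
  ∀ p ∈ D, ∃ U : Set (Fin (Module.finrank ℂ V) → ℂ),
    IsOpen U ∧ (Module.finBasis ℂ V).equivFun p ∈ U ∧
    ∃ (r : ℕ) (f : Fin r → (Fin (Module.finrank ℂ V) → ℂ) → ℂ),
      (∀ i, DifferentiableOn ℂ (f i) U) ∧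
      ∀ v ∈ D, (Module.finBasis ℂ V).equivFun v ∈ U →
        (v ∈ A ↔ ∀ i, f i ((Module.finBasis ℂ V).equivFun v) = 0)

variable {Λ : Type*} [AddCommGroup Λ] [Module.Free ℤ Λ] [Module.Finite ℤ Λ]
  {B : LinearMap.BilinForm ℤ Λ} {h : Λ}

/-- `Z` is a closed analytic subset of the period space: its inverse image in the cone over the
period domain is a closed analytic subset. -/
def IsClosedAnalytic (Z : Set (PeriodSpace B h)) : Prop :=
  IsAnalyticIn (periodCone (perpForm B h))
    {v | ∃ hv : v ∈ periodCone (perpForm B h),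
      PeriodSpace.mk B h (PeriodDomain.mk (perpForm B h) v hv) ∈ Z}

/-- `Z` is an irreducible closed analytic subset of the period space. -/
def IsIrreducibleAnalytic (Z : Set (PeriodSpace B h)) : Prop :=
  IsClosedAnalytic Z ∧ Z.Nonempty ∧
    ∀ Z₁ Z₂ : Set (PeriodSpace B h), IsClosedAnalytic Z₁ → IsClosedAnalytic Z₂ →
      Z ⊆ Z₁ ∪ Z₂ → Z ⊆ Z₁ ∨ Z ⊆ Z₂

end Analytic

/-! ### Every isometry of `h^⊥` is induced by `Ô(Λ_{K3^[3]}, h)` if `h² = 4` and `div(h) = 2`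

This is only needed to show that the map `rho` below is well defined. -/

/-- The inverse of the Cartan matrix of type `E₈`. -/
def e8Inv : Matrix (Fin 8) (Fin 8) ℤ :=
  !![4, 5, 7, 10, 8, 6, 4, 2;
     5, 8, 10, 15, 12, 9, 6, 3;
     7, 10, 14, 20, 16, 12, 8, 4;
     10, 15, 20, 30, 24, 18, 12, 6;
     8, 12, 16, 24, 20, 15, 10, 5;
     6, 9, 12, 18, 15, 12, 8, 4;
     4, 6, 8, 12, 10, 8, 6, 3;
     2, 3, 4, 6, 5, 4, 3, 2]

theorem k3Gram_mul_inv : k3Gram * Matrix.fromBlocks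
    (Matrix.blockDiagonal fun _ : Fin 3 => !![0, 1; 1, 0]) 0
    0 (Matrix.blockDiagonal fun _ : Fin 2 => -e8Inv) = 1 := by
  have h1 : (!![0, 1; 1, 0] : Matrix (Fin 2) (Fin 2) ℤ) * !![0, 1; 1, 0] = 1 := by decide
  have h2 : CartanMatrix.E₈ * e8Inv = 1 := by decide +kernel
  rw [k3Gram, Matrix.fromBlocks_multiply]
  simp only [Matrix.mul_zero, Matrix.zero_mul, add_zero, zero_add, ← Matrix.blockDiagonal_mul, h1,
    neg_mul_neg, h2]
  have e1 : (fun _ : Fin 3 => (1 : Matrix (Fin 2) (Fin 2) ℤ)) = 1 := rfl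
  have e2 : (fun _ : Fin 2 => (1 : Matrix (Fin 8) (Fin 8) ℤ)) = 1 := rfl
  rw [e1, e2, Matrix.blockDiagonal_one, Matrix.blockDiagonal_one, Matrix.fromBlocks_one]

theorem k3Gram_symm : k3Gram.transpose = k3Gram := by
  have h1 : (!![0, 1; 1, 0] : Matrix (Fin 2) (Fin 2) ℤ).transpose = !![0, 1; 1, 0] := by decide
  have h2 : (-CartanMatrix.E₈).transpose = -CartanMatrix.E₈ := by decide +kernel
  rw [k3Gram, Matrix.fromBlocks_transpose, Matrix.blockDiagonal_transpose,
    Matrix.blockDiagonal_transpose, h1, h2]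
  simp

theorem k3Gram_diag (i : K3Index) : Even (k3Gram i i) := by
  rcases i with ⟨i, j⟩ | ⟨i, j⟩
  · simp only [k3Gram, Matrix.fromBlocks_apply₁₁, Matrix.blockDiagonal_apply_eq]
    fin_cases i <;> simp
  · simp [k3Gram, Matrix.blockDiagonal_apply_eq]

/-- The form of the K3 lattice. -/
def k3Form : LinearMap.BilinForm ℤ (K3Index → ℤ) := Matrix.toBilin' k3Gram

theorem k3Form_symm (x y : K3Index → ℤ) : k3Form x y = k3Form y x := by
  rw [k3Form, Matrix.toBilin'_apply', Matrix.toBilin'_apply', Matrix.dotProduct_mulVec,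
    ← Matrix.mulVec_transpose, k3Gram_symm, dotProduct_comm]

theorem k3Form_even (x : K3Index → ℤ) : Even (k3Form x x) := by
  let S : Submodule ℤ (K3Index → ℤ) :=
    { carrier := {x | Even (k3Form x x)}
      zero_mem' := by simp
      add_mem' := by
        intro a b ha hb
        simp only [Set.mem_ofPred_eq, map_add, LinearMap.add_apply] at *
        rw [k3Form_symm b a]
        have e : k3Form a a + k3Form a b + (k3Form a b + k3Form b b) =
          k3Form a a + k3Form b b + 2 * k3Form a b := by ring
        rw [e]
        exact (ha.add hb).add (even_two_mul _)
      smul_mem' := by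
        intro c a ha
        simp only [Set.mem_ofPred_eq, map_smul, LinearMap.smul_apply, smul_eq_mul] at *
        exact (ha.mul_left _).mul_left _ }
  have : S = ⊤ := by
    rw [eq_top_iff, ← (Pi.basisFun ℤ K3Index).span_eq, Submodule.span_le]
    rintro _ ⟨i, rfl⟩
    change Even _
    rw [Pi.basisFun_apply, k3Form, Matrix.toBilin'_single]
    exact k3Gram_diag i
  have hx : x ∈ S := this ▸ Submodule.mem_top
  exact hx

theorem k3Form_surj (f : (K3Index → ℤ) →ₗ[ℤ] ℤ) : ∃ z, ∀ x, f x = k3Form z x := by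
  refine ⟨Matrix.vecMul (fun i => f (fun j => if i = j then 1 else 0)) (Matrix.fromBlocks
    (Matrix.blockDiagonal fun _ : Fin 3 => !![0, 1; 1, 0]) 0
    0 (Matrix.blockDiagonal fun _ : Fin 2 => -e8Inv)), fun x => ?_⟩
  rw [k3Form, Matrix.toBilin'_apply', Matrix.dotProduct_mulVec, Matrix.vecMul_vecMul,
    mul_eq_one_comm.1 k3Gram_mul_inv, Matrix.vecMul_one, LinearMap.pi_apply_eq_sum_univ f x]
  simp [dotProduct, mul_comm]

theorem dvd_of_dvd_k3Form {k : ℤ} {q : K3Index → ℤ} (hq : ∀ x, k ∣ k3Form q x) :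
    ∃ z, q = k • z := by
  have : ∀ i, k ∣ q i := by
    intro i
    obtain ⟨z, hz⟩ := k3Form_surj (LinearMap.proj i)
    have := hz q
    rw [k3Form_symm] at this
    rw [LinearMap.proj_apply] at this
    rw [this]
    exact hq z
  choose z hz using this
  exact ⟨z, funext fun i => by simp [hz i]⟩

theorem k3mForm_three (x y : K3mLattice) : k3mForm 3 x y =
    k3Form (x ∘ Sum.inl) (y ∘ Sum.inl) - 4 * x (Sum.inr ()) * y (Sum.inr ()) := by
  rw [k3mForm, k3mGram, Matrix.toBilin'_apply', k3Form, Matrix.toBilin'_apply',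
    Matrix.fromBlocks_mulVec]
  simp [dotProduct, Matrix.mulVec, Fintype.sum_sum_type]
  ring

theorem k3mForm_three_symm (x y : K3mLattice) : k3mForm 3 x y = k3mForm 3 y x := by
  rw [k3mForm_three, k3mForm_three, k3Form_symm]; ring

theorem k3mForm_three_elim (x : K3mLattice) (z : K3Index → ℤ) :
    k3mForm 3 x (Sum.elim z 0) = k3Form (x ∘ Sum.inl) z := by
  rw [k3mForm_three]; simp

theorem two_dvd_of_div {h : K3mLattice}
    (hdiv : HasDivisibility (k3mForm 3) h 2) (x : K3mLattice) : 2 ∣ k3mForm 3 h x := by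
  have : k3mForm 3 h x ∈ LinearMap.range (k3mForm 3 h) := ⟨x, rfl⟩
  rw [hdiv] at this
  exact Ideal.mem_span_singleton.1 this

theorem exists_eq_two_of_div {h : K3mLattice}
    (hdiv : HasDivisibility (k3mForm 3) h 2) : ∃ x, k3mForm 3 h x = 2 := by
  have : (2 : ℤ) ∈ LinearMap.range (k3mForm 3 h) := by
    rw [hdiv]; exact Ideal.mem_span_singleton.2 (by simp)
  exact this

theorem polarization_coords {h : K3mLattice} (hsq : k3mForm 3 h h = 4)
    (hdiv : HasDivisibility (k3mForm 3) h 2) : ∃ n : K3Index → ℤ, h ∘ Sum.inl = (2 : ℤ) • n ∧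
    k3Form n n = 1 + h (Sum.inr ()) ^ 2 ∧ Odd (h (Sum.inr ())) := by
  obtain ⟨n, hn⟩ := dvd_of_dvd_k3Form (k := 2) (q := h ∘ Sum.inl) fun z => by
    rw [← k3mForm_three_elim]; exact two_dvd_of_div hdiv _
  have e : k3Form n n = 1 + h (Sum.inr ()) ^ 2 := by
    rw [k3mForm_three, hn] at hsq
    simp only [map_smul, LinearMap.smul_apply, smul_eq_mul] at hsq
    linarith
  refine ⟨n, hn, e, ?_⟩
  have := k3Form_even n
  rw [e] at this
  by_contra hs
  rw [Int.not_odd_iff_even] at hs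
  obtain ⟨r, hr⟩ := hs
  obtain ⟨q, hq⟩ := this
  rw [hr] at hq
  have : 1 = 2 * (q - 2 * r * r) := by linarith [hq]
  omega

theorem exists_eq_add_two_smul {h : K3mLattice} (hsq : k3mForm 3 h h = 4)
    (hdiv : HasDivisibility (k3mForm 3) h 2) {y : K3mLattice} (hy : k3mForm 3 h y = 0)
    (hy2 : ∀ w, k3mForm 3 h w = 0 → 2 ∣ k3mForm 3 y w) (hy4 : 8 ∣ k3mForm 3 y y - 4) :
    ∃ t : K3mLattice, y = h + (2 : ℤ) • t := by
  obtain ⟨n, hn, hnn, s, hs⟩ := polarization_coords hsq hdiv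
  obtain ⟨x₀, hx₀⟩ := exists_eq_two_of_div hdiv
  set p := k3mForm 3 y x₀ with hp
  have h1 : ∀ x, 4 ∣ k3mForm 3 ((2 : ℤ) • y - p • h) x := by
    intro x
    obtain ⟨a, ha⟩ := two_dvd_of_div hdiv x
    obtain ⟨c, hc⟩ := hy2 (x - a • x₀) (by
      rw [map_sub, map_smul, hx₀, ha, smul_eq_mul]; ring)
    refine ⟨c, ?_⟩
    rw [map_sub, map_smul, smul_eq_mul, ← hp] at hc
    simp only [map_sub, map_smul, LinearMap.sub_apply, LinearMap.smul_apply, smul_eq_mul, ha]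
    linear_combination 2 * hc
  obtain ⟨z, hz⟩ := dvd_of_dvd_k3Form (k := 4) (q := ((2 : ℤ) • y - p • h) ∘ Sum.inl) fun z => by
    rw [← k3mForm_three_elim]; exact h1 _
  have hyz : y ∘ Sum.inl = p • n + (2 : ℤ) • z := by
    funext i
    have e1 := congrFun hz i
    have e2 := congrFun hn i
    simp only [Function.comp_apply, Pi.sub_apply, Pi.smul_apply, Pi.add_apply, smul_eq_mul] at *
    rw [e2] at e1
    linarith
  set c := y (Sum.inr ()) with hc
  rw [k3mForm_three, hn, hyz, hs, ← hc] at hy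
  rw [k3mForm_three, hyz, ← hc] at hy4
  rw [hs] at hnn
  obtain ⟨m, hm⟩ := k3Form_even z
  simp only [map_smul, map_add, LinearMap.smul_apply, LinearMap.add_apply, smul_eq_mul, hnn, hm,
    k3Form_symm z n] at hy hy4
  set u := k3Form n z with hu
  have hpe : Even p := by
    by_contra hpo
    rw [Int.not_even_iff_odd] at hpo
    obtain ⟨q, hq⟩ := hpo
    obtain ⟨k, hk⟩ := hy4
    rw [hq] at hy hk
    have h2 : 4 * u = 4 * (2 * s + 1) * c - 2 * (2 * q + 1) * (1 + (2 * s + 1) ^ 2) := by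
      linarith
    have h3 : -((2 * q + 1) ^ 2) * (1 + (2 * s + 1) ^ 2) + 4 * (2 * q + 1) * (2 * s + 1) * c
        - 4 * c ^ 2 + 8 * m - 4 = 8 * k := by
      linear_combination hk - (2 * q + 1) * h2
    have h4 : (2 : ℤ) = 4 * (-(q * q + q) * (1 + (2 * s + 1) ^ 2) - (s * s + s) +
        (2 * q + 1) * (2 * s + 1) * c - c ^ 2 + 2 * m - 1 - 2 * k) := by
      linear_combination -h3
    omega
  obtain ⟨q, hq⟩ := hpe
  have hpq : p = 2 * q := by omega
  have hco : Odd c := by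
    by_contra hce
    rw [Int.not_odd_iff_even] at hce
    obtain ⟨r, hr⟩ := hce
    obtain ⟨k, hk⟩ := hy4
    rw [hpq] at hk hy
    rw [hr] at hk hy
    have h2 : 4 * u = 8 * (2 * s + 1) * r - 4 * q * (1 + (2 * s + 1) ^ 2) := by
      linarith
    have h3 : (4 : ℤ) = 8 * (-q ^ 2 * (2 * s * s + 2 * s + 1) + 2 * q * (2 * s + 1) * r
        - 2 * r ^ 2 + m - k) := by
      linear_combination 2 * q * h2 - hk
    omega
  obtain ⟨r, hr⟩ := hco
  refine ⟨Sum.elim (q • n + z - n) (fun _ => r - s), ?_⟩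
  funext i
  rcases i with i | ⟨⟩
  · have e1 := congrFun hyz i
    have e2 := congrFun hn i
    simp only [Function.comp_apply, Pi.sub_apply, Pi.smul_apply, Pi.add_apply, smul_eq_mul,
      Sum.elim_inl] at *
    rw [e1, e2, hpq]
    ring
  · simp only [Pi.smul_apply, Pi.add_apply, smul_eq_mul, Sum.elim_inr, hs, ← hc, hr]
    ring

theorem two_smul_cancel {x y : K3mLattice} (e : (2 : ℤ) • x = (2 : ℤ) • y) : x = y := by
  funext i
  have := congrFun e i
  simp only [Pi.smul_apply, smul_eq_mul] at this
  omega

theorem exists_extension {h : K3mLattice} (hsq : k3mForm 3 h h = 4)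
    (hdiv : HasDivisibility (k3mForm 3) h 2) : ∃ A : K3mLattice →ₗ[ℤ] ℤ, (∀ x, k3mForm 3 h x = 2 * A x) ∧
    ∃ w : K3mLattice →ₗ[ℤ] perp (k3mForm 3) h, (∀ x, (w x : K3mLattice) = (2 : ℤ) • x - A x • h) ∧
    ∀ γ : (perpForm (k3mForm 3) h).IsometryEquiv (perpForm (k3mForm 3) h),
      ∃ G : K3mLattice →ₗ[ℤ] K3mLattice,
        ∀ x, (2 : ℤ) • G x = A x • h + (γ (w x) : K3mLattice) := by
  choose a ha using two_dvd_of_div hdiv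
  let A : K3mLattice →ₗ[ℤ] ℤ :=
    { toFun := a
      map_add' := fun x y => by
        have := ha (x + y)
        rw [map_add, ha, ha] at this
        omega
      map_smul' := fun c x => by
        have := ha (c • x)
        rw [map_smul, ha, smul_eq_mul] at this
        simp only [RingHom.id_apply, smul_eq_mul]
        linarith }
  have hA : ∀ x, k3mForm 3 h x = 2 * A x := ha
  let w₀ : K3mLattice →ₗ[ℤ] K3mLattice := (2 : ℤ) • LinearMap.id - A.smulRight h
  have hw₀ : ∀ x, w₀ x = (2 : ℤ) • x - A x • h := fun x => rfl
  let w : K3mLattice →ₗ[ℤ] perp (k3mForm 3) h := w₀.codRestrict _ fun x => by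
    rw [LinearMap.mem_ker, hw₀, map_sub, map_smul, map_smul, hsq, hA, smul_eq_mul, smul_eq_mul]
    ring
  have hw : ∀ x, (w x : K3mLattice) = (2 : ℤ) • x - A x • h := fun x => rfl
  refine ⟨A, hA, w, hw, fun γ => ?_⟩
  have hγ : ∀ y z : perp (k3mForm 3) h, k3mForm 3 (γ y) (γ z) = k3mForm 3 y z := fun y z =>
    γ.map_app z y
  have key : ∀ x, ∃ z : K3mLattice, (2 : ℤ) • z = A x • h + (γ (w x) : K3mLattice) := by
    intro x
    rcases Int.even_or_odd' (A x) with ⟨c, hc | hc⟩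
    · let v : perp (k3mForm 3) h := ⟨x - c • h, by
        rw [LinearMap.mem_ker, map_sub, map_smul, hsq, hA, hc, smul_eq_mul]; ring⟩
      have hv : w x = (2 : ℤ) • v := by
        apply Subtype.ext
        rw [hw, hc]
        change _ = (2 : ℤ) • (x - c • h)
        rw [smul_sub, smul_smul]
      refine ⟨c • h + γ v, ?_⟩
      rw [hv, map_smul, hc, smul_add, smul_smul]
      rfl
    · obtain ⟨t, ht⟩ := exists_eq_add_two_smul hsq hdiv (y := γ (w x)) (γ (w x)).2 (by
        intro v hv
        have e := hγ (w x) (γ.symm ⟨v, hv⟩)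
        have e' : γ (γ.symm ⟨v, hv⟩) = ⟨v, hv⟩ := γ.toLinearEquiv.apply_symm_apply _
        rw [e'] at e
        change k3mForm 3 (γ (w x)) v = _ at e
        rw [e, hw]
        have e2 : k3mForm 3 h (γ.symm ⟨v, hv⟩) = 0 := (γ.symm ⟨v, hv⟩).2
        rw [map_sub, LinearMap.sub_apply, map_smul, map_smul, LinearMap.smul_apply,
          LinearMap.smul_apply, e2, smul_zero, sub_zero]
        exact ⟨_, rfl⟩) (by
        obtain ⟨r, hr⟩ : Even (k3mForm 3 x x) := by
          rw [k3mForm_three]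
          refine (k3Form_even _).sub ?_
          exact ⟨2 * x (Sum.inr ()) * x (Sum.inr ()), by ring⟩
        have e := k3mForm_three_symm x h
        rw [hγ, hw]
        simp only [map_sub, map_smul, LinearMap.sub_apply, LinearMap.smul_apply, smul_eq_mul, hsq,
          e, hA, hc, hr]
        refine ⟨r - 2 * c * c - 2 * c - 1, ?_⟩
        ring)
      refine ⟨(c + 1) • h + t, ?_⟩
      rw [ht, hc]
      module
  choose G hG using key
  refine ⟨{ toFun := G, map_add' := fun x y => ?_, map_smul' := fun c x => ?_ }, hG⟩
  · apply two_smul_cancel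
    rw [smul_add, hG, hG, hG, map_add, map_add, map_add, Submodule.coe_add]
    module
  · apply two_smul_cancel
    rw [RingHom.id_apply, smul_comm, hG, hG, map_smul, map_smul, map_smul, Submodule.coe_smul]
    module

theorem actsBySign_three (g : (k3mForm 3).IsometryEquiv (k3mForm 3)) : ActsBySign g := by
  set δ : K3mLattice := Sum.elim 0 1 with hδ
  have hδx : ∀ x, k3mForm 3 δ x = -4 * x (Sum.inr ()) := by
    intro x
    rw [k3mForm_three]
    have : δ ∘ Sum.inl = 0 := rfl
    rw [this]
    simp [hδ]
  set t : K3mLattice := g δ with ht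
  have hgs : ∀ x, g (g.symm x) = x := fun x => g.toLinearEquiv.apply_symm_apply x
  have htx : ∀ x, k3mForm 3 t x = -4 * (g.symm x) (Sum.inr ()) := by
    intro x
    rw [← hδx, ← g.map_app (g.symm x) δ, hgs]
  obtain ⟨q, hq⟩ := dvd_of_dvd_k3Form (k := 4) (q := t ∘ Sum.inl) fun z => by
    rw [← k3mForm_three_elim, htx]
    exact ⟨_, by rw [neg_mul]; exact (mul_neg _ _).symm⟩
  set c := t (Sum.inr ()) with hc
  have hco : Odd c := by
    by_contra hce
    rw [Int.not_odd_iff_even] at hce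
    obtain ⟨r, hr⟩ := hce
    have e := g.map_app δ δ
    rw [← ht, hδx, k3mForm_three, hq, ← hc, hr] at e
    simp only [map_smul, LinearMap.smul_apply, smul_eq_mul, hδ, Sum.elim_inr, Pi.one_apply] at e
    have : (1 : ℤ) = 4 * (r * r - k3Form q q) := by linarith
    omega
  obtain ⟨ε, k, hk⟩ : ∃ ε : ℤˣ, ∃ k : ℤ, c = ε + 4 * k := by
    obtain ⟨r, hr⟩ := hco
    rcases Int.even_or_odd' r with ⟨k, hk | hk⟩
    · exact ⟨1, k, by simp; omega⟩
    · exact ⟨-1, k + 1, by simp; omega⟩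
  refine ⟨ε, fun f => ?_⟩
  rw [← Submodule.Quotient.mk_smul, Submodule.Quotient.eq]
  let i₁ : (K3Index → ℤ) →ₗ[ℤ] K3mLattice :=
    { toFun := fun z => Sum.elim z 0
      map_add' := fun x y => by funext i; rcases i with i | i <;> simp
      map_smul' := fun a x => by funext i; rcases i with i | i <;> simp }
  obtain ⟨z, hz⟩ := k3Form_surj (f ∘ₗ i₁)
  have hf : ∀ x, f x = k3mForm 3 (Sum.elim z 0) x + f δ * x (Sum.inr ()) := by
    intro x
    have e : x = i₁ (x ∘ Sum.inl) + x (Sum.inr ()) • δ := by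
      funext i
      rcases i with i | ⟨⟩ <;> simp [i₁, hδ]
    have e2 := hz (x ∘ Sum.inl)
    rw [LinearMap.comp_apply] at e2
    conv_lhs => rw [e, map_add, e2, map_smul, smul_eq_mul]
    rw [k3mForm_three_symm, k3mForm_three_elim, k3Form_symm]
    ring
  refine ⟨g (Sum.elim z 0) - f δ • (Sum.elim q 0 : K3mLattice) - (f δ * k) • δ -
    (ε : ℤ) • (Sum.elim z 0 : K3mLattice), LinearMap.ext fun x => ?_⟩
  have e1 := g.map_app (g.symm x) (Sum.elim z 0)
  rw [hgs] at e1
  have e3 := htx x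
  rw [k3mForm_three, hq, ← hc, map_smul, LinearMap.smul_apply, smul_eq_mul, hk] at e3
  have e4 : k3mForm 3 (Sum.elim q 0) x = k3Form q (x ∘ Sum.inl) := by
    rw [k3mForm_three_symm, k3mForm_three_elim, k3Form_symm]
  change _ = f (g.symm x) - (ε : ℤ) * f x
  rw [hf (g.symm x), hf x]
  simp only [map_sub, map_smul, LinearMap.sub_apply, LinearMap.smul_apply, smul_eq_mul, e1, e4, hδx]
  linarith [congrArg (fun y => f δ * y) e3]

theorem inPeriodGroup_of_sq_of_div {h : K3mLattice} (hsq : k3mForm 3 h h = 4)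
    (hdiv : HasDivisibility (k3mForm 3) h 2)
    (γ : (perpForm (k3mForm 3) h).IsometryEquiv (perpForm (k3mForm 3) h)) :
    InPeriodGroup (k3mForm 3) h γ := by
  obtain ⟨A, hA, w, hw, H⟩ := exists_extension hsq hdiv
  have hperp : ∀ y : perp (k3mForm 3) h, k3mForm 3 h y = 0 := fun y => y.2
  have hAG : ∀ (δ : (perpForm (k3mForm 3) h).IsometryEquiv (perpForm (k3mForm 3) h))
      (G : K3mLattice →ₗ[ℤ] K3mLattice)
      (_ : ∀ x, (2 : ℤ) • G x = A x • h + (δ (w x) : K3mLattice)) (x : K3mLattice),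
      A (G x) = A x ∧ w (G x) = δ (w x) := by
    intro δ G hG x
    have e := congrArg (k3mForm 3 h) (hG x)
    rw [map_smul, map_add, map_smul, hsq, hperp, hA, smul_eq_mul, smul_eq_mul] at e
    have e1 : A (G x) = A x := by linarith
    refine ⟨e1, Subtype.ext ?_⟩
    rw [hw, hG, e1, add_sub_cancel_left]
  have hinv : ∀ (δ η : (perpForm (k3mForm 3) h).IsometryEquiv (perpForm (k3mForm 3) h))
      (_ : ∀ y, η (δ y) = y) (G G' : K3mLattice →ₗ[ℤ] K3mLattice)
      (_ : ∀ x, (2 : ℤ) • G x = A x • h + (δ (w x) : K3mLattice))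
      (_ : ∀ x, (2 : ℤ) • G' x = A x • h + (η (w x) : K3mLattice)) (x : K3mLattice),
      G' (G x) = x := by
    intro δ η hδη G G' hG hG' x
    apply two_smul_cancel
    rw [hG', (hAG δ G hG x).1, (hAG δ G hG x).2, hδη, hw]
    abel
  obtain ⟨G, hG⟩ := H γ
  obtain ⟨G', hG'⟩ := H γ.symm
  let g : (k3mForm 3).IsometryEquiv (k3mForm 3) :=
    { G with
      invFun := G'
      left_inv := hinv γ γ.symm (fun y => γ.toLinearEquiv.symm_apply_apply y) G G' hG hG'
      right_inv := hinv γ.symm γ (fun y => γ.toLinearEquiv.apply_symm_apply y) G' G hG' hG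
      map_app' := by
        intro x y
        change k3mForm 3 (G x) (G y) = k3mForm 3 x y
        have e1 : k3mForm 3 ((2 : ℤ) • G x) ((2 : ℤ) • G y) = 4 * k3mForm 3 (G x) (G y) := by
          simp only [map_smul, LinearMap.smul_apply, smul_eq_mul]
          ring
        have e2 : k3mForm 3 (γ (w x)) (γ (w y)) = k3mForm 3 (w x) (w y) :=
          γ.map_app (w y) (w x)
        have e3 : k3mForm 3 (γ (w x)) h = 0 := by rw [k3mForm_three_symm, hperp]
        have e4 := k3mForm_three_symm x h
        rw [hG, hG] at e1
        simp only [map_add, map_sub, map_smul, LinearMap.add_apply, LinearMap.smul_apply,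
          LinearMap.sub_apply, smul_eq_mul, hsq, hperp, e2, e3, hw, hA, e4] at e1
        linarith }
  have hg : ∀ x, g x = G x := fun _ => rfl
  have hAh : A h = 2 := by
    have := hA h
    rw [hsq] at this
    omega
  refine ⟨g, ?_, actsBySign_three g, fun y => ?_⟩
  · apply two_smul_cancel
    have e : w h = 0 := Subtype.ext (by rw [hw, hAh, sub_self]; rfl)
    rw [hg, hG, hAh, e, map_zero]
    simp
  · apply two_smul_cancel
    have e0 : A y = 0 := by
      have := hA y
      rw [hperp] at this
      omega
    have e : w y = (2 : ℤ) • y := Subtype.ext (by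
      rw [hw, e0, zero_smul, sub_zero]; rfl)
    rw [hg, hG, e0, e, map_smul, zero_smul, zero_add]
    rfl

/-! ### The map `ρ` -/

section Rho

variable {h₂ h₃ : K3mLattice} (hsq : k3mForm 3 h₃ h₃ = 4)
  (hdiv : HasDivisibility (k3mForm 3) h₃ 2)
  (φ : (perpForm (k3mForm 2) h₂).IsometryEquiv (perpForm (k3mForm 3) h₃))

/-- The map between period spaces induced by an isometry `φ : h₂^⊥ ≃ h₃^⊥`. -/
def rho : PeriodSpace (k3mForm 2) h₂ → PeriodSpace (k3mForm 3) h₃ :=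
  Quotient.map (sa := periodSetoid (k3mForm 2) h₂) (sb := periodSetoid (k3mForm 3) h₃)
    (PeriodDomain.map φ) (by
      rintro x y ⟨γ, -, rfl⟩
      refine ⟨(φ.symm.trans γ).trans φ, inPeriodGroup_of_sq_of_div hsq hdiv _, ?_⟩
      rw [← PeriodDomain.map_trans, ← PeriodDomain.map_trans]
      congr 1
      refine DFunLike.ext _ _ fun z => ?_
      change φ (γ (φ.symm (φ z))) = φ (γ z)
      congr 2
      exact φ.toLinearEquiv.symm_apply_apply z)

theorem rho_mk (x : PeriodDomain (perpForm (k3mForm 2) h₂)) :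
    rho hsq hdiv φ (PeriodSpace.mk _ _ x) = PeriodSpace.mk _ _ (PeriodDomain.map φ x) :=
  rfl

/-- `rho` does not depend on the choice of the isometry. -/
theorem rho_eq (ψ : (perpForm (k3mForm 2) h₂).IsometryEquiv (perpForm (k3mForm 3) h₃)) :
    rho hsq hdiv φ = rho hsq hdiv ψ := by
  funext p
  obtain ⟨x, rfl⟩ := Quotient.exists_rep p
  refine Quotient.sound (s := periodSetoid (k3mForm 3) h₃) ?_
  refine ⟨φ.symm.trans ψ, inPeriodGroup_of_sq_of_div hsq hdiv _, ?_⟩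
  rw [← PeriodDomain.map_trans]
  congr 1
  refine DFunLike.ext _ _ fun z => ?_
  change ψ (φ.symm (φ z)) = ψ z
  congr 1
  exact φ.toLinearEquiv.symm_apply_apply z

end Rho

end K3Heegner

end

open scoped TensorProduct LinearAlgebra.Projectivization

noncomputable section

namespace K3Heegner

/-! ### Isometries of lattices containing two hyperbolic planes -/

section IsometryRel

variable {L L' : Type*} [AddCommGroup L] [AddCommGroup L']

/-! Both `h₂^⊥` and `h₃^⊥` are isometric to the model lattice M = U² ⊕ ℤ(-2)² ⊕ E₈(-1)² of
discriminant 4 (`model_equivalent_perp_two`, `model_equivalent_perp_three`). A sublattice K of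
signature (1,1) containing h meets `h^⊥` in rank one; if β ≠ 0 lies in K ∩ `h^⊥`, then β² < 0 and
`K^⊥` is the complement of β in `h^⊥`. So a Heegner divisor is the image of a locus that depends
only on the lattice `h^⊥` (`heegnerDivisor_eq`), and an isometry `h₂^⊥ ≅ h₃^⊥` carries one locus
onto the other. This is the statement about ρ.

By `inPeriodGroup_of_sq_of_div` the period group of h₃ is all of O(M), so the hyperplanes `β^⊥` have
to be classified up to O(M). Since M contains two hyperbolic planes, Eichler's criterion applies: up
to isometry and a rational factor, β is 2(e + q f) + a δ₁ + b δ₂ with (a, b) one of (0,0), (1,0),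
(1,1) (`exists_isometry_orthogonal_stdVector`). Its complement has discriminant 8q - 2a² - 2b²
(`disc_ker_stdVector`). Hence d = 2e with e = a² + b² - 4q. The residue of e mod 4 is 0, 1 or 2 and
determines (a, b), and then e determines q: there is no orbit if e ≡ 3 mod 4 and exactly one
otherwise.

The union of the hyperplanes is closed analytic because it is locally finite
(`exists_finite_orthogonal`): an integral vector of square -d orthogonal to a positive plane that
stays in a bounded region is itself bounded. For irreducibility, each point of the divisor is lifted
to one fixed hyperplane and to one component of the tube domain (`exists_lift`). There the
hyperplane section is convex in tube coordinates, so two points lie on a connected holomorphic curve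
(`exists_curve`), and the identity theorem on that curve (`subset_or_subset_of_curve`) rules out a
decomposition. -/

/-- An isometry from mutually inverse form-preserving linear maps. -/
def isometryOfInverse {b : LinearMap.BilinForm ℤ L} {b' : LinearMap.BilinForm ℤ L'}
    (f : L →ₗ[ℤ] L') (g : L' →ₗ[ℤ] L) (hgf : ∀ x, g (f x) = x) (hfg : ∀ x, f (g x) = x)
    (hf : ∀ x y, b' (f x) (f y) = b x y) : b.IsometryEquiv b' :=
  { f with
    invFun := g
    left_inv := hgf
    right_inv := hfg
    map_app' := hf }

/-- Two vectors are in the same orbit of the isometry group. -/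
def IsometryRel (b : LinearMap.BilinForm ℤ L) (v w : L) : Prop :=
  ∃ g : b.IsometryEquiv b, g v = w

variable {b : LinearMap.BilinForm ℤ L}

theorem IsometryRel.refl (v : L) : IsometryRel b v v :=
  ⟨LinearMap.BilinForm.IsometryEquiv.refl b, rfl⟩

theorem IsometryRel.trans {u v w : L} (h : IsometryRel b u v) (k : IsometryRel b v w) :
    IsometryRel b u w := by
  obtain ⟨g, rfl⟩ := h
  obtain ⟨g', rfl⟩ := k
  exact ⟨g.trans g', rfl⟩

theorem IsometryRel.apply_self {v w : L} (h : IsometryRel b v w) : b w w = b v v := by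
  obtain ⟨g, rfl⟩ := h
  exact g.map_app v v

theorem isometry_apply_symm {b' : LinearMap.BilinForm ℤ L'} (g : b.IsometryEquiv b') (x : L') :
    g (g.symm x) = x := g.toLinearEquiv.apply_symm_apply x

theorem isometry_symm_apply {b' : LinearMap.BilinForm ℤ L'} (g : b.IsometryEquiv b') (x : L) :
    g.symm (g x) = x := g.toLinearEquiv.symm_apply_apply x

theorem range_isometry {b' : LinearMap.BilinForm ℤ L'} (g : b.IsometryEquiv b') (v : L) :
    LinearMap.range (b' (g v)) = LinearMap.range (b v) := by
  ext n
  constructor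
  · rintro ⟨x, rfl⟩
    exact ⟨g.symm x, by rw [← g.map_app, isometry_apply_symm]⟩
  · rintro ⟨x, rfl⟩
    exact ⟨g x, g.map_app x v⟩

theorem HasDivisibility.map {b' : LinearMap.BilinForm ℤ L'} (g : b.IsometryEquiv b') {v : L}
    {t : ℕ} (h : HasDivisibility b v t) : HasDivisibility b' (g v) t :=
  (range_isometry g v).trans h

theorem HasDivisibility.dvd {v : L} {t : ℕ} (h : HasDivisibility b v t) (x : L) :
    (t : ℤ) ∣ b v x := by
  have : b v x ∈ LinearMap.range (b v) := ⟨x, rfl⟩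
  rw [h] at this
  exact Ideal.mem_span_singleton.1 this

theorem HasDivisibility.exists_eq {v : L} {t : ℕ} (h : HasDivisibility b v t) :
    ∃ x, b v x = t := by
  have : (t : ℤ) ∈ LinearMap.range (b v) := by
    rw [h]; exact Ideal.mem_span_singleton_self _
  exact this

theorem exists_hasDivisibility (b : LinearMap.BilinForm ℤ L) (v : L) :
    ∃ t : ℕ, HasDivisibility b v t := by
  obtain ⟨a, ha⟩ := (IsPrincipalIdealRing.principal (LinearMap.range (b v) : Ideal ℤ)).1
  refine ⟨a.natAbs, ?_⟩
  rw [HasDivisibility, Int.span_natAbs]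
  exact ha

end IsometryRel

/-! ### Eichler transvections and orbits of vectors in U ⊕ U ⊕ N. -/

section Eichler

variable {N : Type*} [AddCommGroup N]

/-- The orthogonal sum `U ⊕ U ⊕ N`. -/
def hypSum (B : LinearMap.BilinForm ℤ N) : LinearMap.BilinForm ℤ (ℤ × ℤ × ℤ × ℤ × N) :=
  LinearMap.mk₂ ℤ (fun v w => v.1 * w.2.1 + v.2.1 * w.1 + v.2.2.1 * w.2.2.2.1 +
    v.2.2.2.1 * w.2.2.1 + B v.2.2.2.2 w.2.2.2.2)
    (fun x y z => by simp; ring) (fun c x y => by simp; ring) (fun x y z => by simp; ring)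
    (fun c x y => by simp; ring)

theorem hypSum_apply (B : LinearMap.BilinForm ℤ N) (p q r s p' q' r' s' : ℤ) (x x' : N) :
    hypSum B (p, q, r, s, x) (p', q', r', s', x') = p * q' + q * p' + r * s' + s * r' + B x x' :=
  rfl

variable (B : LinearMap.BilinForm ℤ N)

theorem rel_swap (p q r s : ℤ) (x : N) :
    IsometryRel (hypSum B) (p, q, r, s, x) (q, p, r, s, x) := by
  let f : (ℤ × ℤ × ℤ × ℤ × N) →ₗ[ℤ] (ℤ × ℤ × ℤ × ℤ × N) :=
    { toFun := fun v => (v.2.1, v.1, v.2.2)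
      map_add' := fun _ _ => rfl
      map_smul' := fun _ _ => rfl }
  exact ⟨isometryOfInverse f f (fun _ => rfl) (fun _ => rfl) (by
    rintro ⟨p, q, r, s, x⟩ ⟨p', q', r', s', x'⟩
    simp only [f, LinearMap.coe_mk, AddHom.coe_mk, hypSum_apply]; ring), rfl⟩

theorem rel_exchange (p q r s : ℤ) (x : N) :
    IsometryRel (hypSum B) (p, q, r, s, x) (r, s, p, q, x) := by
  let f : (ℤ × ℤ × ℤ × ℤ × N) →ₗ[ℤ] (ℤ × ℤ × ℤ × ℤ × N) :=
    { toFun := fun v => (v.2.2.1, v.2.2.2.1, v.1, v.2.1, v.2.2.2.2)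
      map_add' := fun _ _ => rfl
      map_smul' := fun _ _ => rfl }
  exact ⟨isometryOfInverse f f (fun _ => rfl) (fun _ => rfl) (by
    rintro ⟨p, q, r, s, x⟩ ⟨p', q', r', s', x'⟩
    simp only [f, LinearMap.coe_mk, AddHom.coe_mk, hypSum_apply]; ring), rfl⟩

theorem rel_neg (p q r s : ℤ) (x : N) :
    IsometryRel (hypSum B) (p, q, r, s, x) (-p, -q, r, s, x) := by
  let f : (ℤ × ℤ × ℤ × ℤ × N) →ₗ[ℤ] (ℤ × ℤ × ℤ × ℤ × N) :=
    { toFun := fun v => (-v.1, -v.2.1, v.2.2)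
      map_add' := fun _ _ => by simp; constructor <;> ring
      map_smul' := fun _ _ => by simp }
  exact ⟨isometryOfInverse f f (fun _ => by simp [f]) (fun _ => by simp [f]) (by
    rintro ⟨p, q, r, s, x⟩ ⟨p', q', r', s', x'⟩
    simp only [f, LinearMap.coe_mk, AddHom.coe_mk, hypSum_apply]; ring), rfl⟩

/-- The transvection that mixes the two hyperbolic planes. It adds a multiple of p to r, which makes
the Euclidean algorithm available on coordinates. -/
theorem rel_shear (k p q r s : ℤ) (x : N) :
    IsometryRel (hypSum B) (p, q, r, s, x) (p, q - k * s, r + k * p, s, x) := by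
  let f (k : ℤ) : (ℤ × ℤ × ℤ × ℤ × N) →ₗ[ℤ] (ℤ × ℤ × ℤ × ℤ × N) :=
    { toFun := fun v => (v.1, v.2.1 - k * v.2.2.2.1, v.2.2.1 + k * v.1, v.2.2.2)
      map_add' := fun _ _ => by simp; constructor <;> ring
      map_smul' := fun _ _ => by simp; constructor <;> ring }
  exact ⟨isometryOfInverse (f k) (f (-k)) (fun _ => by simp [f]) (fun _ => by simp [f]) (by
    rintro ⟨p, q, r, s, x⟩ ⟨p', q', r', s', x'⟩
    simp only [f, LinearMap.coe_mk, AddHom.coe_mk, hypSum_apply]; ring), rfl⟩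

variable {B}

/-- Eichler transvections. -/
theorem rel_transvection (hB : ∀ x y, B x y = B y x) {a : N} {c : ℤ} (hc : B a a = 2 * c)
    (p q r s : ℤ) (x : N) :
    IsometryRel (hypSum B) (p, q, r, s, x) (p, q - B a x - c * p, r, s, x + p • a) := by
  let f (a : N) : (ℤ × ℤ × ℤ × ℤ × N) →ₗ[ℤ] (ℤ × ℤ × ℤ × ℤ × N) :=
    { toFun := fun v => (v.1, v.2.1 - B a v.2.2.2.2 - c * v.1, v.2.2.1, v.2.2.2.1,
        v.2.2.2.2 + v.1 • a)
      map_add' := fun v w => by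
        simp only [Prod.fst_add, Prod.snd_add, map_add, add_smul, Prod.mk_add_mk, Prod.mk.injEq,
          true_and]
        constructor
        · ring
        · abel
      map_smul' := fun m v => by
        simp only [Prod.smul_fst, Prod.smul_snd, map_smul, smul_eq_mul, RingHom.id_apply,
          Prod.smul_mk, Prod.mk.injEq, true_and, smul_add, mul_smul, and_true]
        ring }
  -- The inverse is the transvection along -a; the constant c is the same because a and -a have the
  -- same square.
  refine ⟨isometryOfInverse (f a) (f (-a)) (fun v => ?_) (fun v => ?_) ?_, rfl⟩
  · obtain ⟨p, q, r, s, x⟩ := v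
    simp only [f, LinearMap.coe_mk, AddHom.coe_mk, map_neg, LinearMap.neg_apply, map_add, map_smul,
      hc, smul_eq_mul, Prod.mk.injEq, true_and, smul_neg, add_neg_cancel_right, and_true]
    ring
  · obtain ⟨p, q, r, s, x⟩ := v
    simp only [f, LinearMap.coe_mk, AddHom.coe_mk, map_neg, LinearMap.neg_apply, map_add, map_smul,
      hc, smul_eq_mul, Prod.mk.injEq, true_and, smul_neg, neg_add_cancel_right, and_true]
    ring
  · rintro ⟨p, q, r, s, x⟩ ⟨p', q', r', s', x'⟩
    simp only [f, LinearMap.coe_mk, AddHom.coe_mk, hypSum_apply, map_add, LinearMap.add_apply,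
      map_smul, LinearMap.smul_apply, smul_eq_mul, hc, hB a]
    ring

/-- A form of Eichler's criterion: in `U ⊕ U ⊕ N`, a vector of divisibility `t > 0` is in the orbit
of a vector `t (e + q f) + x` with `x ∈ t N^∨`. -/
theorem exists_rel_of_hasDivisibility (hB : ∀ x y, B x y = B y x) (hev : ∀ x, Even (B x x))
    {v : ℤ × ℤ × ℤ × ℤ × N} {t : ℕ} (ht : 0 < t) (hv : HasDivisibility (hypSum B) v t) :
    ∃ (q : ℤ) (x : N), IsometryRel (hypSum B) v (t, t * q, 0, 0, x) ∧ ∀ y, (t : ℤ) ∣ B x y := by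
  -- Some vector of the orbit has nonzero first coordinate: otherwise swaps, exchanges and
  -- transvections show that v pairs to 0 with everything, against t > 0. The proof then takes the
  -- first coordinate p of least nonzero absolute value.
  have hex : ∃ n : ℕ, 0 < n ∧ ∃ w, IsometryRel (hypSum B) v w ∧ w.1.natAbs = n := by
    by_contra! hno
    have hz : ∀ w, IsometryRel (hypSum B) v w → w.1 = 0 := by
      intro w hw
      by_contra h0
      exact hno _ (Int.natAbs_pos.2 h0) w hw rfl
    obtain ⟨⟨p', q', r', s', x'⟩, hy⟩ := hv.exists_eq
    obtain ⟨p, q, r, s, x⟩ := v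
    have h0 : IsometryRel (hypSum B) (p, q, r, s, x) _ := IsometryRel.refl _
    have h1 : p = 0 := hz _ h0
    have h2 : q = 0 := hz _ (rel_swap B p q r s x)
    have h3 : r = 0 := hz _ (rel_exchange B p q r s x)
    have h4 : s = 0 := hz _ ((rel_exchange B p q r s x).trans (rel_swap B _ _ _ _ _))
    obtain ⟨c, hc⟩ := hev x'
    have h5 := hz _ ((rel_transvection hB (a := x') (c := c) (by omega) p q r s x).trans
      (rel_swap B _ _ _ _ _))
    simp only at h5
    subst h1 h2 h3 h4
    rw [hypSum_apply, hB] at hy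
    omega
  classical
  obtain ⟨hn0, ⟨p, q, r, s, x⟩, hw, hp⟩ := Nat.find_spec hex
  have hmin : ∀ w, IsometryRel (hypSum B) v w → w.1 ≠ 0 → p.natAbs ≤ w.1.natAbs := by
    intro w hw h0
    simp only at hp
    rw [hp]
    exact Nat.find_min' hex ⟨Int.natAbs_pos.2 h0, w, hw, rfl⟩
  simp only at hp
  have hp0 : p ≠ 0 := by omega
  -- Euclidean division: a shear replaces r by r mod p and an exchange makes it the first
  -- coordinate, so minimality of p forces r mod p = 0.
  have hr : ∀ {q r s x}, IsometryRel (hypSum B) v (p, q, r, s, x) → p ∣ r := by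
    intro q r s x h
    by_contra hd
    have h1 := hmin _ ((h.trans (rel_shear B (-(r / p)) _ _ _ _ _)).trans
      (rel_exchange B _ _ _ _ _))
    simp only at h1
    have e : r + -(r / p) * p = r % p := by rw [Int.emod_def]; ring
    rw [e] at h1
    have h2 := h1 fun h => hd (Int.dvd_of_emod_eq_zero h)
    have h3 := Int.emod_nonneg r hp0
    have h4 := Int.emod_lt_abs r hp0
    rw [Int.abs_eq_natAbs] at h4
    omega
  have hclear : ∀ {q r s x}, IsometryRel (hypSum B) v (p, q, r, s, x) →
      ∃ q', IsometryRel (hypSum B) v (p, q', 0, s, x) := by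
    intro q r s x h
    obtain ⟨k, hk⟩ := hr h
    have := h.trans (rel_shear B (-k) _ _ _ _ _)
    rw [hk, show p * k + -k * p = 0 by ring] at this
    exact ⟨_, this⟩
  have hsw : ∀ {q r s x}, IsometryRel (hypSum B) v (p, q, r, s, x) →
      IsometryRel (hypSum B) v (p, q, s, r, x) := fun h =>
    ((h.trans (rel_exchange B _ _ _ _ _)).trans (rel_swap B _ _ _ _ _)).trans
      (rel_exchange B _ _ _ _ _)
  obtain ⟨q₁, h1⟩ := hclear hw
  obtain ⟨q₂, h2⟩ := hclear (hsw h1)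
  -- With the planes exchanged the first coordinate is 0, so the transvection along a only puts
  -- -B(a, x) in the second one. Swapping and exchanging back moves it to the third coordinate,
  -- where `hr` applies.
  have hx : ∀ a, p ∣ B a x := by
    intro a
    obtain ⟨c, hc⟩ := hev a
    have := hr ((((h2.trans (rel_exchange B _ _ _ _ _)).trans (rel_transvection hB (a := a)
      (c := c) (by omega) _ _ _ _ _)).trans (rel_swap B _ _ _ _ _)).trans
      (by rw [zero_smul, add_zero]; exact rel_exchange B _ _ _ _ _))
    simpa using this
  -- In the same way, a shear copies -q₂ to the place where `hr` applies.
  have hq : p ∣ q₂ := by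
    have := hr (((((h2.trans (rel_exchange B _ _ _ _ _)).trans (rel_shear B 1 _ _ _ _ _))).trans
      (rel_swap B _ _ _ _ _)).trans
      (by rw [mul_zero, add_zero]; exact rel_exchange B _ _ _ _ _))
    simpa using this
  -- All pairings with (p, q₂, 0, 0, x) are now multiples of p, and p is the pairing with the second
  -- basis vector of the first plane, so |p| is the divisibility.
  have hpt : p = t ∨ p = -t := by
    obtain ⟨g, hg⟩ := h2
    have hd := hv.map g
    rw [hg] at hd
    have d1 : (t : ℤ) ∣ p := by
      have := hd.dvd (0, 1, 0, 0, 0)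
      simpa [hypSum_apply] using this
    have d2 : p ∣ t := by
      obtain ⟨⟨p', q', r', s', x'⟩, hy⟩ := hd.exists_eq
      rw [← hy, hypSum_apply]
      refine dvd_add (dvd_add (dvd_add (dvd_add ?_ ?_) ?_) ?_) ?_
      · exact dvd_mul_right _ _
      · exact hq.mul_right _
      · simp
      · simp
      · rw [hB]; exact hx _
    have := Int.natAbs_eq_of_dvd_dvd d1 d2
    omega
  obtain ⟨k, hk⟩ := hq
  have hx' : ∀ y, (t : ℤ) ∣ B x y := by
    intro y
    rw [hB]
    rcases hpt with rfl | rfl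
    · exact hx y
    · exact (neg_dvd.1 (hx y))
  rcases hpt with rfl | rfl
  · rw [hk] at h2
    exact ⟨k, x, h2, hx'⟩
  · rw [hk] at h2
    have := h2.trans (rel_neg B _ _ _ _ _)
    rw [neg_neg, ← neg_mul, neg_neg] at this
    exact ⟨k, x, this, hx'⟩

/-- A transvection along a adds t a to x, and the second coordinate stays a multiple of t because t
divides B(x, ·). Thus only the class of x modulo t N matters; q' is recovered afterwards from the
square. -/
theorem exists_rel_add_smul (hB : ∀ x y, B x y = B y x) (hev : ∀ x, Even (B x x))
    {t q : ℤ} {x : N} (hx : ∀ y, t ∣ B x y) (a : N) :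
    ∃ q', IsometryRel (hypSum B) (t, t * q, 0, 0, x) (t, t * q', 0, 0, x + t • a) := by
  obtain ⟨c, hc⟩ := hev a
  obtain ⟨k, hk⟩ := hx a
  have := rel_transvection hB (a := a) (c := c) (by omega) t (t * q) 0 0 x
  rw [hB a x, hk, mul_comm c, ← mul_sub, ← mul_sub] at this
  exact ⟨_, this⟩

end Eichler

/-! ### Coordinates -/

section Forms

variable (R : Type*) [CommRing R]

/-- The form of the lattice `E₈ ⊕ E₈` with coefficients in `R`. -/
def e8Form : LinearMap.BilinForm R (Fin 8 × Fin 2 → R) :=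
  LinearMap.mk₂ R (fun x y => ∑ k, ∑ i, ∑ j, (CartanMatrix.E₈ i j : R) * x (i, k) * y (j, k))
    (fun x y z => by simp only [Pi.add_apply, mul_add, add_mul, Finset.sum_add_distrib])
    (fun c x y => by
      simp only [Pi.smul_apply, smul_eq_mul, Finset.mul_sum]
      refine Finset.sum_congr rfl fun _ _ => Finset.sum_congr rfl fun _ _ =>
        Finset.sum_congr rfl fun _ _ => by ring)
    (fun x y z => by simp only [Pi.add_apply, mul_add, Finset.sum_add_distrib])
    (fun c x y => by
      simp only [Pi.smul_apply, smul_eq_mul, Finset.mul_sum]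
      refine Finset.sum_congr rfl fun _ _ => Finset.sum_congr rfl fun _ _ =>
        Finset.sum_congr rfl fun _ _ => by ring)

variable {R}

theorem e8Form_apply (x y : Fin 8 × Fin 2 → R) : e8Form R x y =
    ∑ k, ∑ i, ∑ j, (CartanMatrix.E₈ i j : R) * x (i, k) * y (j, k) := rfl

theorem e8_symm (i j : Fin 8) : CartanMatrix.E₈ i j = CartanMatrix.E₈ j i := by
  have h : CartanMatrix.E₈.transpose = CartanMatrix.E₈ := by decide +kernel
  exact congrFun (congrFun h j) i

theorem e8Form_symm (x y : Fin 8 × Fin 2 → R) : e8Form R x y = e8Form R y x := by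
  rw [e8Form_apply, e8Form_apply]
  refine Finset.sum_congr rfl fun k _ => ?_
  rw [Finset.sum_comm]
  refine Finset.sum_congr rfl fun i _ => Finset.sum_congr rfl fun j _ => ?_
  rw [e8_symm]; ring

theorem e8Form_map {S : Type*} [CommRing S] (f : R →+* S) (x y : Fin 8 × Fin 2 → R) :
    e8Form S (f ∘ x) (f ∘ y) = f (e8Form R x y) := by
  simp [e8Form_apply]

variable (R)

/-- The indices of the coordinates of the lattice `U ⊕ U ⊕ ℤ(-2) ⊕ ℤ(-2) ⊕ E₈(-1)^2`. -/
abbrev ModelIndex := Fin 6 ⊕ (Fin 8 × Fin 2)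

/-- The form of `U ⊕ ℤ(-2) ⊕ ℤ(-2) ⊕ E₈(-1)^2`, pulled back to the model lattice. -/
def tubeForm : LinearMap.BilinForm R (ModelIndex → R) :=
  LinearMap.mk₂ R (fun x y => x (.inl 0) * y (.inl 1) + x (.inl 1) * y (.inl 0) -
      2 * x (.inl 4) * y (.inl 4) - 2 * x (.inl 5) * y (.inl 5) -
      e8Form R (x ∘ Sum.inr) (y ∘ Sum.inr))
    (fun x y z => by rw [Pi.add_comp, map_add]; simp; ring)
    (fun c x y => by
      rw [show (c • x) ∘ Sum.inr = c • (x ∘ Sum.inr : Fin 8 × Fin 2 → R) from rfl, map_smul]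
      simp; ring)
    (fun x y z => by rw [Pi.add_comp, map_add]; simp; ring)
    (fun c x y => by
      rw [show (c • y) ∘ Sum.inr = c • (y ∘ Sum.inr : Fin 8 × Fin 2 → R) from rfl, map_smul]
      simp; ring)

/-- The form of the model lattice `U ⊕ U ⊕ ℤ(-2) ⊕ ℤ(-2) ⊕ E₈(-1)^2`. -/
def modelForm : LinearMap.BilinForm R (ModelIndex → R) :=
  LinearMap.mk₂ R (fun x y => tubeForm R x y + x (.inl 2) * y (.inl 3) + x (.inl 3) * y (.inl 2))
    (fun x y z => by simp; ring) (fun c x y => by simp; ring)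
    (fun x y z => by simp; ring) (fun c x y => by simp; ring)

variable {R}

theorem tubeForm_apply (x y : ModelIndex → R) : tubeForm R x y =
    x (.inl 0) * y (.inl 1) + x (.inl 1) * y (.inl 0) -
      2 * x (.inl 4) * y (.inl 4) - 2 * x (.inl 5) * y (.inl 5) -
      e8Form R (x ∘ Sum.inr) (y ∘ Sum.inr) := rfl

theorem modelForm_apply (x y : ModelIndex → R) : modelForm R x y =
    tubeForm R x y + x (.inl 2) * y (.inl 3) + x (.inl 3) * y (.inl 2) := rfl

theorem tubeForm_symm (x y : ModelIndex → R) : tubeForm R x y = tubeForm R y x := by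
  rw [tubeForm_apply, tubeForm_apply, e8Form_symm]; ring

theorem modelForm_symm (x y : ModelIndex → R) : modelForm R x y = modelForm R y x := by
  rw [modelForm_apply, modelForm_apply, tubeForm_symm]; ring

theorem tubeForm_map {S : Type*} [CommRing S] (f : R →+* S) (x y : ModelIndex → R) :
    tubeForm S (f ∘ x) (f ∘ y) = f (tubeForm R x y) := by
  simp only [tubeForm_apply, Function.comp_apply, Function.comp_assoc, e8Form_map, map_sub, map_add,
    map_mul, map_ofNat]

theorem modelForm_map {S : Type*} [CommRing S] (f : R →+* S) (x y : ModelIndex → R) :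
    modelForm S (f ∘ x) (f ∘ y) = f (modelForm R x y) := by
  simp only [modelForm_apply, tubeForm_map, Function.comp_apply, map_add, map_mul]

end Forms

theorem k3Form_coords (x y : K3Index → ℤ) : k3Form x y =
    (∑ k, (x (.inl (0, k)) * y (.inl (1, k)) + x (.inl (1, k)) * y (.inl (0, k)))) -
      e8Form ℤ (x ∘ Sum.inr) (y ∘ Sum.inr) := by
  -- A block-diagonal form with equal blocks, regrouped as a sum over the blocks; used for U³ and
  -- for E₈(-1)².
  have e : ∀ n : ℕ, ∀ G : Fin n → Fin n → ℤ, ∀ m : ℕ, ∀ a b : Fin n × Fin m → ℤ,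
      ∑ p, a p * ∑ q, Matrix.blockDiagonal (fun _ : Fin m => Matrix.of G) p q * b q =
        ∑ k, ∑ i, ∑ j, G i j * a (i, k) * b (j, k) := by
    intro n G m a b
    rw [Fintype.sum_prod_type_right]
    refine Finset.sum_congr rfl fun k _ => Finset.sum_congr rfl fun i _ => ?_
    rw [Fintype.sum_prod_type_right, Finset.mul_sum, Finset.sum_eq_single k]
    · rw [Finset.mul_sum]
      refine Finset.sum_congr rfl fun j _ => ?_
      rw [Matrix.blockDiagonal_apply_eq, Matrix.of_apply]
      ring
    · intro l _ hl
      simp [Matrix.blockDiagonal_apply_ne _ _ _ hl.symm]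
    · simp
  rw [k3Form, Matrix.toBilin'_apply', k3Gram, Matrix.fromBlocks_mulVec]
  simp only [dotProduct, Fintype.sum_sum_type, Sum.elim_inl, Sum.elim_inr, Matrix.zero_mulVec,
    add_zero, zero_add, Matrix.mulVec, Function.comp_apply]
  rw [sub_eq_add_neg]
  congr 1
  · refine (e 2 !![0, 1; 1, 0] 3 (fun p => x (.inl p)) (fun p => y (.inl p))).trans ?_
    simp [Fin.sum_univ_succ]
  · refine (e 8 (-CartanMatrix.E₈) 2 (fun p => x (.inr p)) (fun p => y (.inr p))).trans ?_
    simp [e8Form_apply]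

theorem e8Form_eq_k3Form (x y : Fin 8 × Fin 2 → ℤ) :
    e8Form ℤ x y = -k3Form (Sum.elim 0 x) (Sum.elim 0 y) := by
  rw [k3Form_coords]; simp

theorem e8Form_even (x : Fin 8 × Fin 2 → ℤ) : Even (e8Form ℤ x x) := by
  rw [e8Form_eq_k3Form]
  exact (k3Form_even _).neg

/-- E₈² is unimodular. Extending x by zero reduces this to the unimodularity of the K3 lattice. -/
theorem exists_eq_smul_of_dvd_e8Form {t : ℤ} {x : Fin 8 × Fin 2 → ℤ}
    (h : ∀ y, t ∣ e8Form ℤ x y) : ∃ z, x = t • z := by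
  obtain ⟨z, hz⟩ := dvd_of_dvd_k3Form (k := t) (q := Sum.elim 0 x) fun y => by
    have := h (y ∘ Sum.inr)
    rw [k3Form_coords]
    simpa using this
  exact ⟨z ∘ Sum.inr, funext fun i => congrFun hz (.inr i)⟩

theorem k3mForm_coords (m : ℕ) (x y : K3mLattice) : k3mForm m x y =
    k3Form (x ∘ Sum.inl) (y ∘ Sum.inl) - 2 * ((m : ℤ) - 1) * x (.inr ()) * y (.inr ()) := by
  rw [k3mForm, k3mGram, Matrix.toBilin'_apply', k3Form, Matrix.toBilin'_apply',
    Matrix.fromBlocks_mulVec]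
  simp [dotProduct, Matrix.mulVec, Fintype.sum_sum_type]
  ring

/-! ### The K3^[m] lattices and the model lattice as sums `U ⊕ U ⊕ N` -/

/-- The form of `U ⊕ E₈(-1)^2 ⊕ ℤ(-2c)`. -/
def k3mComplement (c : ℤ) : LinearMap.BilinForm ℤ (ℤ × ℤ × (Fin 8 × Fin 2 → ℤ) × ℤ) :=
  LinearMap.mk₂ ℤ (fun v w => v.1 * w.2.1 + v.2.1 * w.1 - e8Form ℤ v.2.2.1 w.2.2.1 -
      2 * c * v.2.2.2 * w.2.2.2)
    (fun x y z => by simp; ring)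
    (fun c x y => by
      simp only [Prod.smul_fst, Prod.smul_snd, map_smul, LinearMap.smul_apply, smul_eq_mul]
      ring)
    (fun x y z => by simp; ring)
    (fun c x y => by
      simp only [Prod.smul_fst, Prod.smul_snd, map_smul, smul_eq_mul]
      ring)

theorem k3mComplement_apply (c u v a u' v' a' : ℤ) (y y' : Fin 8 × Fin 2 → ℤ) :
    k3mComplement c (u, v, y, a) (u', v', y', a') =
      u * v' + v * u' - e8Form ℤ y y' - 2 * c * a * a' := rfl

theorem k3mComplement_symm (c : ℤ) (x y) : k3mComplement c x y = k3mComplement c y x := by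
  obtain ⟨u, v, z, a⟩ := x
  obtain ⟨u', v', z', a'⟩ := y
  rw [k3mComplement_apply, k3mComplement_apply, e8Form_symm]; ring

theorem k3mComplement_even (c : ℤ) (x) : Even (k3mComplement c x x) := by
  obtain ⟨u, v, z, a⟩ := x
  obtain ⟨k, hk⟩ := e8Form_even z
  rw [k3mComplement_apply, hk]
  exact ⟨u * v - k - c * a * a, by ring⟩

/-- The decomposition `Λ_{K3^[m]} = U ⊕ U ⊕ (U ⊕ E₈(-1)^2 ⊕ ℤ(-(2m-2)))`. -/
def k3mIsometry (m : ℕ) : (k3mForm m).IsometryEquiv (hypSum (k3mComplement (m - 1))) :=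
  isometryOfInverse
    { toFun := fun x => (x (.inl (.inl (0, 0))), x (.inl (.inl (1, 0))), x (.inl (.inl (0, 1))),
        x (.inl (.inl (1, 1))), x (.inl (.inl (0, 2))), x (.inl (.inl (1, 2))),
        fun i => x (.inl (.inr i)), x (.inr ()))
      map_add' := fun _ _ => rfl
      map_smul' := fun _ _ => rfl }
    { toFun := fun v => Sum.elim (Sum.elim (fun i => !![v.1, v.2.2.1, v.2.2.2.2.1;
          v.2.1, v.2.2.2.1, v.2.2.2.2.2.1] i.1 i.2) v.2.2.2.2.2.2.1) fun _ => v.2.2.2.2.2.2.2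
      map_add' := fun v w => by
        funext i
        rcases i with (⟨i, j⟩ | i) | i
        · fin_cases i <;> fin_cases j <;> rfl
        · rfl
        · rfl
      map_smul' := fun c w => by
        funext i
        rcases i with (⟨i, j⟩ | i) | i
        · fin_cases i <;> fin_cases j <;> rfl
        · rfl
        · rfl }
    (fun x => by
      funext i
      rcases i with (⟨i, j⟩ | i) | i
      · fin_cases i <;> fin_cases j <;> rfl
      · rfl
      · rfl)
    (fun _ => rfl)
    (fun x y => by
      simp only [LinearMap.coe_mk, AddHom.coe_mk, hypSum_apply, k3mComplement_apply]
      rw [k3mForm_coords, k3Form_coords, Fin.sum_univ_three]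
      simp only [Function.comp_apply]
      have e : ∀ x : K3mLattice, (x ∘ Sum.inl) ∘ Sum.inr = fun i => x (.inl (.inr i)) :=
        fun _ => rfl
      rw [e, e]
      ring)

/-- The form of `ℤ(-2) ⊕ ℤ(-2) ⊕ E₈(-1)^2`. -/
def modelComplement : LinearMap.BilinForm ℤ (ℤ × ℤ × (Fin 8 × Fin 2 → ℤ)) :=
  LinearMap.mk₂ ℤ (fun v w => -2 * v.1 * w.1 - 2 * v.2.1 * w.2.1 - e8Form ℤ v.2.2 w.2.2)
    (fun x y z => by simp; ring)
    (fun c x y => by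
      simp only [Prod.smul_fst, Prod.smul_snd, map_smul, LinearMap.smul_apply, smul_eq_mul]
      ring)
    (fun x y z => by simp; ring)
    (fun c x y => by
      simp only [Prod.smul_fst, Prod.smul_snd, map_smul, smul_eq_mul]
      ring)

theorem modelComplement_apply (a b a' b' : ℤ) (y y' : Fin 8 × Fin 2 → ℤ) :
    modelComplement (a, b, y) (a', b', y') = -2 * a * a' - 2 * b * b' - e8Form ℤ y y' := rfl

theorem modelComplement_symm (x y) : modelComplement x y = modelComplement y x := by
  obtain ⟨u, v, z⟩ := x
  obtain ⟨u', v', z'⟩ := y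
  rw [modelComplement_apply, modelComplement_apply, e8Form_symm]; ring

theorem modelComplement_even (x) : Even (modelComplement x x) := by
  obtain ⟨u, v, z⟩ := x
  obtain ⟨k, hk⟩ := e8Form_even z
  rw [modelComplement_apply, hk]
  exact ⟨-u * u - v * v - k, by ring⟩

/-- The decomposition of the model lattice as `U ⊕ U ⊕ (ℤ(-2) ⊕ ℤ(-2) ⊕ E₈(-1)^2)`. -/
def modelIsometry : (modelForm ℤ).IsometryEquiv (hypSum modelComplement) :=
  isometryOfInverse
    { toFun := fun x => (x (.inl 0), x (.inl 1), x (.inl 2), x (.inl 3), x (.inl 4), x (.inl 5),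
        fun i => x (.inr i))
      map_add' := fun _ _ => rfl
      map_smul' := fun _ _ => rfl }
    { toFun := fun v => Sum.elim ![v.1, v.2.1, v.2.2.1, v.2.2.2.1, v.2.2.2.2.1, v.2.2.2.2.2.1]
        v.2.2.2.2.2.2
      map_add' := fun v w => by
        funext i
        rcases i with i | i
        · fin_cases i <;> rfl
        · rfl
      map_smul' := fun c w => by
        funext i
        rcases i with i | i
        · fin_cases i <;> rfl
        · rfl }
    (fun x => by
      funext i
      rcases i with i | i
      · fin_cases i <;> rfl
      · rfl)
    (fun _ => rfl)
    (fun x y => by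
      simp only [LinearMap.coe_mk, AddHom.coe_mk, hypSum_apply, modelComplement_apply]
      rw [modelForm_apply, tubeForm_apply]
      have e : ∀ x : ModelIndex → ℤ, x ∘ Sum.inr = fun i => x (.inr i) := fun _ => rfl
      rw [e, e]
      ring)

/-! ### The lattices `h₂^⊥` and `h₃^⊥` -/

section Perp

variable {L L' : Type*} [AddCommGroup L] [AddCommGroup L'] {b : LinearMap.BilinForm ℤ L}
  {b' : LinearMap.BilinForm ℤ L'}

/-- An isometry onto `h^⊥` from a linear map with a left inverse. -/
def isometryPerp (h : L') (f : L →ₗ[ℤ] L') (g : L' →ₗ[ℤ] L) (hgf : ∀ x, g (f x) = x)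
    (hh : ∀ x, b' h (f x) = 0) (hfg : ∀ y, b' h y = 0 → f (g y) = y)
    (hf : ∀ x y, b' (f x) (f y) = b x y) : b.IsometryEquiv (perpForm b' h) :=
  isometryOfInverse (f.codRestrict _ hh) (g ∘ₗ (perp b' h).subtype) hgf
    (fun y => Subtype.ext (hfg y y.2)) hf

theorem equivalent_perp_map (g : b.IsometryEquiv b') (h : L) :
    (perpForm b h).Equivalent (perpForm b' (g h)) :=
  ⟨isometryOfInverse
    (((g : L ≃ₗ[ℤ] L').toLinearMap ∘ₗ (perp b h).subtype).codRestrict _ fun y =>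
      (g.map_app y h).trans y.2)
    (((g.symm : L' ≃ₗ[ℤ] L).toLinearMap ∘ₗ (perp b' (g h)).subtype).codRestrict _ fun y => by
      change b h (g.symm y) = 0
      rw [← g.map_app, isometry_apply_symm]
      exact y.2)
    (fun y => Subtype.ext (isometry_symm_apply g y))
    (fun y => Subtype.ext (isometry_apply_symm g y))
    (fun x y => g.map_app y x)⟩

end Perp

/-- For divisibility 1, Eichler's criterion moves h to e + q' f, and h² = 2 gives q' = 1. The
complement of e + f is ℤ(e - f) = ℤ(-2) plus the other summands, one of which is the ℤ(-2) of the
K3^[2] lattice. -/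
theorem model_equivalent_perp_two {h : K3mLattice} (hsq : k3mForm 2 h h = 2)
    (hdiv : HasDivisibility (k3mForm 2) h 1) :
    (modelForm ℤ).Equivalent (perpForm (k3mForm 2) h) := by
  have hd := hdiv.map (k3mIsometry 2)
  obtain ⟨q, x, h1, hx⟩ := exists_rel_of_hasDivisibility (k3mComplement_symm _)
    (k3mComplement_even _) one_pos hd
  obtain ⟨q', h2⟩ := exists_rel_add_smul (k3mComplement_symm _) (k3mComplement_even _) hx (-x)
  have h3 := h1.trans h2
  simp only [Nat.cast_one, one_smul, add_neg_cancel, one_mul] at h3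
  have hs := h3.apply_self
  rw [(k3mIsometry 2).map_app, hsq, hypSum_apply, map_zero] at hs
  obtain rfl : q' = 1 := by omega
  obtain ⟨g, hg⟩ := h3
  refine LinearMap.BilinForm.Equivalent.trans ?_ ((equivalent_perp_map (k3mIsometry 2) h).trans
    (equivalent_perp_map g _)).symm
  rw [hg]
  refine ⟨isometryPerp _
    { toFun := fun x => (x (.inl 4), -x (.inl 4), x (.inl 0), x (.inl 1), x (.inl 2), x (.inl 3),
        fun i => x (.inr i), x (.inl 5))
      map_add' := fun x y => by
        simp only [Pi.add_apply, neg_add]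
        rfl
      map_smul' := fun c x => by
        simp only [Pi.smul_apply, smul_eq_mul, RingHom.id_apply, ← mul_neg]
        rfl }
    { toFun := fun v => Sum.elim ![v.2.2.1, v.2.2.2.1, v.2.2.2.2.1, v.2.2.2.2.2.1, v.1,
        v.2.2.2.2.2.2.2] v.2.2.2.2.2.2.1
      map_add' := fun v w => by
        funext i
        rcases i with i | i
        · fin_cases i <;> rfl
        · rfl
      map_smul' := fun c w => by
        funext i
        rcases i with i | i
        · fin_cases i <;> rfl
        · rfl }
    (fun x => by
      funext i
      rcases i with i | i
      · fin_cases i <;> rfl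
      · rfl)
    (fun x => by
      simp only [LinearMap.coe_mk, AddHom.coe_mk, hypSum_apply, map_zero, LinearMap.zero_apply]
      ring)
    (fun v hv => by
      obtain ⟨p, q, r, s, u, w, z, a⟩ := v
      rw [hypSum_apply, map_zero, LinearMap.zero_apply] at hv
      simp only [LinearMap.coe_mk, AddHom.coe_mk]
      obtain rfl : q = -p := by linarith
      rfl)
    (fun x y => by
      simp only [LinearMap.coe_mk, AddHom.coe_mk, hypSum_apply, k3mComplement_apply]
      rw [modelForm_apply, tubeForm_apply]
      have e : ∀ x : ModelIndex → ℤ, x ∘ Sum.inr = fun i => x (.inr i) := fun _ => rfl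
      rw [e, e]
      push_cast
      ring)⟩

/-- For divisibility 2, Eichler's criterion moves h to 2e + 2q' f + ε δ with δ² = -4 and ε = 0 or 1.
The equation 8q' - 4ε² = 4 forces ε = 1 and q' = 1. -/
theorem model_equivalent_perp_three {h : K3mLattice} (hsq : k3mForm 3 h h = 4)
    (hdiv : HasDivisibility (k3mForm 3) h 2) :
    (modelForm ℤ).Equivalent (perpForm (k3mForm 3) h) := by
  have hd := hdiv.map (k3mIsometry 3)
  obtain ⟨q, ⟨u, v, z, a⟩, h1, hx⟩ := exists_rel_of_hasDivisibility (k3mComplement_symm _)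
    (k3mComplement_even _) two_pos hd
  obtain ⟨u', rfl⟩ : (2 : ℤ) ∣ u := by
    simpa [k3mComplement_apply] using hx (0, 1, 0, 0)
  obtain ⟨v', rfl⟩ : (2 : ℤ) ∣ v := by
    simpa [k3mComplement_apply] using hx (1, 0, 0, 0)
  obtain ⟨z', rfl⟩ : ∃ z', z = (2 : ℤ) • z' := exists_eq_smul_of_dvd_e8Form fun y => by
    have := hx (0, 0, y, 0)
    rw [k3mComplement_apply] at this
    simpa using this
  obtain ⟨q', h2⟩ := exists_rel_add_smul (k3mComplement_symm _) (k3mComplement_even _) hx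
    (-u', -v', -z', -(a / 2))
  have h3 := h1.trans h2
  have e : ((2 * u', 2 * v', (2 : ℤ) • z', a) : ℤ × ℤ × (Fin 8 × Fin 2 → ℤ) × ℤ) +
      ((2 : ℕ) : ℤ) • (-u', -v', -z', -(a / 2)) = (0, 0, 0, a % 2) := by
    simp only [Prod.smul_mk, Prod.mk_add_mk, smul_eq_mul, Prod.mk.injEq, smul_neg]
    refine ⟨by push_cast; ring, by push_cast; ring, add_neg_cancel _, by push_cast; omega⟩
  rw [e] at h3
  have hs := h3.apply_self
  rw [(k3mIsometry 3).map_app, hsq, hypSum_apply, k3mComplement_apply, map_zero] at hs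
  push_cast at hs
  obtain ha : a % 2 = 1 := by
    rcases Int.emod_two_eq_zero_or_one a with ha | ha
    · rw [ha] at hs
      omega
    · exact ha
  rw [ha] at hs h3
  obtain rfl : q' = 1 := by omega
  obtain ⟨g, hg⟩ := h3
  refine LinearMap.BilinForm.Equivalent.trans ?_ ((equivalent_perp_map (k3mIsometry 3) h).trans
    (equivalent_perp_map g _)).symm
  rw [hg]
  -- In the plane of e, f and the line of δ, the complement of 2e + 2f + δ is given by p + q = 2a.
  -- The vectors e + f + δ and e - f form a basis of it; they are orthogonal of square -2.
  refine ⟨isometryPerp _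
    { toFun := fun x => (x (.inl 4) + x (.inl 5), x (.inl 4) - x (.inl 5), x (.inl 0), x (.inl 1),
        x (.inl 2), x (.inl 3), fun i => x (.inr i), x (.inl 4))
      map_add' := fun x y =>
        Prod.ext (add_add_add_comm _ _ _ _) (Prod.ext (add_sub_add_comm _ _ _ _) rfl)
      map_smul' := fun c x => by
        simp only [Pi.smul_apply, smul_eq_mul, RingHom.id_apply, ← mul_add, ← mul_sub]
        rfl }
    { toFun := fun v => Sum.elim ![v.2.2.1, v.2.2.2.1, v.2.2.2.2.1, v.2.2.2.2.2.1,
        v.2.2.2.2.2.2.2, v.1 - v.2.2.2.2.2.2.2] v.2.2.2.2.2.2.1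
      map_add' := fun v w => by
        funext i
        rcases i with i | i
        · fin_cases i <;> first | rfl | exact add_sub_add_comm _ _ _ _
        · rfl
      map_smul' := fun c w => by
        funext i
        rcases i with i | i
        · fin_cases i <;> first | rfl | exact (mul_sub _ _ _).symm
        · rfl }
    (fun x => by
      funext i
      rcases i with i | i
      · fin_cases i <;> first | rfl | exact add_sub_cancel_left _ _
      · rfl)
    (fun x => by
      simp only [LinearMap.coe_mk, AddHom.coe_mk, hypSum_apply, k3mComplement_apply, map_zero,
        LinearMap.zero_apply]
      push_cast
      ring)
    (fun v hv => by
      obtain ⟨p, q, r, s, u, w, z, a⟩ := v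
      rw [hypSum_apply, k3mComplement_apply, map_zero, LinearMap.zero_apply] at hv
      push_cast at hv
      have h1 : a + (p - a) = p := by ring
      have h2 : a - (p - a) = q := by linarith
      change (a + (p - a), a - (p - a), r, s, u, w, z, a) = _
      rw [h1, h2])
    (fun x y => by
      simp only [LinearMap.coe_mk, AddHom.coe_mk, hypSum_apply, k3mComplement_apply]
      rw [modelForm_apply, tubeForm_apply]
      have e : ∀ x : ModelIndex → ℤ, x ∘ Sum.inr = fun i => x (.inr i) := fun _ => rfl
      rw [e, e]
      push_cast
      ring)⟩

/-! ### Orthogonal complements of negative vectors in the model lattice -/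

/-- The vectors `2 (e + q f) + a δ₁ + b δ₂`. Every vector of negative square is orthogonal to the
same vectors as some translate of one of these. -/
def stdVector (q a b : ℤ) : ModelIndex → ℤ := Sum.elim ![2, 2 * q, 0, 0, a, b] 0

theorem modelForm_stdVector (q a b : ℤ) (x : ModelIndex → ℤ) : modelForm ℤ (stdVector q a b) x =
    2 * (q * x (.inl 0) + x (.inl 1) - a * x (.inl 4) - b * x (.inl 5)) := by
  rw [modelForm_apply, tubeForm_apply,
    show stdVector q a b ∘ Sum.inr = (0 : Fin 8 × Fin 2 → ℤ) from rfl, map_zero,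
    LinearMap.zero_apply]
  change 2 * x (.inl 1) + 2 * q * x (.inl 0) - 2 * a * x (.inl 4) - 2 * b * x (.inl 5) - 0 +
    0 * x (.inl 3) + 0 * x (.inl 2) = _
  ring

/-- This number is also the discriminant of the orthogonal complement, by `disc_ker_stdVector`. So
every Heegner hyperplane is orthogonal to a vector of square exactly -d, which is what local
finiteness needs. -/
theorem modelForm_stdVector_self (q a b : ℤ) :
    modelForm ℤ (stdVector q a b) (stdVector q a b) = 8 * q - 2 * a ^ 2 - 2 * b ^ 2 := by
  rw [modelForm_stdVector]
  change 2 * (q * 2 + 2 * q - a * a - b * b) = _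
  ring

theorem rel_swap_delta (p q r s a b : ℤ) (z : Fin 8 × Fin 2 → ℤ) :
    IsometryRel (hypSum modelComplement) (p, q, r, s, a, b, z) (p, q, r, s, b, a, z) := by
  let f : (ℤ × ℤ × ℤ × ℤ × ℤ × ℤ × (Fin 8 × Fin 2 → ℤ)) →ₗ[ℤ]
      (ℤ × ℤ × ℤ × ℤ × ℤ × ℤ × (Fin 8 × Fin 2 → ℤ)) :=
    { toFun := fun v => (v.1, v.2.1, v.2.2.1, v.2.2.2.1, v.2.2.2.2.2.1, v.2.2.2.2.1,
        v.2.2.2.2.2.2)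
      map_add' := fun _ _ => rfl
      map_smul' := fun _ _ => rfl }
  exact ⟨isometryOfInverse f f (fun _ => rfl) (fun _ => rfl) (by
    rintro ⟨p, q, r, s, a, b, x⟩ ⟨p', q', r', s', a', b', x'⟩
    simp only [f, LinearMap.coe_mk, AddHom.coe_mk, hypSum_apply, modelComplement_apply]; ring), rfl⟩

theorem modelIsometry_stdVector (q a b : ℤ) :
    modelIsometry (stdVector q a b) = (2, 2 * q, 0, 0, a, b, 0) := rfl

/-- If t is the divisibility of β, Eichler's criterion and the unimodularity of E₈ move β to t(e +
q' f) + a δ₁ + b δ₂ with t dividing 2a and 2b. Multiplying by 2/t keeps the orthogonal complement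
and gives first coordinate 2 and integral δ-coordinates a', b'. Transvections then reduce a', b' mod
2, and exchanging δ₁ and δ₂ leaves three cases. -/
theorem exists_isometry_orthogonal_stdVector {β : ModelIndex → ℤ} (hβ : modelForm ℤ β β < 0) :
    ∃ (g : (modelForm ℤ).IsometryEquiv (modelForm ℤ)) (q a b : ℤ),
      (a = 0 ∧ b = 0 ∨ a = 1 ∧ b = 0 ∨ a = 1 ∧ b = 1) ∧
      ∀ x, modelForm ℤ β x = 0 ↔ modelForm ℤ (stdVector q a b) (g x) = 0 := by
  obtain ⟨t, ht⟩ := exists_hasDivisibility (modelForm ℤ) β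
  have ht0 : 0 < t := by
    rcases Nat.eq_zero_or_pos t with rfl | h
    · have := ht.dvd β
      rw [Nat.cast_zero, zero_dvd_iff] at this
      omega
    · exact h
  obtain ⟨q, ⟨a, b, z⟩, h1, hx⟩ := exists_rel_of_hasDivisibility modelComplement_symm
    modelComplement_even ht0 (ht.map modelIsometry)
  obtain ⟨a', ha'⟩ : (t : ℤ) ∣ 2 * a := by
    have := hx (-1, 0, 0)
    simpa [modelComplement_apply] using this
  obtain ⟨b', hb'⟩ : (t : ℤ) ∣ 2 * b := by
    have := hx (0, -1, 0)
    simpa [modelComplement_apply] using this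
  obtain ⟨z', rfl⟩ : ∃ z', z = (t : ℤ) • z' := exists_eq_smul_of_dvd_e8Form fun y => by
    have := hx (0, 0, -y)
    rw [modelComplement_apply] at this
    simpa using this
  obtain ⟨q', h2⟩ := exists_rel_add_smul modelComplement_symm modelComplement_even hx (0, 0, -z')
  have h3 := h1.trans h2
  have e : ((a, b, (t : ℤ) • z') : ℤ × ℤ × (Fin 8 × Fin 2 → ℤ)) + (t : ℤ) • (0, 0, -z') =
      (a, b, 0) := by
    simp only [Prod.smul_mk, Prod.mk_add_mk, smul_eq_mul, mul_zero, add_zero, smul_neg,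
      add_neg_cancel]
  rw [e] at h3
  have hdvd : ∀ y, (2 : ℤ) ∣ modelComplement (a', b', 0) y := by
    rintro ⟨c, d, z⟩
    rw [modelComplement_apply, map_zero, LinearMap.zero_apply]
    exact ⟨-a' * c - b' * d, by ring⟩
  obtain ⟨q'', h4⟩ := exists_rel_add_smul (q := q') modelComplement_symm modelComplement_even hdvd
    (-(a' / 2), -(b' / 2), 0)
  have e' : ((a', b', 0) : ℤ × ℤ × (Fin 8 × Fin 2 → ℤ)) +
      (2 : ℤ) • (-(a' / 2), -(b' / 2), 0) = (a' % 2, b' % 2, 0) := by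
    simp only [Prod.smul_mk, Prod.mk_add_mk, smul_eq_mul, smul_zero, add_zero, Prod.mk.injEq,
      and_true]
    constructor <;> omega
  rw [e'] at h4
  obtain ⟨a₀, b₀, hab, h5⟩ : ∃ a₀ b₀, (a₀ = 0 ∧ b₀ = 0 ∨ a₀ = 1 ∧ b₀ = 0 ∨ a₀ = 1 ∧ b₀ = 1) ∧
      IsometryRel (hypSum modelComplement) (2, 2 * q', 0, 0, a', b', 0)
        (2, 2 * q'', 0, 0, a₀, b₀, 0) := by
    rcases Int.emod_two_eq_zero_or_one a' with ha | ha <;>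
    rcases Int.emod_two_eq_zero_or_one b' with hb | hb <;> rw [ha, hb] at h4
    · exact ⟨0, 0, by simp, h4⟩
    · exact ⟨1, 0, by simp, h4.trans (rel_swap_delta _ _ _ _ _ _ _)⟩
    · exact ⟨1, 0, by simp, h4⟩
    · exact ⟨1, 1, by simp, h4⟩
  obtain ⟨g₁, hg₁⟩ := h3
  obtain ⟨g₂, hg₂⟩ := h5
  refine ⟨((modelIsometry.trans g₁).trans g₂).trans modelIsometry.symm, q'', a₀, b₀, hab,
    fun x => ?_⟩
  have e1 : modelForm ℤ β x =
      hypSum modelComplement (t, t * q', 0, 0, a, b, 0) (g₁ (modelIsometry x)) := by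
    rw [← hg₁, g₁.map_app, modelIsometry.map_app]
  have e2 : modelForm ℤ (stdVector q'' a₀ b₀)
      ((((modelIsometry.trans g₁).trans g₂).trans modelIsometry.symm) x) =
      hypSum modelComplement (2, 2 * q', 0, 0, a', b', 0) (g₁ (modelIsometry x)) := by
    rw [← modelIsometry.map_app, modelIsometry_stdVector, ← hg₂]
    change hypSum modelComplement _ (modelIsometry (modelIsometry.symm (g₂ (g₁ (modelIsometry x)))))
      = _
    rw [isometry_apply_symm, g₂.map_app]
  -- The rescaling by 2/t, written without denominators.
  have e3 : (2 : ℤ) • ((t, t * q', 0, 0, a, b, 0) : ℤ × ℤ × ℤ × ℤ × ℤ × ℤ × (Fin 8 × Fin 2 → ℤ)) =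
      (t : ℤ) • (2, 2 * q', 0, 0, a', b', 0) := by
    simp only [Prod.smul_mk, smul_eq_mul, mul_zero, smul_zero, ha', hb', Prod.mk.injEq, and_true]
    constructor <;> ring
  have e4 : 2 * modelForm ℤ β x = t * modelForm ℤ (stdVector q'' a₀ b₀)
      ((((modelIsometry.trans g₁).trans g₂).trans modelIsometry.symm) x) := by
    have := congrArg (fun v => hypSum modelComplement v (g₁ (modelIsometry x))) e3
    beta_reduce at this
    rwa [map_smul, map_smul, LinearMap.smul_apply, LinearMap.smul_apply, ← e1, ← e2] at this
  constructor
  · intro h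
    rw [h, mul_zero, eq_comm, mul_eq_zero] at e4
    rcases e4 with h | h
    · omega
    · exact h
  · intro h
    rw [h, mul_zero] at e4
    omega

/-! ### Discriminants -/

theorem disc_congr {Λ Λ' : Type*} [AddCommGroup Λ] [Module.Free ℤ Λ] [Module.Finite ℤ Λ]
    [AddCommGroup Λ'] [Module.Free ℤ Λ'] [Module.Finite ℤ Λ'] {B : LinearMap.BilinForm ℤ Λ}
    {B' : LinearMap.BilinForm ℤ Λ'} {N : Submodule ℤ Λ} {N' : Submodule ℤ Λ'} (e : N ≃ₗ[ℤ] N')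
    (he : ∀ x y, B' (e x) (e y) = B x y) : disc B N = disc B' N' := by
  rw [disc_eq B' N' ((Module.finBasis ℤ N).map e), disc]
  congr 1
  ext i j
  rw [LinearMap.BilinForm.toMatrix_apply, LinearMap.BilinForm.toMatrix_apply, Module.Basis.map_apply,
    Module.Basis.map_apply]
  exact (he _ _).symm

theorem disc_eq_det {Λ ι : Type*} [AddCommGroup Λ] [Module.Free ℤ Λ] [Module.Finite ℤ Λ]
    [Fintype ι] [DecidableEq ι] {B : LinearMap.BilinForm ℤ Λ} {N : Submodule ℤ Λ}
    (G : Matrix ι ι ℤ) (e : (ι → ℤ) ≃ₗ[ℤ] N)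
    (he : ∀ x y, B (e x) (e y) = Matrix.toBilin' G x y) : disc B N = G.det := by
  rw [disc_eq B N ((Pi.basisFun ℤ ι).map e)]
  congr 1
  ext i j
  rw [LinearMap.BilinForm.toMatrix_apply, Module.Basis.map_apply, Module.Basis.map_apply]
  refine (he _ _).trans ?_
  rw [Pi.basisFun_apply, Pi.basisFun_apply, Matrix.toBilin'_single]

/-- The Gram matrix of the orthogonal complement of `stdVector q a b`. -/
def stdPerpGram (q a b : ℤ) : Matrix (Fin 3 ⊕ (Fin 2 ⊕ (Fin 8 × Fin 2)))
    (Fin 3 ⊕ (Fin 2 ⊕ (Fin 8 × Fin 2))) ℤ :=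
  Matrix.fromBlocks !![-2 * q, a, b; a, -2, 0; b, 0, -2] 0 0
    (Matrix.fromBlocks !![0, 1; 1, 0] 0 0 (Matrix.blockDiagonal fun _ : Fin 2 => -CartanMatrix.E₈))

theorem det_stdPerpGram (q a b : ℤ) :
    (stdPerpGram q a b).det = 8 * q - 2 * a ^ 2 - 2 * b ^ 2 := by
  have h1 : CartanMatrix.E₈.det * e8Inv.det = 1 := by
    have h2 : CartanMatrix.E₈ * e8Inv = 1 := by decide +kernel
    rw [← Matrix.det_mul, h2, Matrix.det_one]
  -- The determinant of E₈ is a unit of ℤ, and only its square enters since there are two copies;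
  -- the sign (-1)⁸ of each negated block is 1.
  have h3 : CartanMatrix.E₈.det * CartanMatrix.E₈.det = 1 := by
    rcases Int.isUnit_iff.1 (IsUnit.of_mul_eq_one _ h1) with h | h <;> rw [h] <;> rfl
  rw [stdPerpGram, Matrix.det_fromBlocks_zero₂₁, Matrix.det_fromBlocks_zero₂₁,
    Matrix.det_blockDiagonal, Fin.prod_univ_two, Matrix.det_neg, Fintype.card_fin,
    Matrix.det_fin_three, Matrix.det_fin_two]
  simp
  rw [h3]
  ring

theorem toBilin'_stdPerpGram (q a b : ℤ) (x y : Fin 3 ⊕ (Fin 2 ⊕ (Fin 8 × Fin 2)) → ℤ) :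
    Matrix.toBilin' (stdPerpGram q a b) x y =
      -2 * q * x (.inl 0) * y (.inl 0) + a * x (.inl 0) * y (.inl 1) + b * x (.inl 0) * y (.inl 2)
      + a * x (.inl 1) * y (.inl 0) - 2 * x (.inl 1) * y (.inl 1) + b * x (.inl 2) * y (.inl 0)
      - 2 * x (.inl 2) * y (.inl 2) + x (.inr (.inl 0)) * y (.inr (.inl 1)) +
      x (.inr (.inl 1)) * y (.inr (.inl 0)) -
      e8Form ℤ (fun i => x (.inr (.inr i))) fun i => y (.inr (.inr i)) := by
  rw [e8Form_eq_k3Form, k3Form, k3Gram, Matrix.toBilin'_apply', Matrix.toBilin'_apply',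
    stdPerpGram, Matrix.fromBlocks_mulVec, Matrix.fromBlocks_mulVec, Matrix.fromBlocks_mulVec]
  simp only [dotProduct, Fintype.sum_sum_type, Sum.elim_inl, Sum.elim_inr, Matrix.zero_mulVec,
    add_zero, zero_add, Pi.zero_apply, zero_mul, Finset.sum_const_zero,
    sub_neg_eq_add]
  rw [← add_assoc]
  congr 1
  simp [Matrix.mulVec, dotProduct, Fin.sum_univ_succ]
  ring

/-- Being orthogonal to the vector means q x₀ + x₁ = a x₄ + b x₅. This determines x₁, so the other
coordinates are free coordinates on the complement, with Gram matrix `stdPerpGram`. -/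
theorem disc_ker_stdVector (q a b : ℤ) :
    disc (modelForm ℤ) (LinearMap.ker (modelForm ℤ (stdVector q a b))) =
      8 * q - 2 * a ^ 2 - 2 * b ^ 2 := by
  rw [← det_stdPerpGram]
  let f : (Fin 3 ⊕ (Fin 2 ⊕ (Fin 8 × Fin 2)) → ℤ) →ₗ[ℤ] (ModelIndex → ℤ) :=
    { toFun := fun x => Sum.elim ![x (.inl 0), a * x (.inl 1) + b * x (.inl 2) - q * x (.inl 0),
        x (.inr (.inl 0)), x (.inr (.inl 1)), x (.inl 1), x (.inl 2)] fun i => x (.inr (.inr i))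
      map_add' := fun x y => by
        funext i
        rcases i with i | i
        · fin_cases i
          · rfl
          · change a * (x (.inl 1) + y (.inl 1)) + b * (x (.inl 2) + y (.inl 2)) -
              q * (x (.inl 0) + y (.inl 0)) = (a * x (.inl 1) + b * x (.inl 2) - q * x (.inl 0)) +
              (a * y (.inl 1) + b * y (.inl 2) - q * y (.inl 0))
            ring
          all_goals rfl
        · rfl
      map_smul' := fun c x => by
        funext i
        rcases i with i | i
        · fin_cases i
          · rfl
          · change a * (c * x (.inl 1)) + b * (c * x (.inl 2)) - q * (c * x (.inl 0)) =
              c * (a * x (.inl 1) + b * x (.inl 2) - q * x (.inl 0))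
            ring
          all_goals rfl
        · rfl }
  have hf : ∀ x, f x ∈ LinearMap.ker (modelForm ℤ (stdVector q a b)) := by
    intro x
    rw [LinearMap.mem_ker, modelForm_stdVector]
    change 2 * (q * x (.inl 0) + (a * x (.inl 1) + b * x (.inl 2) - q * x (.inl 0)) -
      a * x (.inl 1) - b * x (.inl 2)) = 0
    ring
  refine disc_eq_det _
    { f.codRestrict _ hf with
      invFun := fun y => Sum.elim ![y.1 (.inl 0), y.1 (.inl 4), y.1 (.inl 5)]
        (Sum.elim ![y.1 (.inl 2), y.1 (.inl 3)] fun i => y.1 (.inr i))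
      left_inv := fun x => by
        funext i
        rcases i with i | i | i
        · fin_cases i <;> rfl
        · fin_cases i <;> rfl
        · rfl
      right_inv := fun y => by
        obtain ⟨y, hy⟩ := y
        rw [LinearMap.mem_ker, modelForm_stdVector] at hy
        refine Subtype.ext (funext fun i => ?_)
        rcases i with i | i
        · fin_cases i
          · rfl
          · change a * y (.inl 4) + b * y (.inl 5) - q * y (.inl 0) = y (.inl 1)
            linarith
          all_goals rfl
        · rfl } fun x y => ?_
  rw [toBilin'_stdPerpGram]
  change modelForm ℤ (f x) (f y) = _
  rw [modelForm_apply, tubeForm_apply]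
  change x (.inl 0) * (a * y (.inl 1) + b * y (.inl 2) - q * y (.inl 0)) +
    (a * x (.inl 1) + b * x (.inl 2) - q * x (.inl 0)) * y (.inl 0) -
    2 * x (.inl 1) * y (.inl 1) - 2 * x (.inl 2) * y (.inl 2) -
    e8Form ℤ (fun i => x (.inr (.inr i))) (fun i => y (.inr (.inr i))) +
    x (.inr (.inl 0)) * y (.inr (.inl 1)) + x (.inr (.inl 1)) * y (.inr (.inl 0)) = _
  ring

/-- The vectors of negative square whose orthogonal complement has discriminant `-d`. -/
def heegnerVectors {L : Type*} [AddCommGroup L] [Module.Free ℤ L] [Module.Finite ℤ L]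
    (b : LinearMap.BilinForm ℤ L) (d : ℕ) : Set L :=
  {β | b β β < 0 ∧ disc b (LinearMap.ker (b β)) = -(d : ℤ)}

/-- Only the orthogonality conditions have to correspond, so γ may be any nonzero rational multiple
of the image of β. -/
theorem disc_ker_map {L L' : Type*} [AddCommGroup L] [Module.Free ℤ L] [Module.Finite ℤ L]
    [AddCommGroup L'] [Module.Free ℤ L'] [Module.Finite ℤ L'] {b : LinearMap.BilinForm ℤ L}
    {b' : LinearMap.BilinForm ℤ L'} (g : b.IsometryEquiv b') {β : L} {γ : L'}
    (h : ∀ x, b β x = 0 ↔ b' γ (g x) = 0) :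
    disc b (LinearMap.ker (b β)) = disc b' (LinearMap.ker (b' γ)) := by
  refine disc_congr
    { ((g : L ≃ₗ[ℤ] L').toLinearMap.restrict (p := LinearMap.ker (b β))
        (q := LinearMap.ker (b' γ)) fun x hx => (h x).1 hx) with
      invFun := fun y => ⟨g.symm y, (h _).2 (by rw [isometry_apply_symm]; exact y.2)⟩
      left_inv := fun x => Subtype.ext (isometry_symm_apply g x)
      right_inv := fun x => Subtype.ext (isometry_apply_symm g x) } fun x y => g.map_app y x

theorem map_mem_heegnerVectors {L L' : Type*} [AddCommGroup L] [Module.Free ℤ L]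
    [Module.Finite ℤ L] [AddCommGroup L'] [Module.Free ℤ L'] [Module.Finite ℤ L']
    {b : LinearMap.BilinForm ℤ L} {b' : LinearMap.BilinForm ℤ L'} (g : b.IsometryEquiv b') {β : L}
    {d : ℕ} (h : β ∈ heegnerVectors b d) : g β ∈ heegnerVectors b' d := by
  refine ⟨by rw [g.map_app]; exact h.1, ?_⟩
  rw [← h.2]
  exact (disc_ker_map g fun x => by rw [g.map_app]).symm

theorem stdVector_mem_heegnerVectors {q a b : ℤ} {d : ℕ} (hd : 0 < d)
    (h : 8 * q - 2 * a ^ 2 - 2 * b ^ 2 = -(d : ℤ)) :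
    stdVector q a b ∈ heegnerVectors (modelForm ℤ) d := by
  refine ⟨?_, ?_⟩
  · rw [modelForm_stdVector_self]; omega
  · rw [disc_ker_stdVector, h]

/-- If there are vectors of negative square whose orthogonal complement has discriminant `-d`, then
one of the vectors `stdVector q a b` has this property, and the orthogonal complements of all these
vectors are in the same orbit. -/
theorem exists_stdVector_of_mem_heegnerVectors {d : ℕ} {β : ModelIndex → ℤ}
    (hβ : β ∈ heegnerVectors (modelForm ℤ) d) : ∃ q a b : ℤ,
      8 * q - 2 * a ^ 2 - 2 * b ^ 2 = -(d : ℤ) ∧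
      (a = 0 ∧ b = 0 ∨ a = 1 ∧ b = 0 ∨ a = 1 ∧ b = 1) ∧
      ∀ γ ∈ heegnerVectors (modelForm ℤ) d,
        ∃ g : (modelForm ℤ).IsometryEquiv (modelForm ℤ),
          ∀ x, modelForm ℤ γ x = 0 ↔ modelForm ℤ (stdVector q a b) (g x) = 0 := by
  have key : ∀ γ ∈ heegnerVectors (modelForm ℤ) d,
      ∃ (g : (modelForm ℤ).IsometryEquiv (modelForm ℤ)) (q a b : ℤ),
      (a = 0 ∧ b = 0 ∨ a = 1 ∧ b = 0 ∨ a = 1 ∧ b = 1) ∧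
      8 * q - 2 * a ^ 2 - 2 * b ^ 2 = -(d : ℤ) ∧
      ∀ x, modelForm ℤ γ x = 0 ↔ modelForm ℤ (stdVector q a b) (g x) = 0 := by
    intro γ hγ
    obtain ⟨g, q, a, b, hab, h⟩ := exists_isometry_orthogonal_stdVector hγ.1
    refine ⟨g, q, a, b, hab, ?_, h⟩
    rw [← hγ.2, disc_ker_map g h, disc_ker_stdVector]
  obtain ⟨g, q, a, b, hab, hq, h⟩ := key β hβ
  refine ⟨q, a, b, hq, hab, fun γ hγ => ?_⟩
  obtain ⟨g', q', a', b', hab', hq', h'⟩ := key γ hγ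
  -- The residue of d mod 8 is 0, 2 or 4 in the three cases, so d determines (a, b) and then q.
  obtain ⟨rfl, rfl, rfl⟩ : q = q' ∧ a = a' ∧ b = b' := by
    rcases hab with ⟨rfl, rfl⟩ | ⟨rfl, rfl⟩ | ⟨rfl, rfl⟩ <;>
    rcases hab' with ⟨rfl, rfl⟩ | ⟨rfl, rfl⟩ | ⟨rfl, rfl⟩ <;> omega
  exact ⟨g', h'⟩

/-- With e = a² + b² - 4q, the three admissible pairs (a, b) give exactly the residues 0, 1, 2 of e
mod 4. -/
theorem heegnerVectors_nonempty_iff {d : ℕ} (hd : 0 < d) :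
    (heegnerVectors (modelForm ℤ) d).Nonempty ↔ ∃ e : ℕ, d = 2 * e ∧ ¬ e ≡ 3 [MOD 4] := by
  constructor
  · rintro ⟨β, hβ⟩
    obtain ⟨q, a, b, hq, hab, -⟩ := exists_stdVector_of_mem_heegnerVectors hβ
    refine ⟨d / 2, ?_, ?_⟩
    · rcases hab with ⟨rfl, rfl⟩ | ⟨rfl, rfl⟩ | ⟨rfl, rfl⟩ <;> omega
    · rw [Nat.ModEq]
      rcases hab with ⟨rfl, rfl⟩ | ⟨rfl, rfl⟩ | ⟨rfl, rfl⟩ <;> omega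
  · rintro ⟨e, rfl, he⟩
    rw [Nat.ModEq] at he
    obtain ⟨a, b, h⟩ : ∃ a b : ℤ, 8 * -((e / 4 : ℕ) : ℤ) - 2 * a ^ 2 - 2 * b ^ 2 =
        -((2 * e : ℕ) : ℤ) := by
      have : e % 4 = 0 ∨ e % 4 = 1 ∨ e % 4 = 2 := by omega
      rcases this with h | h | h
      · exact ⟨0, 0, by omega⟩
      · exact ⟨1, 0, by omega⟩
      · exact ⟨1, 1, by omega⟩
    exact ⟨_, stdVector_mem_heegnerVectors hd h⟩

/-! ### Heegner divisors in terms of vectors of negative square -/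

section Signature

theorem one_le_sigPos_of_pos {V : Type*} [AddCommGroup V] [Module ℝ V] [FiniteDimensional ℝ V]
    (Q : QuadraticForm ℝ V) {v : V} (hv : 0 < Q v) : 1 ≤ sigPos Q := by
  have hv0 : v ≠ 0 := by
    rintro rfl
    simp at hv
  rw [← finrank_span_singleton (K := ℝ) hv0]
  refine le_sigPos_of_posDef Q ?_
  rintro ⟨x, hx⟩ hx0
  obtain ⟨r, rfl⟩ := Submodule.mem_span_singleton.1 hx
  have hr : r ≠ 0 := by
    rintro rfl
    exact hx0 (Subtype.ext (zero_smul _ _))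
  change 0 < Q (r • v)
  rw [QuadraticMap.map_smul]
  exact mul_pos (mul_self_pos.2 hr) hv

theorem exists_neg_of_sigNeg_eq_one {V : Type*} [AddCommGroup V] [Module ℝ V]
    [FiniteDimensional ℝ V] (Q : QuadraticForm ℝ V) (h : sigNeg Q = 1) : ∃ v, Q v < 0 := by
  obtain ⟨W, hW, hQ⟩ := exists_finrank_eq_sigNeg_and_negDef Q
  rw [h] at hW
  have : Nontrivial W := Module.nontrivial_of_finrank_pos (R := ℝ) (by omega)
  obtain ⟨w, hw⟩ := exists_ne (0 : W)
  have := hQ w hw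
  change 0 < -Q w at this
  exact ⟨w, by linarith⟩

theorem sigPos_eq_one_and_sigNeg_eq_one {V : Type*} [AddCommGroup V] [Module ℝ V]
    [FiniteDimensional ℝ V] (Q : QuadraticForm ℝ V) (hV : Module.finrank ℝ V = 2) {v w : V}
    (hv : 0 < Q v) (hw : Q w < 0) : sigPos Q = 1 ∧ sigNeg Q = 1 := by
  have h1 := one_le_sigPos_of_pos Q hv
  have h2 := one_le_sigPos_of_pos (-Q) (v := w) (by change 0 < -Q w; linarith)
  rw [sigPos_neg] at h2
  have h3 := QuadraticForm.sigPos_add_sigNeg_add_radical (Q := Q)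
  omega

end Signature

section HeegnerVectors

variable {Λ : Type*} [AddCommGroup Λ] {B : LinearMap.BilinForm ℤ Λ} {h : Λ}

theorem submoduleOf_orthogonal {K : Submodule ℤ Λ} {β : perp B h}
    (H : ∀ y, y ∈ B.orthogonal K ↔ B h y = 0 ∧ B β y = 0) :
    (B.orthogonal K).submoduleOf (perp B h) = LinearMap.ker (perpForm B h β) := by
  ext y
  rw [Submodule.submoduleOf, Submodule.mem_comap, LinearMap.mem_ker]
  exact (H y).trans (and_iff_right y.2)

variable [Module.Free ℤ Λ] [Module.Finite ℤ Λ]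

/-- In a basis e₀, e₁ of K, the vector β = B(h, e₁) e₀ - B(h, e₀) e₁ is orthogonal to h. Its square
is h² times the Gram determinant of K, and h and β span K rationally. -/
theorem exists_perp_vector (hB : ∀ x y, B x y = B y x) (hh : 0 < B h h) {K : Submodule ℤ Λ}
    (hK : h ∈ K) (hr : Module.finrank ℤ K = 2) (hs : HasSignatureOneOne B K) :
    ∃ β, B h β = 0 ∧ B β β < 0 ∧ ∀ y, y ∈ B.orthogonal K ↔ B h y = 0 ∧ B β y = 0 := by
  obtain ⟨w, hw⟩ := exists_neg_of_sigNeg_eq_one _ hs.2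
  let e := Module.finBasisOfFinrankEq ℤ K hr
  set e₀ : Λ := Subtype.val (e 0) with he₀
  set e₁ : Λ := Subtype.val (e 1) with he₁
  obtain ⟨c, hc⟩ : ∃ c : Fin 2 → ℤ, h = c 0 • e₀ + c 1 • e₁ := by
    have := congrArg Subtype.val (e.sum_repr ⟨h, hK⟩)
    rw [Fin.sum_univ_two] at this
    exact ⟨_, this.symm⟩
  have hmem : ∀ k ∈ K, ∃ r : Fin 2 → ℤ, k = r 0 • e₀ + r 1 • e₁ := by
    intro k hk
    have := congrArg Subtype.val (e.sum_repr ⟨k, hk⟩)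
    rw [Fin.sum_univ_two] at this
    exact ⟨_, this.symm⟩
  set a₀ := B h e₀ with ha₀
  set a₁ := B h e₁ with ha₁
  have hsym := hB e₁ e₀
  have h0 : a₀ = c 0 * B e₀ e₀ + c 1 * B e₀ e₁ := by
    rw [ha₀, hc, map_add, map_smul, map_smul, LinearMap.add_apply, LinearMap.smul_apply,
      LinearMap.smul_apply, hsym, smul_eq_mul, smul_eq_mul]
  have h1 : a₁ = c 0 * B e₀ e₁ + c 1 * B e₁ e₁ := by
    rw [ha₁, hc, map_add, map_smul, map_smul, LinearMap.add_apply, LinearMap.smul_apply,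
      LinearMap.smul_apply, smul_eq_mul, smul_eq_mul]
  have hH : B h h = c 0 * a₀ + c 1 * a₁ := by
    conv_lhs => enter [2]; rw [hc]
    rw [map_add, map_smul, map_smul, smul_eq_mul, smul_eq_mul]
  -- If the Gram determinant D were nonnegative, the identity h² w² = B(h, w)² + D (c₀ s - c₁ r)²
  -- for w = r e₀ + s e₁ would make w² nonnegative for every real w.
  have hD : B e₀ e₀ * B e₁ e₁ - B e₀ e₁ ^ 2 < 0 := by
    by_contra! hD
    have e' := (e.baseChange ℝ).sum_repr w
    rw [Fin.sum_univ_two, Module.Basis.baseChange_apply, Module.Basis.baseChange_apply] at e'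
    set r := (e.baseChange ℝ).repr w 0
    set s := (e.baseChange ℝ).repr w 1
    have hQ : ((B.restrict K).baseChange ℝ).toQuadraticMap w =
        r ^ 2 * B e₀ e₀ + 2 * r * s * B e₀ e₁ + s ^ 2 * B e₁ e₁ := by
      rw [LinearMap.BilinMap.toQuadraticMap_apply, ← e']
      simp only [map_add, map_smul, LinearMap.add_apply, LinearMap.smul_apply, smul_eq_mul,
        LinearMap.BilinForm.baseChange_tmul, mul_one, zsmul_eq_mul]
      change r * (r * (B e₀ e₀ : ℝ) + s * (B e₁ e₀ : ℝ)) +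
        s * (r * (B e₀ e₁ : ℝ) + s * (B e₁ e₁ : ℝ)) = _
      rw [hsym]
      ring
    rw [hQ] at hw
    have hD' : (0 : ℝ) ≤ B e₀ e₀ * B e₁ e₁ - (B e₀ e₁ : ℝ) ^ 2 := by exact_mod_cast hD
    have hh' : (0 : ℝ) < B h h := by exact_mod_cast hh
    have key : (B h h : ℝ) * (r ^ 2 * B e₀ e₀ + 2 * r * s * B e₀ e₁ + s ^ 2 * B e₁ e₁) =
        (r * a₀ + s * a₁) ^ 2 + (B e₀ e₀ * B e₁ e₁ - (B e₀ e₁ : ℝ) ^ 2) *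
          (c 0 * s - c 1 * r) ^ 2 := by
      rw [hH, h0, h1]
      push_cast
      ring
    have : 0 ≤ (B h h : ℝ) * (r ^ 2 * B e₀ e₀ + 2 * r * s * B e₀ e₁ + s ^ 2 * B e₁ e₁) := by
      rw [key]
      positivity
    exact absurd hw (not_lt.2 (nonneg_of_mul_nonneg_right this hh'))
  have hβ : ∀ y, B (a₁ • e₀ - a₀ • e₁) y = a₁ * B e₀ y - a₀ * B e₁ y := fun y => by
    rw [map_sub, map_smul, map_smul, LinearMap.sub_apply, LinearMap.smul_apply,
      LinearMap.smul_apply, smul_eq_mul, smul_eq_mul]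
  refine ⟨a₁ • e₀ - a₀ • e₁, ?_, ?_, fun y => ⟨fun hy => ⟨hy h hK, ?_⟩, ?_⟩⟩
  · rw [map_sub, map_smul, map_smul, smul_eq_mul, smul_eq_mul]
    ring
  · have : B (a₁ • e₀ - a₀ • e₁) (a₁ • e₀ - a₀ • e₁) =
        B h h * (B e₀ e₀ * B e₁ e₁ - B e₀ e₁ ^ 2) := by
      rw [hβ, map_sub, map_sub, map_smul, map_smul, map_smul, map_smul, smul_eq_mul, smul_eq_mul,
        smul_eq_mul, smul_eq_mul, hsym, hH, h0, h1]
      ring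
    rw [this]
    exact mul_neg_of_pos_of_neg hh hD
  · rw [hβ, hy e₀ (e 0).2, hy e₁ (e 1).2]
    simp
  · rintro ⟨h2, h3⟩ k hk
    obtain ⟨r, rfl⟩ := hmem k hk
    rw [hβ] at h3
    have h4 : c 0 * B e₀ y + c 1 * B e₁ y = 0 := by
      rw [← h2, hc, map_add, map_smul, map_smul, LinearMap.add_apply, LinearMap.smul_apply,
        LinearMap.smul_apply, smul_eq_mul, smul_eq_mul]
    -- Cramer's rule: the linear system given by h and β in the basis e₀, e₁ has determinant ±h²,
    -- which is nonzero.
    have h5 : B h h * B e₀ y = 0 := by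
      rw [hH]; linear_combination a₀ * h4 + c 1 * h3
    have h6 : B h h * B e₁ y = 0 := by
      rw [hH]; linear_combination a₁ * h4 - c 0 * h3
    change B _ y = 0
    rw [map_add, map_smul, map_smul, LinearMap.add_apply,
      LinearMap.smul_apply, LinearMap.smul_apply, (mul_eq_zero.1 h5).resolve_left hh.ne',
      (mul_eq_zero.1 h6).resolve_left hh.ne', smul_zero, smul_zero, add_zero]

/-- The span of h and β works: K is not required to be saturated, and `K^⊥` depends only on the
rational span. -/
theorem exists_sublattice (hB : ∀ x y, B x y = B y x) (hh : 0 < B h h) {β : Λ} (hβh : B h β = 0)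
    (hβ : B β β < 0) : ∃ K : Submodule ℤ Λ, h ∈ K ∧ Module.finrank ℤ K = 2 ∧
      HasSignatureOneOne B K ∧ ∀ y, y ∈ B.orthogonal K ↔ B h y = 0 ∧ B β y = 0 := by
  have hli : LinearIndependent ℤ ![h, β] := by
    rw [LinearIndependent.pair_iff]
    intro s t hst
    have h1 := congrArg (B h) hst
    have h2 := congrArg (B β) hst
    rw [map_add, map_smul, map_smul, hβh, map_zero, smul_zero, add_zero, smul_eq_mul] at h1
    rw [map_add, map_smul, map_smul, hB β h, hβh, map_zero, smul_zero, zero_add, smul_eq_mul] at h2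
    exact ⟨(mul_eq_zero.1 h1).resolve_right hh.ne', (mul_eq_zero.1 h2).resolve_right hβ.ne⟩
  have hfr := finrank_span_eq_card hli
  rw [Fintype.card_fin] at hfr
  set K := Submodule.span ℤ (Set.range ![h, β]) with hK
  have hhK : h ∈ K := Submodule.subset_span ⟨0, rfl⟩
  have hβK : β ∈ K := Submodule.subset_span ⟨1, rfl⟩
  refine ⟨K, hhK, hfr, ?_, fun y => ⟨fun hy => ⟨hy h hhK, hy β hβK⟩, fun hy k hk => ?_⟩⟩
  · refine sigPos_eq_one_and_sigNeg_eq_one _ (by rw [Module.finrank_baseChange, hfr])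
      (v := 1 ⊗ₜ ⟨h, hhK⟩) (w := 1 ⊗ₜ ⟨β, hβK⟩) ?_ ?_
    · rw [LinearMap.BilinMap.toQuadraticMap_apply, LinearMap.BilinForm.baseChange_tmul, mul_one,
        zsmul_eq_mul, mul_one]
      exact_mod_cast hh
    · rw [LinearMap.BilinMap.toQuadraticMap_apply, LinearMap.BilinForm.baseChange_tmul, mul_one,
        zsmul_eq_mul, mul_one]
      exact_mod_cast hβ
  · change B k y = 0
    induction hk using Submodule.span_induction with
    | mem x hx =>
      obtain ⟨i, rfl⟩ := hx
      fin_cases i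
      · exact hy.1
      · exact hy.2
    | zero => simp
    | add x z _ _ hx hz => rw [map_add, LinearMap.add_apply, hx, hz, add_zero]
    | smul c x _ hx => rw [map_smul, LinearMap.smul_apply, hx, smul_zero]

/-- The points of the period domain orthogonal to one of the `heegnerVectors`. -/
def heegnerLocus {L : Type*} [AddCommGroup L] [Module.Free ℤ L] [Module.Finite ℤ L]
    (b : LinearMap.BilinForm ℤ L) (d : ℕ) : Set (PeriodDomain b) :=
  {x | ∃ β ∈ heegnerVectors b d, x.1.submodule ≤ (LinearMap.ker (b β)).baseChange ℂ}

theorem disc_orthogonal {K : Submodule ℤ Λ} {β : perp B h}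
    (H : ∀ y, y ∈ B.orthogonal K ↔ B h y = 0 ∧ B β y = 0) :
    disc B (B.orthogonal K) = disc (perpForm B h) (LinearMap.ker (perpForm B h β)) := by
  rw [← submoduleOf_orthogonal H]
  exact (disc_congr (Submodule.submoduleOfEquivOfLe fun y hy => ((H y).1 hy).1)
    fun _ _ => rfl).symm

/-- The lattices K are traded for negative vectors β of `h^⊥`, so that before taking the quotient
the divisor is described by the lattice `h^⊥` alone. -/
theorem heegnerDivisor_eq (hB : ∀ x y, B x y = B y x) (hh : 0 < B h h) (d : ℕ) :
    heegnerDivisor B h d = PeriodSpace.mk B h '' heegnerLocus (perpForm B h) d := by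
  ext p
  constructor
  · rintro ⟨K, hK, hr, hs, hd, x, hx, rfl⟩
    obtain ⟨β, hβ, hβ2, H⟩ := exists_perp_vector hB hh hK hr hs
    have H' : ∀ y, y ∈ B.orthogonal K ↔ B h y = 0 ∧ B (⟨β, hβ⟩ : perp B h) y = 0 := H
    refine ⟨x, ⟨⟨β, hβ⟩, ⟨hβ2, ?_⟩, ?_⟩, rfl⟩
    · rw [← disc_orthogonal H', hd]
    · rw [← submoduleOf_orthogonal H']
      exact hx
  · rintro ⟨x, ⟨β, ⟨hβ, hd⟩, hx⟩, rfl⟩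
    obtain ⟨K, hK, hr, hs, H⟩ := exists_sublattice hB hh (β := β) β.2 hβ
    refine ⟨K, hK, hr, hs, ?_, x, ?_, rfl⟩
    · rw [disc_orthogonal H, hd]
    · rw [← submoduleOf_orthogonal H] at hx
      exact hx

end HeegnerVectors

/-! ### Period domains and isometries -/

section Complexification

variable {L L' : Type*} [AddCommGroup L] [AddCommGroup L'] {b : LinearMap.BilinForm ℤ L}
  {b' : LinearMap.BilinForm ℤ L'}

/-- Flatness of ℂ over ℤ: complexification commutes with kernels. -/
theorem mem_baseChange_ker_iff (f : L →ₗ[ℤ] ℤ) (v : ℂ ⊗[ℤ] L) :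
    v ∈ (LinearMap.ker f).baseChange ℂ ↔ f.baseChange ℂ v = 0 := by
  have h := Module.Flat.lTensor_exact (R := ℤ) ℂ (f := (LinearMap.ker f).subtype) (g := f)
    (LinearMap.exact_subtype_ker_map f)
  exact (h v).symm

theorem baseChange_apply_one_tmul (β : L) (v : ℂ ⊗[ℤ] L) :
    (b β).baseChange ℂ v = 0 ↔ b.baseChange ℂ (1 ⊗ₜ β) v = 0 := by
  have e : ∀ v, TensorProduct.rid ℤ ℂ ((b β).baseChange ℂ v) = b.baseChange ℂ (1 ⊗ₜ β) v := by
    intro v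
    induction v with
    | zero => simp
    | add x y hx hy => simp only [map_add, hx, hy]
    | tmul z x => simp
  rw [← e, LinearEquiv.map_eq_zero_iff]

theorem mk_submodule_le_iff {v : ℂ ⊗[ℤ] L} (hv : v ∈ periodCone b) (β : L) :
    (PeriodDomain.mk b v hv).1.submodule ≤ (LinearMap.ker (b β)).baseChange ℂ ↔
      b.baseChange ℂ (1 ⊗ₜ β) v = 0 := by
  rw [PeriodDomain.mk, Projectivization.submodule_mk, Submodule.span_singleton_le_iff_mem,
    mem_baseChange_ker_iff, baseChange_apply_one_tmul]

end Complexification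

/-! ### Real coordinates -/

theorem bilinForm_combination {R V : Type*} [CommRing R] [AddCommGroup V] [Module R V]
    (F : LinearMap.BilinForm R V) {x y : V} (h : F y x = F x y) (s t : R) :
    F (s • x + t • y) (s • x + t • y) = s ^ 2 * F x x + 2 * s * t * F x y + t ^ 2 * F y y := by
  simp only [map_add, map_smul, LinearMap.add_apply, LinearMap.smul_apply, smul_eq_mul, h]
  ring

/-- Squares are completed along the three arms of the Dynkin diagram, from the leaves to the branch
vertex 3. What is left there is 2 - 2/3 - 1/2 - 4/5 = 1/30. -/
theorem e8Form_sum_squares (x : Fin 8 × Fin 2 → ℝ) : e8Form ℝ x x =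
    ∑ k, (2 * (x (0, k) - x (2, k) / 2) ^ 2 + 3 / 2 * (x (2, k) - 2 / 3 * x (3, k)) ^ 2 +
      2 * (x (1, k) - x (3, k) / 2) ^ 2 + 2 * (x (7, k) - x (6, k) / 2) ^ 2 +
      3 / 2 * (x (6, k) - 2 / 3 * x (5, k)) ^ 2 + 4 / 3 * (x (5, k) - 3 / 4 * x (4, k)) ^ 2 +
      5 / 4 * (x (4, k) - 4 / 5 * x (3, k)) ^ 2 + 1 / 30 * x (3, k) ^ 2) := by
  rw [e8Form_apply]
  refine Finset.sum_congr rfl fun k _ => ?_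
  simp [Fin.sum_univ_eight, CartanMatrix.E₈]
  ring

theorem e8Form_nonneg (x : Fin 8 × Fin 2 → ℝ) : 0 ≤ e8Form ℝ x x := by
  rw [e8Form_sum_squares]
  exact Finset.sum_nonneg fun k _ => by positivity

/-- The coordinate x_i is the pairing of x with the dual basis vector w, whose square is a diagonal
entry of `e8Inv`, at most 30. The bound is the Cauchy-Schwarz inequality for w and x. -/
theorem sq_le_e8Form (x : Fin 8 × Fin 2 → ℝ) (i : Fin 8 × Fin 2) : x i ^ 2 ≤ 30 * e8Form ℝ x x := by
  obtain ⟨i, k⟩ := i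
  have hinv : ∀ i j, ∑ a, CartanMatrix.E₈ a j * e8Inv i a = if i = j then 1 else 0 := by
    decide +kernel
  have hdiag : ∀ i, 0 < e8Inv i i ∧ e8Inv i i ≤ 30 := by decide +kernel
  let w : Fin 8 × Fin 2 → ℝ := fun p => if p.2 = k then (e8Inv i p.1 : ℝ) else 0
  have hw : ∀ y, e8Form ℝ w y = y (i, k) := by
    intro y
    rw [e8Form_apply, Finset.sum_eq_single k]
    · simp only [w, if_true]
      rw [Finset.sum_comm]
      have : ∀ j, ∑ a, (CartanMatrix.E₈ a j : ℝ) * (e8Inv i a : ℝ) * y (j, k) =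
          if i = j then y (j, k) else 0 := by
        intro j
        have := congrArg (Int.cast (R := ℝ)) (hinv i j)
        push_cast at this
        rw [← Finset.sum_mul, this]
        split_ifs <;> simp
      simp only [this, Finset.sum_ite_eq, Finset.mem_univ, if_true]
    · intro l _ hl
      simp [w, hl]
    · simp
  have hww : e8Form ℝ w w = e8Inv i i := by rw [hw]; simp [w]
  have h0 : (0 : ℝ) < e8Inv i i := by exact_mod_cast (hdiag i).1
  have h30 : (e8Inv i i : ℝ) ≤ 30 := by exact_mod_cast (hdiag i).2
  have h1 := e8Form_nonneg ((e8Inv i i : ℝ) • x + (-x (i, k)) • w)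
  rw [bilinForm_combination _ (e8Form_symm w x), e8Form_symm x w, hww, hw] at h1
  have h2 : 0 ≤ (e8Inv i i : ℝ) * (e8Inv i i * e8Form ℝ x x - x (i, k) ^ 2) := by
    refine h1.trans_eq ?_
    ring
  have h3 := nonneg_of_mul_nonneg_right h2 h0
  have h4 := mul_le_mul_of_nonneg_right h30 (e8Form_nonneg x)
  linarith

/-- The vanishing coordinate is the pairing with an isotropic vector of a form with one positive
direction. -/
theorem tubeForm_nonpos {x : ModelIndex → ℝ} (h : x (.inl 0) = 0) : tubeForm ℝ x x ≤ 0 := by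
  rw [tubeForm_apply, h]
  nlinarith [e8Form_nonneg (x ∘ Sum.inr), sq_nonneg (x (.inl 4)), sq_nonneg (x (.inl 5))]

/-- The two conditions say that x is orthogonal to the positive plane spanned by e₁ + f₁ and e₂ +
f₂. -/
theorem modelForm_nonpos {x : ModelIndex → ℝ} (h : x (.inl 0) + x (.inl 1) = 0)
    (h' : x (.inl 2) + x (.inl 3) = 0) : modelForm ℝ x x ≤ 0 := by
  rw [modelForm_apply, tubeForm_apply, eq_neg_of_add_eq_zero_right h,
    eq_neg_of_add_eq_zero_right h']
  nlinarith [e8Form_nonneg (x ∘ Sum.inr), sq_nonneg (x (.inl 4)), sq_nonneg (x (.inl 5)),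
    sq_nonneg (x (.inl 0)), sq_nonneg (x (.inl 2))]

/-- The reverse Cauchy-Schwarz inequality. -/
theorem tubeForm_reverse_schwarz (x y : ModelIndex → ℝ) :
    y (.inl 0) ^ 2 * tubeForm ℝ x x + x (.inl 0) ^ 2 * tubeForm ℝ y y ≤
      2 * x (.inl 0) * y (.inl 0) * tubeForm ℝ x y := by
  -- The combination y₀ x - x₀ y has zero first coordinate, hence nonpositive square.
  have h := tubeForm_nonpos (x := y (.inl 0) • x + (-x (.inl 0)) • y) (by simp; ring)
  rw [bilinForm_combination _ (tubeForm_symm y x)] at h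
  linarith

theorem ne_zero_of_tubeForm_pos {x : ModelIndex → ℝ} (h : 0 < tubeForm ℝ x x) :
    x (.inl 0) ≠ 0 := fun h0 => (tubeForm_nonpos h0).not_gt h

/-- With a single positive direction, two vectors of positive square cannot be orthogonal. -/
theorem tubeForm_ne_zero {x y : ModelIndex → ℝ} (hx : 0 < tubeForm ℝ x x)
    (hy : 0 < tubeForm ℝ y y) : tubeForm ℝ x y ≠ 0 := by
  intro h
  have h1 := tubeForm_reverse_schwarz x y
  rw [h, mul_zero] at h1
  have h2 := ne_zero_of_tubeForm_pos hx
  have : 0 < x (.inl 0) ^ 2 * tubeForm ℝ y y := by positivity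
  have : 0 ≤ y (.inl 0) ^ 2 * tubeForm ℝ x x := by positivity
  linarith

/-- A component of the cone of vectors of positive square. -/
def lightCone : Set (ModelIndex → ℝ) := {y | 0 < y (.inl 0) ∧ 0 < tubeForm ℝ y y}

theorem convex_lightCone : Convex ℝ lightCone := by
  rintro x ⟨hx0, hx⟩ y ⟨hy0, hy⟩ s t hs ht hst
  have hxy : 0 < tubeForm ℝ x y := by
    have h1 := tubeForm_reverse_schwarz x y
    have h2 : 0 < y (.inl 0) ^ 2 * tubeForm ℝ x x + x (.inl 0) ^ 2 * tubeForm ℝ y y := by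
      positivity
    have h3 : 0 < 2 * x (.inl 0) * y (.inl 0) := by positivity
    exact (mul_pos_iff_of_pos_left h3).1 (h2.trans_le h1)
  have hst' : 0 < s ∨ 0 < t := by
    by_contra! h
    linarith
  refine ⟨?_, ?_⟩
  · simp only [Pi.add_apply, Pi.smul_apply, smul_eq_mul]
    rcases hst' with h | h <;> positivity
  · rw [bilinForm_combination _ (tubeForm_symm y x)]
    rcases hst' with h | h <;> positivity

/-- The square of the norm of the projection to a positive definite plane. -/
def planeNorm (x : ModelIndex → ℝ) : ℝ :=
  (x (.inl 0) + x (.inl 1)) ^ 2 + (x (.inl 2) + x (.inl 3)) ^ 2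

theorem modelForm_self (x : ModelIndex → ℝ) : modelForm ℝ x x = planeNorm x / 2 -
    ((x (.inl 0) - x (.inl 1)) ^ 2 / 2 + (x (.inl 2) - x (.inl 3)) ^ 2 / 2 + 2 * x (.inl 4) ^ 2 +
      2 * x (.inl 5) ^ 2 + e8Form ℝ (x ∘ Sum.inr) (x ∘ Sum.inr)) := by
  rw [modelForm_apply, tubeForm_apply, planeNorm]
  ring

/-- The projection to the fixed positive plane is injective on the span of x, y, since its kernel
has nonpositive squares. So some s x + t y has the same projection as β. The difference has square
at most 0, which gives c(s² + t²) ≤ N; the Cauchy-Schwarz inequality then bounds the projection. -/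
theorem planeNorm_le_of_orthogonal {x y β : ModelIndex → ℝ} {c N : ℝ} (hc : 0 < c)
    (hx : modelForm ℝ x x = c) (hy : modelForm ℝ y y = c) (hxy : modelForm ℝ x y = 0)
    (hβx : modelForm ℝ β x = 0) (hβy : modelForm ℝ β y = 0) (hβ : modelForm ℝ β β = -N) :
    planeNorm β ≤ N / c * (planeNorm x + planeNorm y) := by
  have hlin : ∀ s t : ℝ, modelForm ℝ (s • x + t • y) (s • x + t • y) = c * (s ^ 2 + t ^ 2) := by
    intro s t
    rw [bilinForm_combination _ (modelForm_symm y x), hx, hy, hxy]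
    ring
  set x₀ := x (.inl 0) + x (.inl 1) with hx₀
  set x₁ := x (.inl 2) + x (.inl 3) with hx₁
  set y₀ := y (.inl 0) + y (.inl 1) with hy₀
  set y₁ := y (.inl 2) + y (.inl 3) with hy₁
  set z₀ := β (.inl 0) + β (.inl 1) with hz₀
  set z₁ := β (.inl 2) + β (.inl 3) with hz₁
  have hzero : ∀ s t : ℝ, s * x₀ + t * y₀ = 0 → s * x₁ + t * y₁ = 0 → s = 0 ∧ t = 0 := by
    intro s t h0 h1
    have h := modelForm_nonpos (x := s • x + t • y)
      (by simp only [Pi.add_apply, Pi.smul_apply, smul_eq_mul]; linarith)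
      (by simp only [Pi.add_apply, Pi.smul_apply, smul_eq_mul]; linarith)
    rw [hlin] at h
    have h2 : s ^ 2 + t ^ 2 ≤ 0 := by
      by_contra! h3
      exact (mul_pos hc h3).not_ge h
    constructor <;> nlinarith [sq_nonneg s, sq_nonneg t]
  have hD : x₀ * y₁ - x₁ * y₀ ≠ 0 := by
    intro hD
    obtain ⟨h1, h2⟩ := hzero y₀ (-x₀) (by ring) (by linarith)
    obtain ⟨h3, h4⟩ := hzero y₁ (-x₁) (by linarith) (by ring)
    have := hzero 1 0 (by linarith) (by linarith)
    exact one_ne_zero this.1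
  set s := (z₀ * y₁ - z₁ * y₀) / (x₀ * y₁ - x₁ * y₀) with hs
  set t := (x₀ * z₁ - x₁ * z₀) / (x₀ * y₁ - x₁ * y₀) with ht
  have e0 : s * x₀ + t * y₀ = z₀ := by
    rw [hs, ht, div_mul_eq_mul_div, div_mul_eq_mul_div, ← add_div, div_eq_iff hD]; ring
  have e1 : s * x₁ + t * y₁ = z₁ := by
    rw [hs, ht, div_mul_eq_mul_div, div_mul_eq_mul_div, ← add_div, div_eq_iff hD]; ring
  have hw := modelForm_nonpos (x := β - (s • x + t • y))
    (by simp only [Pi.sub_apply, Pi.add_apply, Pi.smul_apply, smul_eq_mul]; linarith)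
    (by simp only [Pi.sub_apply, Pi.add_apply, Pi.smul_apply, smul_eq_mul]; linarith)
  have hβl : modelForm ℝ β (s • x + t • y) = 0 := by
    rw [map_add, map_smul, map_smul, hβx, hβy, smul_zero, smul_zero, add_zero]
  rw [map_sub, map_sub, LinearMap.sub_apply, LinearMap.sub_apply,
    modelForm_symm (s • x + t • y) β, hβl, hlin, hβ] at hw
  have hst : s ^ 2 + t ^ 2 ≤ N / c := by
    rw [le_div_iff₀ hc]
    linarith
  have h3 : planeNorm β ≤ (s ^ 2 + t ^ 2) * (planeNorm x + planeNorm y) := by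
    rw [planeNorm, planeNorm, planeNorm, ← hz₀, ← hz₁, ← hx₀, ← hx₁, ← hy₀, ← hy₁, ← e0, ← e1]
    nlinarith [sq_nonneg (s * y₀ - t * x₀), sq_nonneg (s * y₁ - t * x₁)]
  refine h3.trans (mul_le_mul_of_nonneg_right hst ?_)
  rw [planeNorm, planeNorm]
  positivity

/-- Changing the sign of the form on the complement of the positive plane gives a positive
semidefinite form whose value at β is N + `planeNorm β`. It controls each coordinate; the factor 30
comes from E₈. -/
theorem sq_le_of_orthogonal {x y β : ModelIndex → ℝ} {c N : ℝ} (hc : 0 < c) (hN : 0 ≤ N)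
    (hx : modelForm ℝ x x = c) (hy : modelForm ℝ y y = c) (hxy : modelForm ℝ x y = 0)
    (hβx : modelForm ℝ β x = 0) (hβy : modelForm ℝ β y = 0) (hβ : modelForm ℝ β β = -N)
    (i : ModelIndex) : β i ^ 2 ≤ 30 * (N + N / c * (planeNorm x + planeNorm y)) := by
  have h1 := planeNorm_le_of_orthogonal hc hx hy hxy hβx hβy hβ
  have h2 := modelForm_self β
  rw [hβ] at h2
  have h3 := e8Form_nonneg (β ∘ Sum.inr)
  set R := N / c * (planeNorm x + planeNorm y)
  rw [planeNorm] at h1 h2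
  rcases i with i | i
  · fin_cases i <;> simp only [Fin.zero_eta, Fin.mk_one, Fin.reduceFinMk] <;>
    nlinarith [sq_nonneg (β (.inl 0) - β (.inl 1)), sq_nonneg (β (.inl 2) - β (.inl 3)),
      sq_nonneg (β (.inl 0) + β (.inl 1)), sq_nonneg (β (.inl 2) + β (.inl 3)),
      sq_nonneg (β (.inl 4)), sq_nonneg (β (.inl 5))]
  · have h4 := sq_le_e8Form (β ∘ Sum.inr) i
    simp only [Function.comp_apply] at h4
    nlinarith [sq_nonneg (β (.inl 0) - β (.inl 1)), sq_nonneg (β (.inl 2) - β (.inl 3)),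
      sq_nonneg (β (.inl 0) + β (.inl 1)), sq_nonneg (β (.inl 2) + β (.inl 3)),
      sq_nonneg (β (.inl 4)), sq_nonneg (β (.inl 5))]

/-! ### Complex coordinates -/

section ComplexForms

variable (v : ModelIndex → ℂ)

theorem eq_re_add_im : v = Complex.ofRealHom ∘ (fun i => (v i).re) +
    Complex.I • (Complex.ofRealHom ∘ fun i => (v i).im) := by
  funext i
  simp [mul_comm Complex.I]

theorem conj_eq_re_sub_im : (starRingEnd ℂ) ∘ v = Complex.ofRealHom ∘ (fun i => (v i).re) -
    Complex.I • (Complex.ofRealHom ∘ fun i => (v i).im) := by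
  funext i
  simp [Complex.ext_iff]

theorem modelForm_complex : modelForm ℂ v v =
    ((modelForm ℝ (fun i => (v i).re) (fun i => (v i).re) -
      modelForm ℝ (fun i => (v i).im) (fun i => (v i).im) : ℝ) : ℂ) +
    ((2 * modelForm ℝ (fun i => (v i).re) (fun i => (v i).im) : ℝ) : ℂ) * Complex.I := by
  conv_lhs => rw [eq_re_add_im v]
  simp only [map_add, map_smul, LinearMap.add_apply, LinearMap.smul_apply, modelForm_map,
    smul_eq_mul, Complex.ofRealHom_eq_coe, modelForm_symm (fun i => (v i).im) (fun i => (v i).re)]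
  push_cast
  linear_combination (modelForm ℝ (fun i => (v i).im) (fun i => (v i).im) : ℂ) * Complex.I_sq

theorem modelForm_conj : modelForm ℂ v (starRingEnd ℂ ∘ v) =
    ((modelForm ℝ (fun i => (v i).re) (fun i => (v i).re) +
      modelForm ℝ (fun i => (v i).im) (fun i => (v i).im) : ℝ) : ℂ) := by
  rw [conj_eq_re_sub_im]
  conv_lhs => enter [1]; rw [eq_re_add_im v]
  simp only [map_add, map_sub, map_smul, LinearMap.add_apply, LinearMap.smul_apply,
    modelForm_map, smul_eq_mul, Complex.ofRealHom_eq_coe,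
    modelForm_symm (fun i => (v i).im) (fun i => (v i).re)]
  push_cast
  linear_combination -(modelForm ℝ (fun i => (v i).im) (fun i => (v i).im) : ℂ) * Complex.I_sq

theorem modelForm_int (β : ModelIndex → ℤ) : modelForm ℂ (fun i => (β i : ℂ)) v =
    (modelForm ℝ (fun i => (β i : ℝ)) (fun i => (v i).re) : ℂ) +
      (modelForm ℝ (fun i => (β i : ℝ)) (fun i => (v i).im) : ℂ) * Complex.I := by
  conv_lhs => rw [eq_re_add_im v]
  have e : (fun i => (β i : ℂ)) = Complex.ofRealHom ∘ fun i => (β i : ℝ) := by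
    funext i
    simp
  rw [e, map_add, map_smul, modelForm_map, modelForm_map, smul_eq_mul, mul_comm]
  rfl

/-- The cone over the period domain, in coordinates. -/
def modelCone : Set (ModelIndex → ℂ) :=
  {v | modelForm ℂ v v = 0 ∧ 0 < (modelForm ℂ v (starRingEnd ℂ ∘ v)).re}

/-- Points of the cone are oriented positive planes with an orthogonal basis of two vectors of equal
length: the real and imaginary parts. -/
theorem mem_modelCone_iff : v ∈ modelCone ↔
    modelForm ℝ (fun i => (v i).re) (fun i => (v i).re) =
      modelForm ℝ (fun i => (v i).im) (fun i => (v i).im) ∧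
    modelForm ℝ (fun i => (v i).re) (fun i => (v i).im) = 0 ∧
    0 < modelForm ℝ (fun i => (v i).im) (fun i => (v i).im) := by
  rw [modelCone, Set.mem_ofPred_eq, modelForm_complex, modelForm_conj, Complex.ofReal_re,
    Complex.ext_iff]
  simp only [Complex.add_re, Complex.ofReal_re, Complex.mul_re, Complex.I_re, mul_zero,
    Complex.ofReal_im, Complex.I_im, sub_zero, add_zero, Complex.zero_re, Complex.add_im,
    Complex.mul_im, mul_one, zero_add, Complex.zero_im]
  constructor
  · rintro ⟨⟨h1, h2⟩, h3⟩
    refine ⟨by linarith, by linarith, by linarith⟩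
  · rintro ⟨h1, h2, h3⟩
    refine ⟨⟨by linarith, by linarith⟩, by linarith⟩

end ComplexForms

/-! ### Transport of the period cone to the model coordinates. -/

section Coordinates

variable {L : Type*} [AddCommGroup L] {b : LinearMap.BilinForm ℤ L}
  (ψ : (modelForm ℤ).IsometryEquiv b)

/-- The coordinates on `ℂ ⊗ L` given by an isometry from the model lattice to `L`. -/
def complexCoords : ℂ ⊗[ℤ] L ≃ₗ[ℂ] (ModelIndex → ℂ) :=
  ((ψ.symm : L ≃ₗ[ℤ] (ModelIndex → ℤ)).baseChange ℤ ℂ L (ModelIndex → ℤ)).trans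
    (TensorProduct.piScalarRight ℤ ℂ ℂ ModelIndex)

theorem complexCoords_tmul (z : ℂ) (x : L) :
    complexCoords ψ (z ⊗ₜ x) = fun i => z * (ψ.symm x i : ℂ) := by
  funext i
  simp [complexCoords, mul_comm]

theorem complexCoords_conj (v : ℂ ⊗[ℤ] L) :
    complexCoords ψ (conj v) = starRingEnd ℂ ∘ complexCoords ψ v := by
  induction v with
  | zero => funext i; simp
  | add x y hx hy => rw [map_add, map_add, hx, hy, map_add]; funext i; simp
  | tmul z x => rw [conj_tmul, complexCoords_tmul, complexCoords_tmul]; funext i; simp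

theorem modelForm_complexCoords (v w : ℂ ⊗[ℤ] L) :
    modelForm ℂ (complexCoords ψ v) (complexCoords ψ w) = b.baseChange ℂ v w := by
  induction v with
  | zero => simp
  | add x y hx hy => simp only [map_add, LinearMap.add_apply, hx, hy]
  | tmul z x =>
    induction w with
    | zero => simp
    | add x y hx hy => simp only [map_add, hx, hy]
    | tmul w y =>
      have e : ∀ (z : ℂ) (x : L), (fun i => z * (ψ.symm x i : ℂ)) =
          z • ((Int.castRingHom ℂ) ∘ ψ.symm x) := fun z x => rfl
      rw [complexCoords_tmul, complexCoords_tmul, e, e, map_smul, map_smul, LinearMap.smul_apply,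
        modelForm_map, LinearMap.BilinForm.baseChange_tmul, ← ψ.map_app, isometry_apply_symm,
        isometry_apply_symm]
      simp
      ring

theorem complexCoords_mem_modelCone {v : ℂ ⊗[ℤ] L} :
    complexCoords ψ v ∈ modelCone ↔ v ∈ periodCone b := by
  rw [modelCone, periodCone, Set.mem_ofPred_eq, Set.mem_ofPred_eq, ← complexCoords_conj,
    modelForm_complexCoords, modelForm_complexCoords]

theorem baseChange_one_tmul_eq (β : ModelIndex → ℤ) (v : ℂ ⊗[ℤ] L) :
    b.baseChange ℂ (1 ⊗ₜ ψ β) v = modelForm ℂ (fun i => (β i : ℂ)) (complexCoords ψ v) := by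
  rw [← modelForm_complexCoords ψ, complexCoords_tmul, isometry_symm_apply]
  simp

end Coordinates

/-! ### Local finiteness -/

section BaseChange

variable {L L' : Type*} [AddCommGroup L] [AddCommGroup L'] {b : LinearMap.BilinForm ℤ L}
  {b' : LinearMap.BilinForm ℤ L'}

/-- By flatness the complex hyperplane is determined by its integral points, so β may be replaced by
any vector with the same integral complement. -/
theorem baseChange_eq_zero_iff_of_ker {β γ : L} (h : ∀ x, b β x = 0 ↔ b γ x = 0)
    (v : ℂ ⊗[ℤ] L) : b.baseChange ℂ (1 ⊗ₜ β) v = 0 ↔ b.baseChange ℂ (1 ⊗ₜ γ) v = 0 := by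
  have e : LinearMap.ker (b β) = LinearMap.ker (b γ) := by
    ext x
    exact h x
  rw [← baseChange_apply_one_tmul, ← baseChange_apply_one_tmul, ← mem_baseChange_ker_iff,
    ← mem_baseChange_ker_iff, e]

theorem baseChange_isometry (φ : b.IsometryEquiv b') (v w : ℂ ⊗[ℤ] L) :
    b'.baseChange ℂ ((φ : L ≃ₗ[ℤ] L').baseChange ℤ ℂ L L' v)
      ((φ : L ≃ₗ[ℤ] L').baseChange ℤ ℂ L L' w) = b.baseChange ℂ v w := by
  induction v with
  | zero => simp
  | add x x' hx hx' => simp [hx, hx']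
  | tmul z x =>
    induction w with
    | zero => simp
    | add y y' hy hy' => simp only [map_add, hy, hy']
    | tmul w y => simp

end BaseChange

theorem continuous_modelForm_im :
    Continuous fun w : ModelIndex → ℂ => modelForm ℝ (fun i => (w i).im) fun i => (w i).im := by
  simp only [modelForm_apply, tubeForm_apply, e8Form_apply, Function.comp_apply]
  fun_prop

theorem continuous_planeNorm : Continuous planeNorm := by
  unfold planeNorm
  fun_prop

/-- Near each point of the cone, only finitely many vectors of given square are orthogonal to some
point of the cone. -/
theorem exists_finite_orthogonal {p : ModelIndex → ℂ} (hp : p ∈ modelCone) (d : ℕ) :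
    ∃ U : Set (ModelIndex → ℂ), IsOpen U ∧ p ∈ U ∧
      {β : ModelIndex → ℤ | modelForm ℤ β β = -(d : ℤ) ∧
        ∃ v ∈ U, v ∈ modelCone ∧ modelForm ℂ (fun i => (β i : ℂ)) v = 0}.Finite := by
  set c : (ModelIndex → ℂ) → ℝ := fun w => modelForm ℝ (fun i => (w i).im) fun i => (w i).im
    with hc
  set P : (ModelIndex → ℂ) → ℝ := fun w => planeNorm (fun i => (w i).re) +
    planeNorm fun i => (w i).im with hP
  have hPc : Continuous P :=
    (continuous_planeNorm.comp (by fun_prop)).add (continuous_planeNorm.comp (by fun_prop))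
  have hcp : 0 < c p := ((mem_modelCone_iff p).1 hp).2.2
  have hP0 : ∀ w, 0 ≤ P w := fun w => by
    simp only [hP, planeNorm]
    positivity
  -- The bound of `sq_le_of_orthogonal` with N = d, uniform on the neighbourhood where c exceeds
  -- half its value at p and P is less than P(p) + 1. Integral vectors with bounded coordinates are
  -- finite in number.
  set C : ℝ := 30 * (d + d / (c p / 2) * (P p + 1)) with hC
  refine ⟨{w | c p / 2 < c w ∧ P w < P p + 1},
    (isOpen_lt continuous_const continuous_modelForm_im).inter (isOpen_lt hPc continuous_const),
    ⟨by linarith, by linarith⟩,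
    (Set.finite_Icc (fun _ => -⌈C⌉ : ModelIndex → ℤ) fun _ => ⌈C⌉).subset ?_⟩
  rintro β ⟨hβ, v, ⟨hv1, hv2⟩, hv, hβv⟩
  obtain ⟨e1, e2, e3⟩ := (mem_modelCone_iff v).1 hv
  rw [modelForm_int, Complex.ext_iff] at hβv
  simp only [Complex.add_re, Complex.ofReal_re, Complex.mul_re, Complex.I_re, mul_zero,
    Complex.ofReal_im, Complex.I_im, sub_zero, add_zero, Complex.zero_re, Complex.add_im,
    Complex.mul_im, mul_one, zero_add, Complex.zero_im] at hβv
  have hβ' : modelForm ℝ (fun i => (β i : ℝ)) (fun i => (β i : ℝ)) = -(d : ℝ) := by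
    have := modelForm_map (Int.castRingHom ℝ) β β
    rw [hβ] at this
    refine this.trans ?_
    simp
  have key : ∀ i, |β i| ≤ ⌈C⌉ := by
    intro i
    have h1 := sq_le_of_orthogonal e3 (Nat.cast_nonneg d) e1 rfl e2 hβv.1 hβv.2 hβ' i
    have h2 : (d : ℝ) / c v * P v ≤ d / (c p / 2) * (P p + 1) := by
      refine mul_le_mul ?_ hv2.le (hP0 v) (by positivity)
      exact div_le_div_of_nonneg_left (Nat.cast_nonneg d) (by positivity) hv1.le
    have h3 : (β i : ℝ) ^ 2 ≤ C := h1.trans (by rw [hC]; simp only [hP, hc] at h2 ⊢; linarith)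
    have h4 : β i ^ 2 ≤ ⌈C⌉ := by
      have := h3.trans (Int.le_ceil C)
      exact_mod_cast this
    have h5 : |β i| ≤ β i ^ 2 := by
      have := Int.le_self_sq |β i|
      rwa [sq_abs] at this
    exact h5.trans h4
  exact ⟨fun i => (abs_le.1 (key i)).1, fun i => (abs_le.1 (key i)).2⟩

/-- The union of the hyperplanes orthogonal to the `heegnerVectors` is a closed analytic subset of
the cone over the period domain. -/
theorem isAnalyticIn_heegnerVectors {L : Type*} [AddCommGroup L] [Module.Free ℤ L]
    [Module.Finite ℤ L] {b : LinearMap.BilinForm ℤ L} (ψ : (modelForm ℤ).IsometryEquiv b) {d : ℕ}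
    (hd : 0 < d) : IsAnalyticIn (periodCone b)
      {v | ∃ β ∈ heegnerVectors b d, b.baseChange ℂ (1 ⊗ₜ β) v = 0} := by
  classical
  -- Each β is replaced by the image of a `stdVector`, of square exactly -d. Without this
  -- normalization the multiples of β would spoil finiteness.
  have hA : ∀ v : ℂ ⊗[ℤ] L, (∃ β ∈ heegnerVectors b d, b.baseChange ℂ (1 ⊗ₜ β) v = 0) ↔
      ∃ β ∈ heegnerVectors (modelForm ℤ) d, modelForm ℤ β β = -(d : ℤ) ∧
        modelForm ℂ (fun i => (β i : ℂ)) (complexCoords ψ v) = 0 := by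
    intro v
    constructor
    · rintro ⟨γ, hγ, hv⟩
      have hγ' := map_mem_heegnerVectors ψ.symm hγ
      obtain ⟨q, a, c, hq, -, H⟩ := exists_stdVector_of_mem_heegnerVectors hγ'
      obtain ⟨g, hg⟩ := H _ hγ'
      refine ⟨g.symm (stdVector q a c), map_mem_heegnerVectors _
        (stdVector_mem_heegnerVectors hd hq), ?_, ?_⟩
      · rw [g.symm.map_app, modelForm_stdVector_self, hq]
      · rw [← baseChange_one_tmul_eq]
        refine (baseChange_eq_zero_iff_of_ker (fun x => ?_) v).1 hv
        have h1 := hg (ψ.symm x)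
        rw [ψ.symm.map_app] at h1
        rw [h1, ← isometry_apply_symm g (stdVector q a c), g.map_app, ← ψ.map_app,
          isometry_apply_symm, isometry_apply_symm]
    · rintro ⟨β, hβ, -, hv⟩
      refine ⟨ψ β, map_mem_heegnerVectors ψ hβ, ?_⟩
      rw [baseChange_one_tmul_eq, hv]
  intro p hp
  obtain ⟨U, hU, hpU, hfin⟩ := exists_finite_orthogonal ((complexCoords_mem_modelCone ψ).2 hp) d
  let κ : (Fin (Module.finrank ℂ (ℂ ⊗[ℤ] L)) → ℂ) →ₗ[ℂ] (ModelIndex → ℂ) :=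
    (complexCoords ψ).toLinearMap ∘ₗ (Module.finBasis ℂ (ℂ ⊗[ℤ] L)).equivFun.symm.toLinearMap
  have hκ : ∀ v, κ ((Module.finBasis ℂ (ℂ ⊗[ℤ] L)).equivFun v) = complexCoords ψ v := by
    intro v
    simp only [κ, LinearMap.comp_apply, LinearEquiv.coe_coe, LinearEquiv.symm_apply_apply]
  -- A single equation suffices: the product of the finitely many linear forms whose hyperplanes
  -- meet the cone in this neighbourhood.
  refine ⟨κ ⁻¹' U, hU.preimage κ.continuous_of_finiteDimensional, by
    rw [Set.mem_preimage, hκ]; exact hpU, 1,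
    fun _ u => ∏ β ∈ hfin.toFinset.filter (· ∈ heegnerVectors (modelForm ℤ) d),
      modelForm ℂ (fun i => (β i : ℂ)) (κ u), fun _ => ?_, fun v hv hvU => ?_⟩
  · have hlin : ∀ β : ModelIndex → ℤ,
        Differentiable ℂ fun u => modelForm ℂ (fun i => (β i : ℂ)) (κ u) := fun β =>
      (LinearMap.toContinuousLinearMap
        ((modelForm ℂ (fun i => (β i : ℂ))) ∘ₗ κ)).differentiable
    exact fun x _ => (HasFDerivAt.finsetProd fun β _ =>
      (hlin β x).hasFDerivAt).differentiableAt.differentiableWithinAt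
  · rw [Set.mem_ofPred_eq, hA]
    rw [Set.mem_preimage, hκ] at hvU
    simp only [hκ, Finset.prod_eq_zero_iff, forall_const, Finset.mem_filter, Set.Finite.mem_toFinset]
    constructor
    · rintro ⟨β, hβ, hβ2, hβv⟩
      exact ⟨β, ⟨⟨hβ2, _, hvU, (complexCoords_mem_modelCone ψ).2 hv, hβv⟩, hβ⟩, hβv⟩
    · rintro ⟨β, ⟨⟨hβ2, -⟩, hβ⟩, hβv⟩
      exact ⟨β, hβ, hβ2, hβv⟩

/-! ### Analytic subsets and curves -/

section Curves

variable {V : Type*} [AddCommGroup V] [Module ℂ V] [Module.Finite ℂ V] {D A : Set V} {F : ℂ → V}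

theorem IsAnalyticIn.congr {A' : Set V} (h : IsAnalyticIn D A) (e : ∀ v ∈ D, v ∈ A ↔ v ∈ A') :
    IsAnalyticIn D A' := by
  intro p hp
  obtain ⟨U, hU, hpU, r, f, hf, H⟩ := h p hp
  exact ⟨U, hU, hpU, r, f, hf, fun v hv hvU => (e v hv).symm.trans (H v hv hvU)⟩

/-- The inverse image of an analytic subset by a holomorphic curve is an analytic subset. -/
theorem IsAnalyticIn.exists_ball (hA : IsAnalyticIn D A) {Ω : Set ℂ} (hΩ : IsOpen Ω)
    (hF : Differentiable ℂ fun s => (Module.finBasis ℂ V).equivFun (F s))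
    (hD : ∀ s ∈ Ω, F s ∈ D) {s : ℂ} (hs : s ∈ Ω) :
    ∃ ε > 0, Metric.ball s ε ⊆ Ω ∧ ∃ (r : ℕ) (f : Fin r → ℂ → ℂ),
      (∀ i, DifferentiableOn ℂ (f i) (Metric.ball s ε)) ∧
      ∀ t ∈ Metric.ball s ε, F t ∈ A ↔ ∀ i, f i t = 0 := by
  obtain ⟨U, hU, hsU, r, f, hf, H⟩ := hA _ (hD s hs)
  obtain ⟨ε, hε, hball⟩ := Metric.isOpen_iff.1 (hΩ.inter (hU.preimage hF.continuous)) s ⟨hs, hsU⟩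
  refine ⟨ε, hε, fun t ht => (hball ht).1, r, fun i t => f i _, fun i => ?_, fun t ht =>
    H _ (hD t (hball ht).1) (hball ht).2⟩
  exact (hf i).comp hF.differentiableOn fun t ht => (hball ht).2

/-- A connected holomorphic curve contained in the union of two analytic subsets is contained in one
of them. -/
theorem subset_or_subset_of_curve {A' : Set V} (hA : IsAnalyticIn D A) (hA' : IsAnalyticIn D A')
    {Ω : Set ℂ} (hΩ : IsOpen Ω) (hc : IsPreconnected Ω)
    (hF : Differentiable ℂ fun s => (Module.finBasis ℂ V).equivFun (F s))
    (hD : ∀ s ∈ Ω, F s ∈ D) (hAA' : ∀ s ∈ Ω, F s ∈ A ∪ A') :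
    (∀ s ∈ Ω, F s ∈ A) ∨ ∀ s ∈ Ω, F s ∈ A' := by
  by_contra! hno
  obtain ⟨⟨s₀, hs₀, hn⟩, s₁, hs₁, hn₁⟩ := hno
  -- Some defining function of A is nonzero at s₀, hence near s₀, so nearby points of the curve are
  -- in A'.
  have hint : s₀ ∈ interior {s | s ∈ Ω ∧ F s ∈ A'} := by
    obtain ⟨ε, hε, hball, r, f, hf, H⟩ := hA.exists_ball hΩ hF hD hs₀
    have hs := Metric.mem_ball_self (x := s₀) hε
    rw [H s₀ hs] at hn
    push Not at hn
    obtain ⟨i, hi⟩ := hn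
    have hcont := ((hf i).differentiableAt (Metric.isOpen_ball.mem_nhds hs)).continuousAt
    rw [mem_interior_iff_mem_nhds]
    filter_upwards [hcont.eventually_ne hi, Metric.isOpen_ball.mem_nhds hs] with t ht htb
    refine ⟨hball htb, (hAA' t (hball htb)).resolve_left fun hA => ?_⟩
    exact ht ((H t htb).1 hA i)
  -- The interior is closed in Ω: on a ball around a limit point the equations of A' vanish on a
  -- nonempty open set, hence everywhere by the identity theorem.
  have hsub : Ω ⊆ interior {s | s ∈ Ω ∧ F s ∈ A'} := by
    refine hc.subset_of_closure_inter_subset isOpen_interior ⟨s₀, hs₀, hint⟩ ?_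
    rintro s ⟨hs, hsΩ⟩
    obtain ⟨ε, hε, hball, r, f, hf, H⟩ := hA'.exists_ball hΩ hF hD hsΩ
    obtain ⟨t, ht, htb⟩ := Metric.mem_closure_iff.1 hs ε hε
    rw [dist_comm] at htb
    have hsub : Metric.ball s ε ⊆ {s | s ∈ Ω ∧ F s ∈ A'} := by
      intro u hu
      refine ⟨hball hu, (H u hu).2 fun i => ?_⟩
      have hev : f i =ᶠ[nhds t] 0 := by
        filter_upwards [mem_interior_iff_mem_nhds.1 ht, Metric.isOpen_ball.mem_nhds htb] with u hu hub
        exact (H u hub).1 hu.2 i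
      exact ((hf i).analyticOnNhd Metric.isOpen_ball).eqOn_zero_of_preconnected_of_eventuallyEq_zero
        (convex_ball s ε).isPreconnected htb hev hu
    exact interior_maximal hsub Metric.isOpen_ball (Metric.mem_ball_self hε)
  exact hn₁ (interior_subset (hsub hs₁)).2

end Curves

/-! ### Tube coordinates -/

section Tube

theorem mem_modelCone_iff_im {v : ModelIndex → ℂ} : v ∈ modelCone ↔ modelForm ℂ v v = 0 ∧
    0 < modelForm ℝ (fun i => (v i).im) (fun i => (v i).im) := by
  constructor
  · intro h
    exact ⟨h.1, ((mem_modelCone_iff v).1 h).2.2⟩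
  · rintro ⟨h1, h2⟩
    refine ⟨h1, ?_⟩
    rw [modelForm_complex, Complex.ext_iff] at h1
    simp only [Complex.add_re, Complex.ofReal_re, Complex.mul_re, Complex.I_re, mul_zero,
      Complex.ofReal_im, Complex.I_im, Complex.zero_re] at h1
    rw [modelForm_conj, Complex.ofReal_re]
    linarith [h1.1]

/-- If this coordinate vanished, the real and imaginary parts would be orthogonal vectors of
positive square for `tubeForm`. So every period can be scaled to have coordinate 1 there. -/
theorem coord_ne_zero_of_mem_modelCone {v : ModelIndex → ℂ} (hv : v ∈ modelCone) :
    v (.inl 3) ≠ 0 := by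
  intro h
  obtain ⟨h1, h2, h3⟩ := (mem_modelCone_iff v).1 hv
  simp only [modelForm_apply, h, Complex.zero_re, Complex.zero_im, mul_zero, zero_mul,
    add_zero] at h1 h2 h3
  exact tubeForm_ne_zero (h1 ▸ h3) h3 h2

/-- The vectors of the cone with coordinate `1` along a given isotropic vector and with imaginary
part in a given component of the light cone. -/
def tubeDomain : Set (ModelIndex → ℂ) :=
  {v | v ∈ modelCone ∧ v (.inl 3) = 1 ∧ (fun i => (v i).im) ∈ lightCone}

theorem tubeForm_im_pos {v : ModelIndex → ℂ} (hv : v ∈ modelCone) (h : v (.inl 3) = 1) :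
    0 < tubeForm ℝ (fun i => (v i).im) (fun i => (v i).im) := by
  have := ((mem_modelCone_iff v).1 hv).2.2
  simpa [modelForm_apply, h] using this

theorem tubeForm_update {R : Type*} [CommRing R] (u w : ModelIndex → R) (c c' : R) :
    tubeForm R (Function.update u (.inl 2) c) (Function.update w (.inl 2) c') =
      tubeForm R u w := by
  have e : ∀ (u : ModelIndex → R) (c : R), Function.update u (.inl 2) c ∘ Sum.inr =
      (u ∘ Sum.inr : Fin 8 × Fin 2 → R) := fun u c => by
    funext i
    simp
  rw [tubeForm_apply, tubeForm_apply, e, e]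
  simp

/-- The point of the cone with given tube coordinates. -/
def tubePoint (u : ModelIndex → ℂ) : ModelIndex → ℂ :=
  Function.update u (.inl 2) (-tubeForm ℂ u u / 2)

/-- Coordinate 2 is chosen so that the vector is isotropic. As coordinate 3 is the real number 1,
the square of the imaginary part is its `tubeForm` square, whatever coordinate 2 is. -/
theorem tubePoint_mem {u : ModelIndex → ℂ} (h : u (.inl 3) = 1)
    (hu : (fun i => (u i).im) ∈ lightCone) : tubePoint u ∈ modelCone := by
  have e : (fun i => (tubePoint u i).im) =
      Function.update (fun i => (u i).im) (.inl 2) (-tubeForm ℂ u u / 2).im := by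
    funext i
    rw [tubePoint, Function.update_apply, Function.update_apply]
    split_ifs <;> rfl
  rw [mem_modelCone_iff_im, e, modelForm_apply, modelForm_apply, tubeForm_update, tubePoint,
    tubeForm_update]
  refine ⟨?_, ?_⟩
  · simp [h]
    ring
  · simpa [h] using hu.2

theorem tubePoint_eq_self {v : ModelIndex → ℂ} (hv : v ∈ tubeDomain) : tubePoint v = v := by
  have h := hv.1.1
  rw [modelForm_apply, hv.2.1] at h
  rw [tubePoint, Function.update_eq_self_iff]
  linear_combination (-1 / 2) * h

theorem modelForm_stdVector_complex (q a b : ℤ) (v : ModelIndex → ℂ) :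
    modelForm ℂ (fun i => (stdVector q a b i : ℂ)) v =
      2 * (q * v (.inl 0) + v (.inl 1) - a * v (.inl 4) - b * v (.inl 5)) := by
  have e : (fun i => (stdVector q a b i : ℂ)) ∘ Sum.inr = (0 : Fin 8 × Fin 2 → ℂ) := by
    funext i
    simp [stdVector]
  rw [modelForm_apply, tubeForm_apply, e, map_zero, LinearMap.zero_apply]
  simp [stdVector]
  ring

theorem differentiable_tubeForm {u : ℂ → ModelIndex → ℂ} (hu : Differentiable ℂ u) :
    Differentiable ℂ fun s => tubeForm ℂ (u s) (u s) := by
  have h : ∀ i, Differentiable ℂ fun s => u s i := fun i => differentiable_pi.1 hu i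
  simp only [tubeForm_apply, e8Form_apply, Function.comp_apply]
  fun_prop

/-- Two points of the tube domain orthogonal to `stdVector q a b` are on a connected holomorphic
curve of such points. -/
theorem exists_curve {q a b : ℤ} {v w : ModelIndex → ℂ} (hv : v ∈ tubeDomain) (hw : w ∈ tubeDomain)
    (hvo : modelForm ℂ (fun i => (stdVector q a b i : ℂ)) v = 0)
    (hwo : modelForm ℂ (fun i => (stdVector q a b i : ℂ)) w = 0) :
    ∃ (Ω : Set ℂ) (F : ℂ → ModelIndex → ℂ), IsOpen Ω ∧ IsPreconnected Ω ∧ Differentiable ℂ F ∧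
      (∀ s ∈ Ω, F s ∈ modelCone ∧ modelForm ℂ (fun i => (stdVector q a b i : ℂ)) (F s) = 0) ∧
      (∃ s ∈ Ω, F s = v) ∧ ∃ s ∈ Ω, F s = w := by
  -- The complex line through v and w; coordinate 2 is corrected afterwards by `tubePoint`.
  let u : ℂ → ModelIndex → ℂ := fun s => v + s • (w - v)
  have hu : Differentiable ℂ u := by fun_prop
  let im : (ModelIndex → ℂ) →ₗ[ℝ] (ModelIndex → ℝ) :=
    { toFun := fun v i => (v i).im
      map_add' := fun _ _ => by funext i; simp
      map_smul' := fun _ _ => by funext i; simp }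
  -- The imaginary part is real affine in s, so the parameters that land in the convex light cone
  -- form a convex, hence connected, open set.
  let A : ℂ →ᵃ[ℝ] (ModelIndex → ℝ) :=
    (im ∘ₗ (LinearMap.toSpanSingleton ℂ _ (w - v)).restrictScalars ℝ).toAffineMap +
      AffineMap.const ℝ ℂ (im v)
  have hA : ∀ s, A s = fun i => (u s i).im := by
    intro s
    funext i
    simp [A, u, im]
    ring
  have hlc : IsOpen lightCone := by
    have hcont : Continuous fun y : ModelIndex → ℝ => tubeForm ℝ y y := by
      simp only [tubeForm_apply, e8Form_apply, Function.comp_apply]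
      fun_prop
    have h0 : Continuous fun y : ModelIndex → ℝ => y (.inl 0) := continuous_apply _
    exact (isOpen_lt continuous_const h0).inter (isOpen_lt continuous_const hcont)
  have hu0 : u 0 = v := by simp [u]
  have hu1 : u 1 = w := by simp [u]
  refine ⟨A ⁻¹' lightCone, fun s => tubePoint (u s), ?_, ?_, ?_, fun s hs => ⟨?_, ?_⟩,
    ⟨0, ?_, ?_⟩, ⟨1, ?_, ?_⟩⟩
  · exact hlc.preimage A.continuous_of_finiteDimensional
  · exact (convex_lightCone.affine_preimage A).isPreconnected
  · rw [differentiable_pi]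
    intro i
    have h1 := differentiable_tubeForm hu
    have h2 : Differentiable ℂ fun s => u s i := differentiable_pi.1 hu i
    by_cases hi : i = .inl 2
    · subst hi
      simp only [tubePoint, Function.update_self]
      fun_prop
    · simp only [tubePoint, Function.update_of_ne hi]
      exact h2
  · rw [Set.mem_preimage, hA] at hs
    exact tubePoint_mem (by simp [u, hv.2.1, hw.2.1]) hs
  -- Orthogonality to `stdVector` does not involve coordinate 2, so the correction does not affect
  -- it and it holds along the line by linearity.
  · rw [modelForm_stdVector_complex] at hvo hwo ⊢
    simp [tubePoint, u]
    linear_combination (1 - s) / 2 * hvo + s / 2 * hwo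
  · rw [Set.mem_preimage, hA, hu0]; exact hv.2.2
  · change tubePoint (u 0) = v
    rw [hu0]; exact tubePoint_eq_self hv
  · rw [Set.mem_preimage, hA, hu1]; exact hw.2.2
  · change tubePoint (u 1) = w
    rw [hu1]; exact tubePoint_eq_self hw

/-- The imaginary part has coordinates (2, a² + b² - 2q, a, b) in places 0, 1, 4, 5: it is
orthogonal to `stdVector q a b` and its `tubeForm` square is 2a² + 2b² - 8q = d > 0. -/
theorem exists_mem_modelCone_orthogonal {q a b : ℤ} {d : ℕ} (hd : 0 < d)
    (h : 8 * q - 2 * a ^ 2 - 2 * b ^ 2 = -(d : ℤ)) :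
    ∃ v ∈ modelCone, modelForm ℂ (fun i => (stdVector q a b i : ℂ)) v = 0 := by
  let v : ModelIndex → ℂ := Sum.elim ![2 * Complex.I, ((a ^ 2 + b ^ 2 - 2 * q : ℝ) : ℂ) * Complex.I,
    0, 1, (a : ℝ) * Complex.I, (b : ℝ) * Complex.I] 0
  have e : (fun i => (v i).im) = (Sum.elim ![2, (a ^ 2 + b ^ 2 - 2 * q : ℝ), 0, 0, (a : ℝ), b] 0 :
      ModelIndex → ℝ) := by
    funext i
    rcases i with i | i
    · fin_cases i
      · simp [v]
      · exact (Complex.mul_I_im _).trans (Complex.ofReal_re _)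
      all_goals simp [v]
    · simp [v]
  have hd' : 8 * (q : ℝ) - 2 * a ^ 2 - 2 * b ^ 2 = -(d : ℝ) := by exact_mod_cast h
  have hd0 : (0 : ℝ) < d := by exact_mod_cast hd
  refine ⟨tubePoint v, tubePoint_mem (by simp [v]) ?_, ?_⟩
  · rw [e]
    refine ⟨by simp, ?_⟩
    rw [tubeForm_apply, Sum.elim_comp_inr, map_zero]
    simp
    linarith
  · rw [modelForm_stdVector_complex]
    simp [tubePoint, v]
    ring

end Tube

/-! ### Heegner loci -/

section Locus

variable {L L' : Type*} [AddCommGroup L] [AddCommGroup L'] {b : LinearMap.BilinForm ℤ L}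
  {b' : LinearMap.BilinForm ℤ L'}

theorem PeriodDomain.mk_smul {z : ℂ} (hz : z ≠ 0) {v : ℂ ⊗[ℤ] L} (hv : v ∈ periodCone b) :
    PeriodDomain.mk b (z • v) (smul_mem_periodCone hz hv) = PeriodDomain.mk b v hv := by
  refine Subtype.ext ?_
  change Projectivization.mk ℂ _ _ = Projectivization.mk ℂ _ _
  rw [Projectivization.mk_eq_mk_iff']
  exact ⟨z, rfl⟩

variable [Module.Free ℤ L] [Module.Finite ℤ L] [Module.Free ℤ L'] [Module.Finite ℤ L'] {d : ℕ}

theorem mk_mem_heegnerLocus_iff {v : ℂ ⊗[ℤ] L} (hv : v ∈ periodCone b) :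
    PeriodDomain.mk b v hv ∈ heegnerLocus b d ↔
      ∃ β ∈ heegnerVectors b d, b.baseChange ℂ (1 ⊗ₜ β) v = 0 :=
  exists_congr fun β => and_congr_right fun _ => mk_submodule_le_iff hv β

theorem map_mem_heegnerLocus (φ : b.IsometryEquiv b') {x : PeriodDomain b}
    (hx : x ∈ heegnerLocus b d) : PeriodDomain.map φ x ∈ heegnerLocus b' d := by
  obtain ⟨v, hv, rfl⟩ := x.exists_mk
  obtain ⟨β, hβ, h⟩ := (mk_mem_heegnerLocus_iff hv).1 hx
  rw [PeriodDomain.map_mk, mk_mem_heegnerLocus_iff]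
  refine ⟨φ β, map_mem_heegnerVectors φ hβ, ?_⟩
  rw [← h, ← baseChange_isometry φ, LinearEquiv.baseChange_tmul]
  rfl

/-- The locus is defined by squares and discriminants in the lattice, so isometries in both
directions preserve it. -/
theorem map_image_heegnerLocus (φ : b.IsometryEquiv b') :
    PeriodDomain.map φ '' heegnerLocus b d = heegnerLocus b' d := by
  refine Set.Subset.antisymm ?_ fun y hy => ?_
  · rintro _ ⟨x, hx, rfl⟩
    exact map_mem_heegnerLocus φ hx
  · refine ⟨_, map_mem_heegnerLocus φ.symm hy, ?_⟩
    rw [← PeriodDomain.map_trans]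
    have e : φ.symm.trans φ = LinearMap.BilinForm.IsometryEquiv.refl b' :=
      DFunLike.ext _ _ fun y => isometry_apply_symm φ y
    rw [e, PeriodDomain.map_refl]

theorem heegnerLocus_nonempty_iff (ψ : (modelForm ℤ).IsometryEquiv b) (hd : 0 < d) :
    (heegnerLocus b d).Nonempty ↔ ∃ e : ℕ, d = 2 * e ∧ ¬ e ≡ 3 [MOD 4] := by
  rw [← heegnerVectors_nonempty_iff hd]
  constructor
  · rintro ⟨x, β, hβ, -⟩
    exact ⟨ψ.symm β, map_mem_heegnerVectors ψ.symm hβ⟩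
  · rintro ⟨β, hβ⟩
    obtain ⟨q, a, c, hq, -, -⟩ := exists_stdVector_of_mem_heegnerVectors hβ
    obtain ⟨v, hv, hvo⟩ := exists_mem_modelCone_orthogonal hd hq
    have e := (complexCoords ψ).apply_symm_apply v
    have hv' : (complexCoords ψ).symm v ∈ periodCone b := by
      rw [← complexCoords_mem_modelCone ψ, e]
      exact hv
    refine ⟨PeriodDomain.mk b _ hv', (mk_mem_heegnerLocus_iff hv').2 ⟨ψ (stdVector q a c),
      map_mem_heegnerVectors ψ (stdVector_mem_heegnerVectors hd hq), ?_⟩⟩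
    rw [baseChange_one_tmul_eq, e, hvo]

end Locus

/-- The isometry of the model lattice that is `-1` on the second hyperbolic plane. -/
def negPlane : (modelForm ℤ).IsometryEquiv (modelForm ℤ) :=
  let f : (ModelIndex → ℤ) →ₗ[ℤ] (ModelIndex → ℤ) :=
    { toFun := fun x i => if i = .inl 2 ∨ i = .inl 3 then -x i else x i
      map_add' := fun x y => by
        funext i
        simp only [Pi.add_apply]
        split_ifs <;> ring
      map_smul' := fun c x => by
        funext i
        simp only [Pi.smul_apply, smul_eq_mul, RingHom.id_apply]
        split_ifs <;> ring }
  have hf : ∀ x, f (f x) = x := fun x => by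
    funext i
    simp only [f, LinearMap.coe_mk, AddHom.coe_mk]
    split_ifs <;> simp
  isometryOfInverse f f hf hf fun x y => by
    have e : ∀ x, f x ∘ Sum.inr = x ∘ Sum.inr := fun x => rfl
    rw [modelForm_apply, modelForm_apply, tubeForm_apply, tubeForm_apply, e, e]
    simp [f]

theorem negPlane_apply (x : ModelIndex → ℤ) (i : ModelIndex) :
    negPlane x i = if i = .inl 2 ∨ i = .inl 3 then -x i else x i := rfl

theorem PeriodSpace.mk_map {Λ : Type*} [AddCommGroup Λ] {B : LinearMap.BilinForm ℤ Λ} {h : Λ}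
    {φ : (perpForm B h).IsometryEquiv (perpForm B h)} (hφ : InPeriodGroup B h φ)
    (x : PeriodDomain (perpForm B h)) :
    PeriodSpace.mk B h (PeriodDomain.map φ x) = PeriodSpace.mk B h x :=
  (Quotient.sound (s := periodSetoid B h) ⟨φ, hφ, rfl⟩).symm

/-! ### Closedness and irreducibility of the image in the period space. -/

section Irreducible

variable {Λ : Type*} [AddCommGroup Λ] [Module.Free ℤ Λ] [Module.Finite ℤ Λ]
  {B : LinearMap.BilinForm ℤ Λ} {h : Λ} {d : ℕ}

/-- The locus is stable under all isometries, hence saturated for the quotient map. -/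
theorem mk_mem_image_heegnerLocus_iff {x : PeriodDomain (perpForm B h)} :
    PeriodSpace.mk B h x ∈ PeriodSpace.mk B h '' heegnerLocus (perpForm B h) d ↔
      x ∈ heegnerLocus (perpForm B h) d := by
  refine ⟨?_, Set.mem_image_of_mem _⟩
  rintro ⟨y, hy, hyx⟩
  obtain ⟨γ, -, rfl⟩ := Quotient.exact (s := periodSetoid B h) hyx
  exact map_mem_heegnerLocus γ hy

theorem isClosedAnalytic_image_heegnerLocus (ψ : (modelForm ℤ).IsometryEquiv (perpForm B h))
    (hd : 0 < d) :
    IsClosedAnalytic (PeriodSpace.mk B h '' heegnerLocus (perpForm B h) d) :=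
  (isAnalyticIn_heegnerVectors ψ hd).congr fun v hv => by
    rw [Set.mem_ofPred_eq, Set.mem_ofPred_eq, ← mk_mem_heegnerLocus_iff hv,
      ← mk_mem_image_heegnerLocus_iff]
    exact ⟨fun h => ⟨hv, h⟩, fun ⟨_, h⟩ => h⟩

theorem complexCoords_baseChange_negPlane {L : Type*} [AddCommGroup L]
    {b : LinearMap.BilinForm ℤ L} (ψ : (modelForm ℤ).IsometryEquiv b) (v : ℂ ⊗[ℤ] L)
    (i : ModelIndex) :
    complexCoords ψ (((ψ.symm.trans (negPlane.trans ψ) : b.IsometryEquiv b) :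
      L ≃ₗ[ℤ] L).baseChange ℤ ℂ L L v) i =
      if i = .inl 2 ∨ i = .inl 3 then -complexCoords ψ v i else complexCoords ψ v i := by
  induction v with
  | zero => simp
  | add x y hx hy =>
    rw [map_add, map_add, map_add, Pi.add_apply, Pi.add_apply, hx, hy]
    split_ifs <;> ring
  | tmul z x =>
    rw [LinearEquiv.baseChange_tmul, complexCoords_tmul, complexCoords_tmul]
    change z * (ψ.symm (ψ (negPlane (ψ.symm x))) i : ℂ) = _
    rw [isometry_symm_apply, negPlane_apply]
    split_ifs
    · push_cast
      ring
    · rfl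

/-- If every isometry of `h^⊥` is in the period group, then each point of the image of a Heegner
locus has a representative in the tube domain that is orthogonal to a given vector. -/
theorem exists_lift (hγ : ∀ γ, InPeriodGroup B h γ)
    (ψ : (modelForm ℤ).IsometryEquiv (perpForm B h)) {q a c : ℤ}
    (H : ∀ γ ∈ heegnerVectors (modelForm ℤ) d,
      ∃ g : (modelForm ℤ).IsometryEquiv (modelForm ℤ),
        ∀ x, modelForm ℤ γ x = 0 ↔ modelForm ℤ (stdVector q a c) (g x) = 0)
    {p : PeriodSpace B h} (hp : p ∈ PeriodSpace.mk B h '' heegnerLocus (perpForm B h) d) :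
    ∃ v, ∃ hv : v ∈ periodCone (perpForm B h),
      PeriodSpace.mk B h (PeriodDomain.mk _ v hv) = p ∧ complexCoords ψ v ∈ tubeDomain ∧
      modelForm ℂ (fun i => (stdVector q a c i : ℂ)) (complexCoords ψ v) = 0 := by
  obtain ⟨x, hx, rfl⟩ := hp
  obtain ⟨v₀, hv₀, rfl⟩ := x.exists_mk
  obtain ⟨β, hβ, hβv⟩ := (mk_mem_heegnerLocus_iff hv₀).1 hx
  obtain ⟨g, hg⟩ := H _ (map_mem_heegnerVectors ψ.symm hβ)
  -- This isometry carries the hyperplane of β to that of `stdVector`; by `hγ` it does not change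
  -- the point of the period space.
  let φ : (perpForm B h).IsometryEquiv (perpForm B h) := ψ.symm.trans (g.trans ψ)
  have hφ : ∀ y, φ y = ψ (g (ψ.symm y)) := fun _ => rfl
  obtain ⟨v₁, hv₁, e₁, o₁⟩ : ∃ v, ∃ hv : v ∈ periodCone (perpForm B h),
      PeriodSpace.mk B h (PeriodDomain.mk _ v hv) = PeriodSpace.mk B h (PeriodDomain.mk _ v₀ hv₀) ∧
      modelForm ℂ (fun i => (stdVector q a c i : ℂ)) (complexCoords ψ v) = 0 := by
    refine ⟨_, map_mem_periodCone φ hv₀, ?_, ?_⟩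
    · rw [← PeriodDomain.map_mk, PeriodSpace.mk_map (hγ φ)]
    · rw [← baseChange_one_tmul_eq, ← isometry_apply_symm φ (ψ (stdVector q a c))]
      have e := baseChange_isometry φ (1 ⊗ₜ φ.symm (ψ (stdVector q a c))) v₀
      rw [LinearEquiv.baseChange_tmul] at e
      refine e.trans ((baseChange_eq_zero_iff_of_ker (fun y => ?_) v₀).1 hβv)
      have h1 := hg (ψ.symm y)
      rw [ψ.symm.map_app] at h1
      rw [h1, ← φ.map_app, isometry_apply_symm, hφ, ψ.map_app]
  have hn : complexCoords ψ v₁ (.inl 3) ≠ 0 :=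
    coord_ne_zero_of_mem_modelCone ((complexCoords_mem_modelCone ψ).2 hv₁)
  obtain ⟨v₂, hv₂, e₂, o₂, n₂⟩ : ∃ v, ∃ hv : v ∈ periodCone (perpForm B h),
      PeriodSpace.mk B h (PeriodDomain.mk _ v hv) = PeriodSpace.mk B h (PeriodDomain.mk _ v₀ hv₀) ∧
      modelForm ℂ (fun i => (stdVector q a c i : ℂ)) (complexCoords ψ v) = 0 ∧
      complexCoords ψ v (.inl 3) = 1 := by
    refine ⟨_, smul_mem_periodCone (inv_ne_zero hn) hv₁, ?_, ?_, ?_⟩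
    · rw [PeriodDomain.mk_smul (inv_ne_zero hn) hv₁, e₁]
    · rw [map_smul, map_smul, o₁, smul_zero]
    · rw [map_smul, Pi.smul_apply, smul_eq_mul, inv_mul_cancel₀ hn]
  have hc₂ := (complexCoords_mem_modelCone ψ).2 hv₂
  have ht := tubeForm_im_pos hc₂ n₂
  have h0 : (complexCoords ψ v₂ (.inl 0)).im ≠ 0 := (ne_zero_of_tubeForm_pos ht)
  rcases h0.lt_or_gt with hneg | hpos
  -- When the imaginary part is in the opposite cone, `negPlane` followed by the scalar -1 fixes
  -- coordinates 2 and 3 and negates the others. It keeps the normalization and the orthogonality,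
  -- and exchanges the two components.
  · let η : (perpForm B h).IsometryEquiv (perpForm B h) := ψ.symm.trans (negPlane.trans ψ)
    have hη : ∀ i, complexCoords ψ
        ((-1 : ℂ) • (η : perp B h ≃ₗ[ℤ] perp B h).baseChange ℤ ℂ _ _ v₂) i =
        if i = .inl 2 ∨ i = .inl 3 then complexCoords ψ v₂ i else -complexCoords ψ v₂ i := by
      intro i
      rw [map_smul, Pi.smul_apply, complexCoords_baseChange_negPlane]
      split_ifs <;> simp
    have hm := map_mem_periodCone η hv₂
    have hs := smul_mem_periodCone (neg_ne_zero.2 one_ne_zero) hm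
    have hs' := (complexCoords_mem_modelCone ψ).2 hs
    have n₃ := hη (.inl 3)
    rw [if_pos (Or.inr rfl), n₂] at n₃
    refine ⟨_, hs, ?_, ⟨hs', n₃, ?_, tubeForm_im_pos hs' n₃⟩, ?_⟩
    · rw [PeriodDomain.mk_smul (neg_ne_zero.2 one_ne_zero) hm, ← PeriodDomain.map_mk η hv₂,
        PeriodSpace.mk_map (hγ η), e₂]
    · change 0 < (complexCoords ψ _ _).im
      rw [hη, if_neg (by simp), Complex.neg_im]
      linarith
    · rw [modelForm_stdVector_complex] at o₂ ⊢
      rw [hη, hη, hη, hη, if_neg (by simp), if_neg (by simp), if_neg (by simp), if_neg (by simp)]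
      linear_combination -o₂
  · exact ⟨v₂, hv₂, e₂, ⟨hc₂, n₂, hpos, ht⟩, o₂⟩

/-- Given a point outside Z₁ and a point outside Z₂, lift both to the same tube domain and the same
hyperplane. The curve joining the lifts maps into Z, hence into Z₁ ∪ Z₂, so it stays in one of them,
which is absurd. -/
theorem isIrreducibleAnalytic_image_heegnerLocus (hγ : ∀ γ, InPeriodGroup B h γ)
    (ψ : (modelForm ℤ).IsometryEquiv (perpForm B h)) (hd : 0 < d)
    (hne : (PeriodSpace.mk B h '' heegnerLocus (perpForm B h) d).Nonempty) :
    IsIrreducibleAnalytic (PeriodSpace.mk B h '' heegnerLocus (perpForm B h) d) := by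
  refine ⟨isClosedAnalytic_image_heegnerLocus ψ hd, hne, fun Z₁ Z₂ h₁ h₂ hZ => ?_⟩
  obtain ⟨_, x, ⟨β, hβ, -⟩, -⟩ := hne
  obtain ⟨q, a, c, hq, -, H⟩ :=
    exists_stdVector_of_mem_heegnerVectors (map_mem_heegnerVectors ψ.symm hβ)
  by_contra! hno
  rw [Set.not_subset, Set.not_subset] at hno
  obtain ⟨⟨p₁, hp₁, hn₁⟩, p₂, hp₂, hn₂⟩ := hno
  obtain ⟨v, hv, rfl, hvt, hvo⟩ := exists_lift hγ ψ H hp₁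
  obtain ⟨w, hw, rfl, hwt, hwo⟩ := exists_lift hγ ψ H hp₂
  obtain ⟨Ω, F, hΩ, hc, hF, hFΩ, ⟨s, hs, hsv⟩, t, ht, htw⟩ := exists_curve hvt hwt hvo hwo
  have hD : ∀ s ∈ Ω, (complexCoords ψ).symm (F s) ∈ periodCone (perpForm B h) := fun s hs => by
    rw [← complexCoords_mem_modelCone ψ, LinearEquiv.apply_symm_apply]
    exact (hFΩ s hs).1
  have hdiff : Differentiable ℂ fun s => (Module.finBasis ℂ (ℂ ⊗[ℤ] perp B h)).equivFun
      ((complexCoords ψ).symm (F s)) :=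
    (LinearMap.toContinuousLinearMap
      ((Module.finBasis ℂ (ℂ ⊗[ℤ] perp B h)).equivFun.toLinearMap ∘ₗ
        (complexCoords ψ).symm.toLinearMap)).differentiable.comp hF
  rcases subset_or_subset_of_curve h₁ h₂ hΩ hc hdiff hD (fun s hs => by
    have hm : PeriodSpace.mk B h (PeriodDomain.mk _ _ (hD s hs)) ∈
        PeriodSpace.mk B h '' heegnerLocus (perpForm B h) d := by
      refine Set.mem_image_of_mem _ ((mk_mem_heegnerLocus_iff _).2 ⟨ψ (stdVector q a c),
        map_mem_heegnerVectors ψ (stdVector_mem_heegnerVectors hd hq), ?_⟩)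
      rw [baseChange_one_tmul_eq, LinearEquiv.apply_symm_apply]
      exact (hFΩ s hs).2
    exact (hZ hm).imp (fun h => ⟨_, h⟩) fun h => ⟨_, h⟩) with h | h
  · obtain ⟨hv', hm⟩ := h s hs
    simp only [hsv, LinearEquiv.symm_apply_apply] at hm
    exact hn₁ hm
  · obtain ⟨hw', hm⟩ := h t ht
    simp only [htw, LinearEquiv.symm_apply_apply] at hm
    exact hn₂ hm

end Irreducible

theorem k3mForm_symm (m : ℕ) (x y : K3mLattice) : k3mForm m x y = k3mForm m y x := by
  rw [k3mForm_coords, k3mForm_coords, k3Form_symm]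
  ring

end K3Heegner

end

/-! ### The main theorem. -/

open K3Heegner in
theorem mainTheorem11 (h₂ h₃ : K3mLattice)
    (hsq₂ : k3mForm 2 h₂ h₂ = 2) (hdiv₂ : HasDivisibility (k3mForm 2) h₂ 1)
    (hsq₃ : k3mForm 3 h₃ h₃ = 4) (hdiv₃ : HasDivisibility (k3mForm 3) h₃ 2) :
    (perpForm (k3mForm 2) h₂).Equivalent (perpForm (k3mForm 3) h₃) ∧
    ∀ d : ℕ, 0 < d →
      ((heegnerDivisor (k3mForm 3) h₃ d).Nonempty ↔ ∃ e : ℕ, d = 2 * e ∧ ¬ e ≡ 3 [MOD 4]) ∧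
      ((heegnerDivisor (k3mForm 3) h₃ d).Nonempty →
        IsIrreducibleAnalytic (heegnerDivisor (k3mForm 3) h₃ d) ∧
        ∀ φ : (perpForm (k3mForm 2) h₂).IsometryEquiv (perpForm (k3mForm 3) h₃),
          rho hsq₃ hdiv₃ φ '' heegnerDivisor (k3mForm 2) h₂ d =
            heegnerDivisor (k3mForm 3) h₃ d) := by
  obtain ⟨ψ₂⟩ := model_equivalent_perp_two hsq₂ hdiv₂
  obtain ⟨ψ₃⟩ := model_equivalent_perp_three hsq₃ hdiv₃
  refine ⟨⟨ψ₂.symm.trans ψ₃⟩, fun d hd => ?_⟩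
  rw [heegnerDivisor_eq (k3mForm_symm 3) (by rw [hsq₃]; norm_num) d,
    heegnerDivisor_eq (k3mForm_symm 2) (by rw [hsq₂]; norm_num) d]
  refine ⟨?_, fun hne => ⟨isIrreducibleAnalytic_image_heegnerLocus
    (inPeriodGroup_of_sq_of_div hsq₃ hdiv₃) ψ₃ hd hne, fun φ => ?_⟩⟩
  · rw [Set.image_nonempty, heegnerLocus_nonempty_iff ψ₃ hd]
  -- After the locus of h₃ is written as the image by φ of that of h₂, both sides are images of one
  -- set by maps that agree by definition of `rho`.
  · rw [← map_image_heegnerLocus φ, Set.image_image, Set.image_image]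
    rfl
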